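/- \textbf{Theorem (Solution relationship).} \emph{CLS.} Let $f_{\mathrm v}:\mathbb R^{n}\times\mathbb R^{n}\times\mathbb R^{m}\to\mathbb R^{n}$, $M:\mathbb R^{n}\to\mathbb R^{n\times n}$, $f_c:\mathbb R^{n}\to\mathbb R$ be twice continuously differentiable, $M(q)$ symmetric positive definite, $n(q):=\nabla f_c(q)\neq 0$ whenever $f_c(q)=0$. Put $D(q)=n(q)^\top M(q)^{-1}n(q)$ and $\varphi(q,v,u)=n(q)^\top f_{\mathrm v}(q,v,u)+\nabla_q(n(q)^\top v)^\top v$. For a bounded measurable control $u(t)$, the complementarity Lagrangian system (CLS) with inelastic impacts is \[\dot q=v,\quad \dot v=f_{\mathrm v}(q,v,u)+M(q)^{-1}n(q)\lambda_{\mathrm n},\quad 0\le\lambda_{\mathrm n}\perp f_c(q)\ge 0,\quad n(q(t))^\top v(t^+)=0\ \text{ if } f_c(q(t))=0,\ n(q(t))^\top v(t^-)<0 .\] The times $t$ in the last condition are called impact times. A solution $x=(q,v)$ on $[0,t_{\mathrm f}]$ with initial value $(q_0,v_0)$ consists of a continuous $q$, a right-continuous $v$ of bounded variation with $v(0^-)=v_0$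 (so $v(0)=v_0$ unless $0$ is an impact time), and a force $\lambda_{\mathrm n}$ which is an integrable function plus finitely many nonnegative Dirac impulses located at impact times; the differential equations hold in integrated form and the complementarity of the function part holds almost everywhere. \emph{Time-freezing system.} Fix $a_{\mathrm n}>0$. For $y=(q,v,t)\in\mathbb R^{2n+1}$ let $c_1(y)=f_c(q)$, $c_2(y)=n(q)^\top v$, $R_1=\{c_1>0\}\cup\{c_1<0,\,c_2>0\}$, $R_2=\{c_1<0,\,c_2<0\}$, $\Sigma=\{c_1=c_2=0\}$, $f_1(y,w)=(v,f_{\mathrm v}(q,v,w),1)$ and $f_2(y)=(0,M(q)^{-1}n(q)a_{\mathrm n},0)$. For a control $w(\tau)$, a solution on $[0,\tau_{\mathrm f}]$ is an absolutely continuous $y=(q,v,t)$ satisfying, for almost every $\tau$, \[y'\in\{\theta_1f_1(y,w)+\theta_2f_2(y)\mid \theta_1,\theta_2\ge0,\ \theta_1+\theta_2=1,\ \theta_i=0\text{ if }y\notin\overline{R_i}\}.\] Call a state $y$ impacting if $c_1(y)=0$ and $c_2(y)<0$. The controls $u$, $w$ agree along $y$ if $w(\tau)=u(t(\tau))$ for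 all $\tau\in[0,\tau_{\mathrm f}]$ at which $y(\tau)$ is not impacting. \emph{Relation.} Let $y$ be a trajectory of the time-freezing system on $[0,\tau_{\mathrm f}]$ and $x$ one of the CLS on $[0,t_{\mathrm f}]$, $t_{\mathrm f}=t(\tau_{\mathrm f})$. They are \emph{related} if: \begin{enumerate} \item $x(t(\tau))=Ry(\tau)$, $R=[\,I_{2n}\ \ 0\,]$, for every $\tau\in[0,\tau_{\mathrm f}]$ such that $t(\tau)$ is not an impact time of $x$; and for almost every $t\in[0,t_{\mathrm f}]$ and every $\tau$ with $t(\tau)=t$, the function part of $\lambda_{\mathrm n}$ satisfies $\lambda_{\mathrm n}(t)=-D(q(t))^{-1}\varphi(x(t),u(t))$ if $y(\tau)\in\Sigma$ and $\lambda_{\mathrm n}(t)=0$ otherwise; \item for every impact time $t_{\mathrm s}$ of $x$ there are $0\le\tau_{\mathrm s}<\tau_{\mathrm r}\le\tau_{\mathrm f}$ such that $\{\tau\in[0,\tau_{\mathrm f}]\mid t(\tau)=t_{\mathrm s}\}=[\tau_{\mathrm s},\tau_{\mathrm r}]$, $y$ is impacting on $[\tau_{\mathrm s},\tau_{\mathrm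 r})$, $y(\tau_{\mathrm r})\in\Sigma$, and \[\lim_{\epsilon\downarrow0}\int_{t_{\mathrm s}-\epsilon}^{t_{\mathrm s}+\epsilon}\lambda_{\mathrm n}(t)\,\mathrm dt=\int_{\tau_{\mathrm s}}^{\tau_{\mathrm r}}a_{\mathrm n}\,\mathrm d\tau,\] where the left-hand integral includes Dirac impulses. \end{enumerate} \emph{Claim.} Let $f_c(q_0)\ge0$ and let $u$ be a bounded measurable control. \begin{enumerate} \item[(A)] Let $y$ be a solution of the time-freezing system on $[0,\tau_{\mathrm f}]$ with $y(0)=(q_0,v_0,0)$ and a control $w$ that agrees with $u$ along $y$, such that $y(\tau_{\mathrm f})$ is not impacting (as is the case if $n(q(\tau_{\mathrm f}))^\top v(\tau_{\mathrm f})\ge0$) and $t(\tau)$ takes at most one value on the set of those $\tau$ for which $y(\tau)$ is impacting. Then there is a solution of the CLS on $[0,t(\tau_{\mathrm f})]$ with initial value $(q_0,v_0)$ and control $u$, with at most one impact time, that is related to $y$. \item[(B)] Let $x$ be a solution of the CLS on $[0,t_{\mathrm f}]$, $t_{\mathrm f}\ge0$, with initial value $(q_0,v_0)$, control $u$ and at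 most one impact time. Then there are $\tau_{\mathrm f}\ge0$ and a trajectory $y$ on $[0,\tau_{\mathrm f}]$ related to $x$, with $t(\tau_{\mathrm f})=t_{\mathrm f}$, with $y(\tau_{\mathrm f})$ not impacting and with at most one value of $t(\tau)$ at impacting states, that is a solution of the time-freezing system with $y(0)=(q_0,v_0,0)$ for every control $w$ that agrees with $u$ along $y$. \item[(C)] Suppose in addition that $c_2$ is twice continuously differentiable. Let $y$ be any solution of the time-freezing system on $[0,\tau_{\mathrm f}]$ with $y(0)=(q_0,v_0,0)$ and a control that agrees with $u$ along $y$, such that $y(\tau_{\mathrm f})$ is not impacting and contact is made or lost only finitely often (the set $\{\tau\in[0,\tau_{\mathrm f}]\mid c_1(y(\tau))=0\}$ has finite boundary), and let $x$ be any solution of the CLS on $[0,t(\tau_{\mathrm f})]$ with initial value $(q_0,v_0)$ and control $u$. If $x$ has at most one impact time, or $t(\tau)$ takes at most one value at impacting states of $y$, then $y$ and $x$ are related. \end{enumerate} -/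

import Mathlib

open Set Filter Topology MeasureTheory

noncomputable section

/-- Positions, velocities and controls are vectors of a Euclidean space. -/
abbrev Vec (n : ℕ) := EuclideanSpace ℝ (Fin n)

/-- The state `y = (q, v, t)` of the time-freezing system. -/
abbrev TFState (n : ℕ) := Vec n × Vec n × ℝ

/-- The data of a complementarity Lagrangian system with one unilateral constraint `fc q ≥ 0`:
acceleration `fv`, inertia matrix `M`, constraint function `fc`. The gradient of `fc` does not
vanish on the constraint surface (equivalently, the Delassus scalar `D` is positive there). -/
structure CLS (n m : ℕ) where
  fv : Vec n → Vec n → Vec m → Vec n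
  M : Vec n → Matrix (Fin n) (Fin n) ℝ
  fc : Vec n → ℝ
  fv_smooth : ContDiff ℝ 2 (fun p : Vec n × Vec n × Vec m => fv p.1 p.2.1 p.2.2)
  M_smooth : ∀ i j, ContDiff ℝ 2 (fun q => M q i j)
  fc_smooth : ContDiff ℝ 2 fc
  M_posDef : ∀ q, (M q).PosDef
  normal_ne_zero : ∀ q, fc q = 0 → gradient fc q ≠ 0

/-- A candidate trajectory of a CLS in physical time: position `q`, velocity `v`, and the normal
contact force, which consists of a function `lam` and of finitely many Dirac impulses, the one at
time `s` having size `imp s`. -/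
structure CLSTraj (n : ℕ) where
  q : ℝ → Vec n
  v : ℝ → Vec n
  lam : ℝ → ℝ
  imp : ℝ →₀ ℝ

/-- The normal contact force on `[0, tf]` as a measure, Dirac impulses included. -/
def CLSTraj.contactForce {n : ℕ} (x : CLSTraj n) (tf : ℝ) : Measure ℝ :=
  (volume.restrict (Icc 0 tf)).withDensity (fun t => ENNReal.ofReal (x.lam t)) +
    ∑ s ∈ x.imp.support, ENNReal.ofReal (x.imp s) • Measure.dirac s

namespace CLS

variable {n m : ℕ} (S : CLS n m)

/-- The constraint normal `n(q) = ∇ fc(q)`. -/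
def normal (q : Vec n) : Vec n := gradient S.fc q

/-- The vector `M(q)⁻¹ n(q)`. -/
def invMn (q : Vec n) : Vec n := Matrix.toEuclideanLin (S.M q)⁻¹ (S.normal q)

/-- The Delassus scalar `D(q) = n(q)ᵀ M(q)⁻¹ n(q)`. -/
def D (q : Vec n) : ℝ := inner ℝ (S.normal q) (S.invMn q)

/-- `φ(q, v, u) = n(q)ᵀ fv(q, v, u) + ∇_q (n(q)ᵀ v)ᵀ v`. -/
def phi (q v : Vec n) (u : Vec m) : ℝ :=
  inner ℝ (S.normal q) (S.fv q v u) +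
    inner ℝ (gradient (fun p => inner ℝ (S.normal p) v) q) v

/-! ### The system in physical time -/

/-- `t ∈ [0, tf]` is an impact time of the trajectory: contact with `n(q(t))ᵀ v(t⁻) < 0`. -/
def IsImpactTime (tf : ℝ) (x : CLSTraj n) (t : ℝ) : Prop :=
  t ∈ Icc 0 tf ∧ S.fc (x.q t) = 0 ∧ inner ℝ (S.normal (x.q t)) (Function.leftLim x.v t) < 0

/-- Solutions on `[0, tf]` of the CLS with inelastic impacts,
`q' = v`, `v' = fv(q, v, u) + M(q)⁻¹ n(q) λ`, `0 ≤ λ ⊥ fc(q) ≥ 0`,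
`n(q(t))ᵀ v(t⁺) = 0` at every impact time `t`,
started in `(q0, v0)`. The position is continuous. The velocity has bounded variation and is
normalised to be right-continuous, so `v t` is `v(t⁺)`; it is extended by `v0` to negative times, so
that `v(0⁻) = v0`, and `v(0) = v0` unless the system is started in an impact. Outside the impact
times the contact force is a function; impulses occur only at impact times. -/
structure IsSolution (u : ℝ → Vec m) (q0 v0 : Vec n) (tf : ℝ) (x : CLSTraj n) : Prop where
  lam_integrable : IntegrableOn x.lam (Icc 0 tf)
  fv_integrable : IntegrableOn (fun s => S.fv (x.q s) (x.v s) (u s)) (Icc 0 tf)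
  v_integrable : IntegrableOn x.v (Icc 0 tf)
  v_init : ∀ t < 0, x.v t = v0
  q_eq : ∀ t ∈ Icc 0 tf, x.q t = q0 + ∫ s in (0 : ℝ)..t, x.v s
  v_eq : ∀ t ∈ Icc 0 tf, x.v t = v0
    + (∫ s in (0 : ℝ)..t, (S.fv (x.q s) (x.v s) (u s) + x.lam s • S.invMn (x.q s)))
    + ∑ s ∈ x.imp.support with s ≤ t, x.imp s • S.invMn (x.q s)
  fc_nonneg : ∀ t ∈ Icc 0 tf, 0 ≤ S.fc (x.q t)
  compl : ∀ᵐ t ∂(volume.restrict (Icc 0 tf)), 0 ≤ x.lam t ∧ x.lam t * S.fc (x.q t) = 0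
  imp_nonneg : ∀ t, 0 ≤ x.imp t
  imp_only : ∀ t, x.imp t ≠ 0 → S.IsImpactTime tf x t
  impact_law : ∀ t, S.IsImpactTime tf x t → inner ℝ (S.normal (x.q t)) (x.v t) = 0

/-! ### The time-freezing system -/

/-- First switching function. -/
def c1 (y : TFState n) : ℝ := S.fc y.1

/-- Second switching function. -/
def c2 (y : TFState n) : ℝ := inner ℝ (S.normal y.1) y.2.1

def R1 : Set (TFState n) := {y | 0 < S.c1 y} ∪ {y | S.c1 y < 0 ∧ 0 < S.c2 y}

def R2 : Set (TFState n) := {y | S.c1 y < 0 ∧ S.c2 y < 0}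

/-- The set on which the sliding mode evolves. -/
def Sigma : Set (TFState n) := {y | S.c1 y = 0 ∧ S.c2 y = 0}

/-- States at which an impact takes place. -/
def Impacting : Set (TFState n) := {y | S.c1 y = 0 ∧ S.c2 y < 0}

/-- Unconstrained dynamics with a running clock. -/
def f1 (y : TFState n) (u : Vec m) : TFState n := (y.2.1, S.fv y.1 y.2.1 u, 1)

/-- Auxiliary dynamics with a stopped clock. -/
def faux (a : ℝ) (y : TFState n) : TFState n := (0, a • S.invMn y.1, 0)

/-- The Filippov set of the time-freezing system. -/
def filippov (a : ℝ) (y : TFState n) (u : Vec m) : Set (TFState n) :=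
  {z | ∃ θ₁ θ₂ : ℝ, 0 ≤ θ₁ ∧ 0 ≤ θ₂ ∧ θ₁ + θ₂ = 1 ∧
    (y ∉ closure S.R1 → θ₁ = 0) ∧ (y ∉ closure S.R2 → θ₂ = 0) ∧
    z = θ₁ • S.f1 y u + θ₂ • S.faux a y}

/-- Filippov solutions on `[0, τf]` with `y(0) = y0`: absolutely continuous functions, that is,
indefinite integrals of an integrable function `g`, with `y' = g ∈ F(y, w)` almost everywhere. -/
def IsTFSolution (a : ℝ) (w : ℝ → Vec m) (y0 : TFState n) (τf : ℝ) (y : ℝ → TFState n) : Prop :=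
  ∃ g : ℝ → TFState n, IntegrableOn g (Icc 0 τf) ∧
    (∀ τ ∈ Icc 0 τf, y τ = y0 + ∫ s in (0 : ℝ)..τ, g s) ∧
    ∀ᵐ τ ∂(volume.restrict (Icc 0 τf)), g τ ∈ S.filippov a (y τ) (w τ)

/-- The control `w` in numerical time and the control `u` in physical time agree,
`w(τ) = u(t(τ))`, as long as the clock is not stopped by an impact. -/
def ControlsAgree (u w : ℝ → Vec m) (τf : ℝ) (y : ℝ → TFState n) : Prop :=
  ∀ τ ∈ Icc 0 τf, y τ ∉ S.Impacting → w τ = u (y τ).2.2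

/-- At most one physical time `t(τ)` at which `y` is in an impact. -/
def AtMostOneImpactTF (τf : ℝ) (y : ℝ → TFState n) : Prop :=
  ∀ τ ∈ Icc 0 τf, ∀ σ ∈ Icc 0 τf, y τ ∈ S.Impacting → y σ ∈ S.Impacting → (y τ).2.2 = (y σ).2.2

/-- At most one impact time of a trajectory in physical time. -/
def AtMostOneImpact (tf : ℝ) (x : CLSTraj n) : Prop :=
  ∀ t s, S.IsImpactTime tf x t → S.IsImpactTime tf x s → t = s

open Classical in
/-- The relation between a trajectory `y` of the time-freezing system on `[0, τf]` and a trajectory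
`x` of the CLS on `[0, t(τf)]`, where `t(τ)` is the clock state of `y`. -/
structure Related (a : ℝ) (u : ℝ → Vec m) (τf : ℝ) (y : ℝ → TFState n) (x : CLSTraj n) :
    Prop where
  /-- `x(t(τ)) = R y(τ)` whenever `t(τ)` is not an impact time. -/
  state_eq : ∀ τ ∈ Icc 0 τf, ¬ S.IsImpactTime (y τf).2.2 x (y τ).2.2 →
    (x.q (y τ).2.2, x.v (y τ).2.2) = ((y τ).1, (y τ).2.1)
  /-- The contact force at almost every time `t = t(τ)`. -/
  lam_eq : ∀ᵐ t ∂(volume.restrict (Icc 0 (y τf).2.2)), ∀ τ ∈ Icc 0 τf, (y τ).2.2 = t →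
    x.lam t = if y τ ∈ S.Sigma then -((S.D (x.q t))⁻¹ * S.phi (x.q t) (x.v t) (u t)) else 0
  /-- At an impact time `ts` the clock stands still exactly on an interval `[τs, τr]`, at the end of
  which `Sigma` is reached, and the impulse of the contact force is `∫ a dτ` over it. -/
  impulse_eq : ∀ ts, S.IsImpactTime (y τf).2.2 x ts → ∃ τs τr, 0 ≤ τs ∧ τs < τr ∧ τr ≤ τf ∧
    (∀ τ ∈ Icc 0 τf, (y τ).2.2 = ts ↔ τ ∈ Icc τs τr) ∧
    (∀ τ ∈ Ico τs τr, y τ ∈ S.Impacting) ∧ y τr ∈ S.Sigma ∧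
    Tendsto (fun ε => (x.contactForce (y τf).2.2).real (Icc (ts - ε) (ts + ε))) (𝓝[>] 0)
      (𝓝 (∫ _τ in τs..τr, a))

end CLS

end

/-! The two systems differ by a change of time. Along a Filippov solution the clock runs at the rate
`θ`, the weight of the unconstrained dynamics, while the auxiliary dynamics add `(1 - θ) a M⁻¹ n` to
the acceleration. What determines `θ` is that a derivative vanishes almost everywhere on the zero
set of its function (`ae_deriv_eq_zero_of_eq_zero`). On `c1 = 0` the derivative `θ c2` of `c1`
vanishes, so the clock is stopped during an impact. On `Sigma` the derivative `θ φ + (1 - θ) a D` of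
`c2` vanishes, so `(1 - θ) a = θ λ` with `λ = -φ / D`. Off these sets `θ = 1` almost everywhere.
Hence, while the clock runs, the auxiliary dynamics are the contact force (`ae_not_impacting`);
while it stands still, `c2` grows linearly and stays negative before the end of the pause
(`impacting_of_t_eq`), and a maximal pause ends with `c2 = 0`. Such a pause is an inelastic impact,
with impulse `a` times its length. In physical time the same argument determines the contact force
(`ae_contact`).

For (A), `y` is read off at the last numerical time with a given clock value (`lastTime`). The clock
maps `θ dτ` to Lebesgue measure (`map_clock_withDensity`), so the integral equations follow by
substitution, and the jumps of the velocity are the pauses.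

For (B), numerical time is physical time plus `a⁻¹` times the impulse of the contact force so far,
Dirac impulses included (`dilate`). The generalised inverse of this function is the clock, and
across each of its jumps the velocity is interpolated linearly (`freeze`). The clock maps Lebesgue
measure to the Stieltjes measure of `dilate` (`map_dilateClock`); integrated against it, the
Filippov field gives back the integral equations of `x`.

For (C), finitely many boundary points of the contact set leave finitely many impact times
(`finite_impactTimes`), so the construction of (A) gives one related solution, and uniqueness in
physical time remains. It is local, and just after each time the constructed solution is either in
contact or free (`phases`). A free solution is compared with any other in `exists_eq_of_free`: a
contact force of the second would only push it further from the constraint. In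
`exists_eq_of_contact` the normal velocity of the second solution is bounded above by the integrated
distance, and its integral is nonnegative since `fc ≥ 0`. Impacts are determined by left limits
(`jump_eq`). -/

noncomputable section

/-! ### Indefinite integrals -/

/-- `F` is an indefinite integral of the integrable function `g` on `[a, b]`. -/
def IsPrimitiveOn {E : Type*} [NormedAddCommGroup E] [NormedSpace ℝ E] (F g : ℝ → E) (a b : ℝ) :
    Prop :=
  IntegrableOn g (Icc a b) ∧ ∀ t ∈ Icc a b, F t = F a + ∫ s in a..t, g s

/-- Meant for `N` the integral of a norm, which dominates the increments both of an indefinite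
integral and of its image under a Lipschitz map. -/
theorem AbsolutelyContinuousOnInterval.of_dist_le {X Y : Type*} [PseudoMetricSpace X]
    [PseudoMetricSpace Y] {f : ℝ → X} {N : ℝ → Y} {a b K : ℝ}
    (hN : AbsolutelyContinuousOnInterval N a b)
    (h : ∀ x ∈ uIcc a b, ∀ y ∈ uIcc a b, dist (f x) (f y) ≤ K * dist (N x) (N y)) :
    AbsolutelyContinuousOnInterval f a b := by
  rw [absolutelyContinuousOnInterval_iff] at hN ⊢
  intro ε hε
  -- No sign is assumed for `K`; `|K| + 1` is a positive number above it.
  obtain ⟨δ, hδ, H⟩ := hN (ε / (|K| + 1)) (by positivity)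
  refine ⟨δ, hδ, fun E hE hEδ => ?_⟩
  have h1 := H E hE hEδ
  calc ∑ i ∈ Finset.range E.1, dist (f (E.2 i).1) (f (E.2 i).2)
      ≤ ∑ i ∈ Finset.range E.1, (|K| + 1) * dist (N (E.2 i).1) (N (E.2 i).2) := by
        refine Finset.sum_le_sum fun i hi => (h _ (hE.1 i hi).1 _ (hE.1 i hi).2).trans ?_
        gcongr
        linarith [le_abs_self K]
    _ = (|K| + 1) * ∑ i ∈ Finset.range E.1, dist (N (E.2 i).1) (N (E.2 i).2) := by
        rw [Finset.mul_sum]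
    _ < (|K| + 1) * (ε / (|K| + 1)) := by gcongr
    _ = ε := by field_simp

/-- A function that is differentiable almost everywhere has derivative zero almost everywhere on its
zero set. -/
theorem ae_deriv_eq_zero_of_eq_zero {E : Type*} [NormedAddCommGroup E] [NormedSpace ℝ E]
    {F g : ℝ → E} {s : Set ℝ} (h : ∀ᵐ t ∂(volume.restrict s), HasDerivAt F (g t) t) :
    ∀ᵐ t ∂(volume.restrict s), F t = 0 → g t = 0 := by
  -- Only countably many points of a set are isolated in it from the right. At any other zero the
  -- derivative is a limit of slopes between zeros.
  have hc : {x ∈ {t | F t = 0} | 𝓝[{t | F t = 0} ∩ Ioi x] x = ⊥}.Countable :=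
    countable_setOfPred_isolated_right_within
  have hc' : ∀ᵐ t ∂(volume.restrict s),
      t ∉ {x ∈ {t | F t = 0} | 𝓝[{t | F t = 0} ∩ Ioi x] x = ⊥} :=
    ae_restrict_of_ae (measure_eq_zero_iff_ae_notMem.1 (hc.measure_zero _))
  filter_upwards [h, hc'] with t ht hn h0
  have hne : (𝓝[{t | F t = 0} ∩ Ioi t] t).NeBot := ⟨fun hb => hn ⟨h0, hb⟩⟩
  have h1 : HasDerivWithinAt F (g t) ({t | F t = 0} ∩ Ioi t) t := ht.hasDerivWithinAt
  rw [hasDerivWithinAt_iff_tendsto_slope' (by simp)] at h1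
  refine tendsto_nhds_unique h1 (tendsto_const_nhds.congr' ?_)
  filter_upwards [self_mem_nhdsWithin] with s hs
  have : F s = 0 := hs.1
  simp [slope, this, show F t = 0 from h0]

namespace IsPrimitiveOn

variable {E E' : Type*} [NormedAddCommGroup E] [NormedSpace ℝ E]
  [NormedAddCommGroup E'] [NormedSpace ℝ E'] {F g : ℝ → E} {a b : ℝ}

theorem intervalIntegrable (h : IsPrimitiveOn F g a b) {s t : ℝ} (hs : s ∈ Icc a b)
    (ht : t ∈ Icc a b) : IntervalIntegrable g volume s t := by
  refine intervalIntegrable_iff.2 (h.1.mono_set (uIoc_subset_uIcc.trans ?_))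
  exact (convex_Icc a b).ordConnected.uIcc_subset hs ht

theorem sub_eq (h : IsPrimitiveOn F g a b) {s t : ℝ} (hs : s ∈ Icc a b)
    (ht : t ∈ Icc a b) : F t - F s = ∫ r in s..t, g r := by
  have ha : a ∈ Icc a b := ⟨le_rfl, hs.1.trans hs.2⟩
  rw [h.2 t ht, h.2 s hs, ← intervalIntegral.integral_add_adjacent_intervals
    (h.intervalIntegrable ha hs) (h.intervalIntegrable hs ht)]
  abel

theorem mono (h : IsPrimitiveOn F g a b) {c d : ℝ} (hc : a ≤ c) (hd : d ≤ b) :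
    IsPrimitiveOn F g c d := by
  refine ⟨h.1.mono_set (Icc_subset_Icc hc hd), fun t ht => ?_⟩
  rw [← h.sub_eq ⟨hc, ht.1.trans (ht.2.trans hd)⟩ ⟨hc.trans ht.1, ht.2.trans hd⟩]
  abel

theorem congr_ae (h : IsPrimitiveOn F g a b) {g' : ℝ → E}
    (hg : ∀ᵐ t ∂(volume.restrict (Icc a b)), g t = g' t) : IsPrimitiveOn F g' a b := by
  refine ⟨h.1.congr hg, fun t ht => ?_⟩
  rw [h.2 t ht]
  congr 1
  refine intervalIntegral.integral_congr_ae ?_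
  rw [ae_restrict_iff' measurableSet_Icc] at hg
  filter_upwards [hg] with s hs hst
  rw [uIoc_of_le ht.1] at hst
  exact hs ⟨hst.1.le, hst.2.trans ht.2⟩

theorem continuousOn (h : IsPrimitiveOn F g a b) : ContinuousOn F (Icc a b) := by
  refine ContinuousOn.congr (f := fun t => F a + ∫ s in a..t, g s) ?_ h.2
  rcases le_or_gt a b with hab | hab
  · have := intervalIntegral.continuousOn_primitive_interval (μ := volume) (f := g) (a := a) (b := b)
      (by rw [uIcc_of_le hab]; exact h.1)
    rw [uIcc_of_le hab] at this
    exact continuousOn_const.add this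
  · simp [Icc_eq_empty hab.not_ge]

theorem prodMk {G k : ℝ → E'} (h : IsPrimitiveOn F g a b) (h' : IsPrimitiveOn G k a b)
    [CompleteSpace E] [CompleteSpace E'] :
    IsPrimitiveOn (fun t => (F t, G t)) (fun t => (g t, k t)) a b := by
  have hi : IntegrableOn (fun t => (g t, k t)) (Icc a b) := h.1.prodMk h'.1
  refine ⟨hi, fun t ht => ?_⟩
  have hii : IntegrableOn (fun t => (g t, k t)) (Ioc a t) :=
    hi.mono_set (Ioc_subset_Icc_self.trans (Icc_subset_Icc_right ht.2))
  beta_reduce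
  rw [h.2 t ht, h'.2 t ht, intervalIntegral.integral_of_le ht.1, intervalIntegral.integral_of_le ht.1,
    intervalIntegral.integral_of_le ht.1]
  ext1
  · simp [fst_integral hii]
  · simp [snd_integral hii]

theorem ae_hasDerivAt [CompleteSpace E] (h : IsPrimitiveOn F g a b) :
    ∀ᵐ t ∂(volume.restrict (Icc a b)), HasDerivAt F (g t) t := by
  rw [ae_restrict_iff' measurableSet_Icc]
  rcases lt_or_ge a b with hab | hab
  · have hi : IntervalIntegrable g volume a b :=
      h.intervalIntegrable ⟨le_rfl, hab.le⟩ ⟨hab.le, le_rfl⟩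
    have h1 : ∀ᵐ x : ℝ, x ≠ a := by simp [ae_iff, measure_singleton]
    have h2 : ∀ᵐ x : ℝ, x ≠ b := by simp [ae_iff, measure_singleton]
    filter_upwards [hi.ae_hasDerivAt_integral, h1, h2] with t ht ha hb hI
    rw [uIcc_of_le hab.le] at ht
    have := (ht hI a ⟨le_rfl, hab.le⟩).const_add (F a)
    refine this.congr_of_eventuallyEq ?_
    filter_upwards [Icc_mem_nhds (lt_of_le_of_ne hI.1 ha.symm) (lt_of_le_of_ne hI.2 hb)] with s hs
    exact h.2 s hs
  · have h1 : ∀ᵐ x : ℝ, x ≠ a := by simp [ae_iff, measure_singleton]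
    filter_upwards [h1] with t ht hI
    exact absurd (le_antisymm (hI.2.trans hab) hI.1) ht

theorem monotoneOn {F g : ℝ → ℝ} (h : IsPrimitiveOn F g a b)
    (hg : ∀ᵐ t ∂(volume.restrict (Icc a b)), 0 ≤ g t) : MonotoneOn F (Icc a b) := by
  intro s hs t ht hst
  rw [← sub_nonneg, h.sub_eq hs ht]
  refine intervalIntegral.integral_nonneg_of_ae_restrict hst ?_
  exact ae_mono (Measure.restrict_mono (Icc_subset_Icc hs.1 ht.2) le_rfl) hg

theorem integrableOn_clm_apply [FiniteDimensional ℝ E] {L : ℝ → E →L[ℝ] E'}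
    (hL : ContinuousOn L (Icc a b)) (hg : IntegrableOn g (Icc a b)) :
    IntegrableOn (fun r => L r (g r)) (Icc a b) := by
  obtain ⟨C, hC⟩ := isCompact_Icc.exists_bound_of_continuousOn hL
  refine Integrable.mono' (hg.norm.const_mul C) ?_ ?_
  · exact (ContinuousLinearMap.id ℝ (E →L[ℝ] E')).aestronglyMeasurable_comp₂
      (hL.aestronglyMeasurable measurableSet_Icc) hg.1
  · filter_upwards [ae_restrict_mem measurableSet_Icc] with r hr
    exact (L r).le_of_opNorm_le (hC r hr) _

theorem of_integrableOn (hg : IntegrableOn g (Icc a b)) :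
    IsPrimitiveOn (fun t => ∫ s in a..t, g s) g a b :=
  ⟨hg, fun t _ => by simp⟩

theorem dist_le (h : IsPrimitiveOn F g a b) : ∀ x ∈ Icc a b, ∀ y ∈ Icc a b,
    dist (F x) (F y) ≤ dist (∫ s in a..x, ‖g s‖) (∫ s in a..y, ‖g s‖) := by
  intro x hx y hy
  rw [dist_eq_norm, dist_eq_norm, h.sub_eq hy hx, (of_integrableOn h.1.norm).sub_eq hy hx]
  exact intervalIntegral.norm_integral_le_abs_integral_norm

theorem absolutelyContinuousOnInterval_integral_norm {G : Type*} [NormedAddCommGroup G]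
    {g : ℝ → G} {a b : ℝ} (hg : IntegrableOn g (Icc a b)) (hab : a ≤ b) : AbsolutelyContinuousOnInterval (fun t => ∫ s in a..t, ‖g s‖) a b :=
  ((of_integrableOn hg.norm).intervalIntegrable ⟨le_rfl, hab⟩
    ⟨hab, le_rfl⟩).absolutelyContinuousOnInterval_intervalIntegral left_mem_uIcc

/-- The chain rule for indefinite integrals. -/
theorem comp [FiniteDimensional ℝ E] [CompleteSpace E'] {Ψ : E → E'} (hΨ : ContDiff ℝ 1 Ψ)
    (h : IsPrimitiveOn F g a b) :
    IsPrimitiveOn (fun t => Ψ (F t)) (fun t => fderiv ℝ Ψ (F t) (g t)) a b := by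
  have hcont : ContinuousOn (fun t => fderiv ℝ Ψ (F t)) (Icc a b) :=
    (hΨ.continuous_fderiv one_ne_zero).comp_continuousOn h.continuousOn
  have hint := integrableOn_clm_apply hcont h.1
  refine ⟨hint, fun t ht => ?_⟩
  have hab : a ≤ b := ht.1.trans ht.2
  have hE : CompleteSpace E := FiniteDimensional.complete ℝ E
  -- `Ψ` is Lipschitz on a ball containing the compact range of `F`, so both sides are absolutely
  -- continuous. Their derivatives agree almost everywhere, hence they differ by a constant.
  have hac1 : AbsolutelyContinuousOnInterval (fun t => Ψ (F t)) a b := by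
    obtain ⟨R, hR⟩ := isCompact_Icc.exists_bound_of_continuousOn h.continuousOn
    obtain ⟨K, hK⟩ := hΨ.contDiffOn.exists_lipschitzOnWith (s := Metric.closedBall 0 R) (by simp)
      (convex_closedBall _ _) (isCompact_closedBall _ _)
    refine (absolutelyContinuousOnInterval_integral_norm h.1 hab).of_dist_le (K := K) fun x hx y hy => ?_
    rw [uIcc_of_le hab] at hx hy
    refine (hK.dist_le_mul _ (by simpa using hR x hx) _ (by simpa using hR y hy)).trans ?_
    gcongr
    exact h.dist_le x hx y hy
  have hac2 : AbsolutelyContinuousOnInterval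
      (fun t => ∫ s in a..t, fderiv ℝ Ψ (F s) (g s)) a b := by
    refine (absolutelyContinuousOnInterval_integral_norm hint hab).of_dist_le (K := 1) fun x hx y hy => ?_
    rw [uIcc_of_le hab] at hx hy
    simpa using (of_integrableOn hint).dist_le x hx y hy
  have hder : ∀ᵐ x, x ∈ uIcc a b →
      HasDerivAt (fun t => Ψ (F t) - ∫ s in a..t, fderiv ℝ Ψ (F s) (g s)) 0 x := by
    have h1 := h.ae_hasDerivAt
    have h2 := (of_integrableOn hint).ae_hasDerivAt
    rw [ae_restrict_iff' measurableSet_Icc] at h1 h2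
    filter_upwards [h1, h2] with x hx1 hx2 hx
    rw [uIcc_of_le hab] at hx
    have h3 := ((hΨ.differentiable one_ne_zero (F x)).hasFDerivAt.comp_hasDerivAt x (hx1 hx)).sub
      (hx2 hx)
    rw [sub_self] at h3
    exact h3
  obtain ⟨C, hC⟩ := (hac1.sub hac2).const_of_ae_hasDerivAt_zero hder
  rw [uIcc_of_le hab] at hC
  have h1 := hC t ht
  have h2 := hC a ⟨le_rfl, hab⟩
  simp only [Pi.sub_apply, intervalIntegral.integral_same, sub_zero] at h1 h2
  beta_reduce
  rw [h2, ← h1]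
  abel

end IsPrimitiveOn

namespace CLS

variable {n m : ℕ} (S : CLS n m)

/-! ### Regularity of the data -/

theorem contDiff_gradient {E : Type*} [NormedAddCommGroup E] [InnerProductSpace ℝ E]
    [CompleteSpace E] {f : E → ℝ} (hf : ContDiff ℝ 2 f) : ContDiff ℝ 1 (gradient f) :=
  (InnerProductSpace.toDual ℝ E).symm.contDiff.comp (hf.fderiv_right (by norm_num))

theorem contDiff_normal : ContDiff ℝ 1 S.normal := contDiff_gradient S.fc_smooth

theorem fderiv_fc (q w : Vec n) : fderiv ℝ S.fc q w = inner ℝ (S.normal q) w := by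
  rw [normal, gradient, InnerProductSpace.toDual_symm_apply]

/-- Cramer's rule: the entries are polynomials in the entries of `M` divided by a determinant
without zeros. -/
theorem contDiff_inv_apply (i j : Fin n) : ContDiff ℝ 2 (fun q => (S.M q)⁻¹ i j) := by
  have hdet : ContDiff ℝ 2 (fun q => (S.M q).det) := by
    simp only [Matrix.det_apply]
    exact ContDiff.sum fun σ _ => (contDiff_prod fun k _ => S.M_smooth _ _).const_smul _
  have hadj : ContDiff ℝ 2 (fun q => (S.M q).adjugate i j) := by
    simp only [Matrix.adjugate_apply, Matrix.det_apply]
    refine ContDiff.sum fun σ _ => (contDiff_prod fun k _ => ?_).const_smul _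
    by_cases h : σ k = j
    · simp only [h, Matrix.updateRow_self]
      exact contDiff_const
    · simp only [Matrix.updateRow_ne h]
      exact S.M_smooth _ _
  have : (fun q => (S.M q)⁻¹ i j) = fun q => ((S.M q).det)⁻¹ * (S.M q).adjugate i j := by
    funext q
    rw [Matrix.inv_def, Matrix.smul_apply, Ring.inverse_eq_inv', smul_eq_mul]
  rw [this]
  exact (hdet.inv fun q => (S.M_posDef q).det_pos.ne').mul hadj

/-- The order is left free because the normal is C¹ in general, and C² when `c2` is, as uniqueness
assumes. -/
theorem contDiff_invMn_of {k : WithTop ℕ∞} (hk : k ≤ 2) (h : ContDiff ℝ k S.normal) :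
    ContDiff ℝ k S.invMn := by
  rw [contDiff_euclidean]
  intro i
  have : (fun q => S.invMn q i) = fun q => ∑ j, (S.M q)⁻¹ i j * S.normal q j := by
    funext q
    simp [invMn, Matrix.toLpLin_apply, Matrix.mulVec, dotProduct]
  rw [this]
  exact ContDiff.sum fun j _ => ((S.contDiff_inv_apply i j).of_le hk).mul (contDiff_euclidean.1 h j)

theorem contDiff_D_of {k : WithTop ℕ∞} (hk : k ≤ 2) (h : ContDiff ℝ k S.normal) :
    ContDiff ℝ k S.D :=
  h.inner ℝ (S.contDiff_invMn_of hk h)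

theorem contDiff_invMn : ContDiff ℝ 1 S.invMn := S.contDiff_invMn_of (by norm_num) S.contDiff_normal

theorem contDiff_D : ContDiff ℝ 1 S.D := S.contDiff_D_of (by norm_num) S.contDiff_normal

theorem D_pos {q : Vec n} (h : S.fc q = 0) : 0 < S.D q := by
  have hn : (S.normal q).ofLp ≠ 0 := fun h0 => S.normal_ne_zero q h (by
    have : S.normal q = 0 := by ext i; simp [h0]
    exact this)
  have := (S.M_posDef q).inv.dotProduct_mulVec_pos hn
  simp only [star_trivial] at this
  rw [D, invMn, EuclideanSpace.inner_eq_star_dotProduct, dotProduct_comm]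
  simpa [Matrix.toLpLin_apply] using this

/-! ### The normal velocity -/

/-- The normal velocity as a function of position and velocity. -/
def normalVel (p : Vec n × Vec n) : ℝ := inner ℝ (S.normal p.1) p.2

theorem contDiff_normalVel : ContDiff ℝ 1 S.normalVel :=
  (S.contDiff_normal.comp contDiff_fst).inner ℝ contDiff_snd

theorem fderiv_normalVel_vert (q v w : Vec n) :
    fderiv ℝ S.normalVel (q, v) (0, w) = inner ℝ (S.normal q) w := by
  have h1 : HasFDerivAt (fun v' : Vec n => S.normalVel (q, v'))
      ((fderiv ℝ S.normalVel (q, v)).comp (ContinuousLinearMap.inr ℝ (Vec n) (Vec n))) v :=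
    ((S.contDiff_normalVel.differentiable one_ne_zero (q, v)).hasFDerivAt).comp v
      (hasFDerivAt_prodMk_right q v)
  have h2 : HasFDerivAt (fun v' : Vec n => S.normalVel (q, v')) (innerSL ℝ (S.normal q)) v :=
    (innerSL ℝ (S.normal q)).hasFDerivAt
  simpa using DFunLike.congr_fun (h1.unique h2) w

theorem fderiv_normalVel_horiz (q v w : Vec n) :
    fderiv ℝ S.normalVel (q, v) (w, 0) =
      inner ℝ (gradient (fun p => inner ℝ (S.normal p) v) q) w := by
  have h1 : HasFDerivAt (fun q' : Vec n => inner ℝ (S.normal q') v)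
      ((fderiv ℝ S.normalVel (q, v)).comp (ContinuousLinearMap.inl ℝ (Vec n) (Vec n))) q :=
    HasFDerivAt.comp (g := S.normalVel) (f := fun e => (e, v)) q
      (S.contDiff_normalVel.differentiable one_ne_zero (q, v)).hasFDerivAt
      (hasFDerivAt_prodMk_left q v)
  rw [gradient, InnerProductSpace.toDual_symm_apply, h1.fderiv]
  simp

/-- `φ` is the derivative of the normal velocity along the unconstrained dynamics. -/
theorem phi_eq_fderiv (q v : Vec n) (u : Vec m) :
    S.phi q v u = fderiv ℝ S.normalVel (q, v) (v, S.fv q v u) := by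
  have : ((v, S.fv q v u) : Vec n × Vec n) = (v, 0) + (0, S.fv q v u) := by simp
  rw [this, map_add, fderiv_normalVel_vert, fderiv_normalVel_horiz, phi, add_comm]

/-- The normal acceleration is affine in the multiplier with slope `D`; setting it to zero yields
the contact force. -/
theorem fderiv_normalVel_force (q v : Vec n) (u : Vec m) (l : ℝ) :
    fderiv ℝ S.normalVel (q, v) (v, S.fv q v u + l • S.invMn q) = S.phi q v u + l * S.D q := by
  have : ((v, S.fv q v u + l • S.invMn q) : Vec n × Vec n)
      = (v, S.fv q v u) + l • (0, S.invMn q) := by simp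
  rw [this, map_add, map_smul, fderiv_normalVel_vert, ← phi_eq_fderiv, smul_eq_mul, D]

theorem continuous_fv : Continuous (fun p : Vec n × Vec n × Vec m => S.fv p.1 p.2.1 p.2.2) :=
  S.fv_smooth.continuous

theorem continuous_phi : Continuous (fun p : Vec n × Vec n × Vec m => S.phi p.1 p.2.1 p.2.2) := by
  simp only [phi_eq_fderiv]
  refine Continuous.clm_apply ?_ ?_
  · exact (S.contDiff_normalVel.continuous_fderiv one_ne_zero).comp (by fun_prop)
  · exact (continuous_fst.comp continuous_snd).prodMk S.continuous_fv

theorem contDiff_normalVel_of_c2 {S : CLS n m} (h : ContDiff ℝ 2 S.c2) : ContDiff ℝ 2 S.normalVel :=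
  h.comp (contDiff_fst.prodMk (contDiff_snd.prodMk (contDiff_const (c := (0 : ℝ)))))

/-- The components of the normal are the normal velocities of the basis vectors. -/
theorem contDiff_normal_of_c2 {S : CLS n m} (h : ContDiff ℝ 2 S.c2) : ContDiff ℝ 2 S.normal := by
  rw [contDiff_euclidean]
  intro i
  have : (fun q => S.normal q i) = fun q => S.normalVel (q, EuclideanSpace.single i 1) := by
    funext q
    simp [normalVel, EuclideanSpace.inner_single_right]
  rw [this]
  exact (contDiff_normalVel_of_c2 h).comp (contDiff_id.prodMk contDiff_const)

theorem contDiff_phi_of_c2 {S : CLS n m} (h : ContDiff ℝ 2 S.c2) :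
    ContDiff ℝ 1 (fun p : Vec n × Vec n × Vec m => S.phi p.1 p.2.1 p.2.2) := by
  simp only [phi_eq_fderiv]
  refine ContDiff.clm_apply ?_ ?_
  · exact ((contDiff_normalVel_of_c2 h).fderiv_right (m := 1) (by norm_num)).comp (by fun_prop)
  · exact (contDiff_fst.comp contDiff_snd).prodMk (S.fv_smooth.of_le (by norm_num))

/-! ### The regions of the time-freezing system -/

theorem continuous_c1 : Continuous S.c1 := S.fc_smooth.continuous.comp continuous_fst

theorem continuous_c2 : Continuous S.c2 :=
  S.contDiff_normalVel.continuous.comp (by fun_prop : Continuous fun y : TFState n => (y.1, y.2.1))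

theorem isClosed_Sigma : IsClosed S.Sigma :=
  (isClosed_eq S.continuous_c1 continuous_const).inter (isClosed_eq S.continuous_c2 continuous_const)

theorem of_mem_closure_R1 {y : TFState n} (h : y ∈ closure S.R1) : 0 ≤ S.c1 y ∨ 0 ≤ S.c2 y := by
  have hc : IsClosed {y | 0 ≤ S.c1 y ∨ 0 ≤ S.c2 y} :=
    (isClosed_le continuous_const S.continuous_c1).union
      (isClosed_le continuous_const S.continuous_c2)
  refine closure_minimal ?_ hc h
  rintro z (hz | hz)
  · exact Or.inl (le_of_lt hz)
  · exact Or.inr hz.2.le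

theorem of_mem_closure_R2 {y : TFState n} (h : y ∈ closure S.R2) : S.c1 y ≤ 0 ∧ S.c2 y ≤ 0 := by
  have hc : IsClosed {y | S.c1 y ≤ 0 ∧ S.c2 y ≤ 0} :=
    (isClosed_le S.continuous_c1 continuous_const).inter
      (isClosed_le S.continuous_c2 continuous_const)
  refine closure_minimal ?_ hc h
  rintro z ⟨hz, hz'⟩
  exact ⟨hz.le, hz'.le⟩

/-- Near a contact configuration the constraint function increases along the normal. -/
theorem slope_fc_normal {q : Vec n} (h : S.fc q = 0) :
    Tendsto (fun s : ℝ => s⁻¹ * S.fc (q + s • S.normal q)) (𝓝[≠] 0)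
      (𝓝 (inner ℝ (S.normal q) (S.normal q))) := by
  have h1 : HasDerivAt (fun s : ℝ => q + s • S.normal q) (S.normal q) 0 := by
    simpa using ((hasDerivAt_id (0 : ℝ)).smul_const (S.normal q)).const_add q
  have h2 : HasDerivAt (fun s : ℝ => S.fc (q + s • S.normal q))
      (inner ℝ (S.normal q) (S.normal q)) 0 := by
    have h3 := (S.fc_smooth.differentiable (by norm_num) (q + (0 : ℝ) • S.normal q)).hasFDerivAt
    have := h3.comp_hasDerivAt (0 : ℝ) h1
    rwa [zero_smul, add_zero, fderiv_fc] at this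
  rw [hasDerivAt_iff_tendsto_slope] at h2
  refine h2.congr fun s => ?_
  simp [slope, h]

theorem normal_sq_pos {q : Vec n} (h : S.fc q = 0) : 0 < (inner ℝ (S.normal q) (S.normal q) : ℝ) :=
  real_inner_self_pos.2 (S.normal_ne_zero q h)

/-- Displacing a contact position along its normal makes `fc` positive. -/
theorem mem_closure_R1 {y : TFState n} (h : 0 ≤ S.c1 y) : y ∈ closure S.R1 := by
  rcases h.lt_or_eq with h | h
  · exact subset_closure (Or.inl h)
  have hf : S.fc y.1 = 0 := h.symm
  have ht : Tendsto (fun s : ℝ => ((y.1 + s • S.normal y.1, y.2) : TFState n)) (𝓝[>] 0) (𝓝 y) := by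
    have hcont : Continuous fun s : ℝ => ((y.1 + s • S.normal y.1, y.2) : TFState n) := by fun_prop
    have := hcont.tendsto 0
    rw [zero_smul, add_zero] at this
    exact this.mono_left nhdsWithin_le_nhds
  refine mem_closure_of_tendsto ht ?_
  have h1 := (S.slope_fc_normal hf).mono_left (nhdsWithin_mono 0 (fun s (hs : 0 < s) => hs.ne'))
  filter_upwards [h1.eventually_const_lt (S.normal_sq_pos hf), self_mem_nhdsWithin] with s hs hs0
  exact Or.inl ((mul_pos_iff_of_pos_left (inv_pos.2 hs0)).1 hs)

/-- Displacing the position against the normal makes `fc` negative, while `c2 < 0` survives by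
continuity. -/
theorem mem_closure_R2_of_neg {y : TFState n} (h : S.c1 y = 0) (h2 : S.c2 y < 0) :
    y ∈ closure S.R2 := by
  have hf : S.fc y.1 = 0 := h
  have ht : Tendsto (fun s : ℝ => ((y.1 + s • S.normal y.1, y.2) : TFState n)) (𝓝[<] 0) (𝓝 y) := by
    have hcont : Continuous fun s : ℝ => ((y.1 + s • S.normal y.1, y.2) : TFState n) := by fun_prop
    have := hcont.tendsto 0
    rw [zero_smul, add_zero] at this
    exact this.mono_left nhdsWithin_le_nhds
  refine mem_closure_of_tendsto ht ?_
  have h1 := (S.slope_fc_normal hf).mono_left (nhdsWithin_mono 0 (fun s (hs : s < 0) => hs.ne))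
  filter_upwards [h1.eventually_const_lt (S.normal_sq_pos hf), self_mem_nhdsWithin,
    ((S.continuous_c2.tendsto y).comp ht).eventually_lt_const h2] with s hs hs0 hs2
  exact ⟨neg_of_mul_pos_right hs (inv_nonpos.2 (le_of_lt hs0)), hs2⟩

/-- When `c2 = 0`, a displacement of the position does not control the sign of `c2`. Lowering the
velocity along the normal gives contact states with `c2 < 0`, already known to lie in the closure.
-/
theorem mem_closure_R2 {y : TFState n} (h : S.c1 y = 0) (h2 : S.c2 y ≤ 0) : y ∈ closure S.R2 := by
  have hf : S.fc y.1 = 0 := h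
  have ht : Tendsto (fun s : ℝ => ((y.1, y.2.1 - s • S.normal y.1, y.2.2) : TFState n))
      (𝓝[>] 0) (𝓝 y) := by
    have hcont : Continuous fun s : ℝ => ((y.1, y.2.1 - s • S.normal y.1, y.2.2) : TFState n) := by
      fun_prop
    have := hcont.tendsto 0
    rw [zero_smul, sub_zero] at this
    exact this.mono_left nhdsWithin_le_nhds
  rw [← closure_closure]
  refine mem_closure_of_tendsto ht ?_
  filter_upwards [self_mem_nhdsWithin] with s hs
  refine S.mem_closure_R2_of_neg h ?_
  have h3 : S.c2 (y.1, y.2.1 - s • S.normal y.1, y.2.2)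
      = S.c2 y - s * inner ℝ (S.normal y.1) (S.normal y.1) := by
    simp only [c2, inner_sub_right, real_inner_smul_right]
  rw [h3]
  have := mul_pos (show (0 : ℝ) < s from hs) (S.normal_sq_pos hf)
  linarith

end CLS

namespace CLS

variable {n m : ℕ} {S : CLS n m}

/-! ### Solutions in physical time -/

/-- The acceleration of a trajectory outside the impact times. -/
def accel (S : CLS n m) (u : ℝ → Vec m) (x : CLSTraj n) (t : ℝ) : Vec n :=
  S.fv (x.q t) (x.v t) (u t) + x.lam t • S.invMn (x.q t)

/-- The sum of the jumps `p s • c s` up to time `t`. -/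
def jumpSum {E : Type*} [AddCommGroup E] [Module ℝ E] (p : ℝ →₀ ℝ) (c : ℝ → E) (t : ℝ) : E :=
  ∑ s ∈ p.support with s ≤ t, p s • c s

theorem jumpSum_congr {E : Type*} [AddCommGroup E] [Module ℝ E] {p : ℝ →₀ ℝ} (c : ℝ → E) {r t : ℝ}
    (hct : r ≤ t) (h : ∀ s ∈ p.support, s ∉ Ioc r t) : jumpSum p c t = jumpSum p c r := by
  unfold jumpSum
  congr 1
  refine Finset.filter_congr fun s hs => ⟨fun hst => ?_, fun hsc => hsc.trans hct⟩
  by_contra hcs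
  exact h s hs ⟨not_le.1 hcs, hst⟩

/-- There are finitely many jumps, so shortly before `t` all earlier ones have occurred and only the
one at `t` is missing. -/
theorem eventually_jumpSum_left {E : Type*} [AddCommGroup E] [Module ℝ E] (p : ℝ →₀ ℝ) (c : ℝ → E)
    (t : ℝ) : ∀ᶠ s in 𝓝[<] t, jumpSum p c s = jumpSum p c t - p t • c t := by
  have h : ∀ᶠ s in 𝓝[<] t, ∀ r ∈ p.support, r < t → r < s := by
    rw [Filter.eventually_all_finset]
    intro r _
    by_cases hr : r < t
    · filter_upwards [mem_nhdsWithin_of_mem_nhds (Ioi_mem_nhds hr)] with s hs _ using hs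
    · exact Eventually.of_forall fun s h => absurd h hr
  filter_upwards [h, self_mem_nhdsWithin] with s hs hst
  have hst' : s < t := hst
  rw [eq_sub_iff_add_eq]
  unfold jumpSum
  by_cases ht : t ∈ p.support
  · have : p.support.filter (· ≤ t) = insert t (p.support.filter (· ≤ s)) := by
      ext r
      simp only [Finset.mem_filter, Finset.mem_insert]
      constructor
      · rintro ⟨h1, h2⟩
        rcases h2.lt_or_eq with h3 | h3
        · exact Or.inr ⟨h1, (hs r h1 h3).le⟩
        · exact Or.inl h3
      · rintro (rfl | h1)
        · exact ⟨ht, le_rfl⟩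
        · exact ⟨h1.1, h1.2.trans hst'.le⟩
    rw [this, Finset.sum_insert (by simp [hst']), add_comm]
  · rw [Finsupp.notMem_support_iff.1 ht, zero_smul, add_zero]
    congr 1
    refine Finset.filter_congr fun r hr => ⟨fun h => h.trans hst'.le, fun h => ?_⟩
    rcases h.lt_or_eq with h3 | h3
    · exact (hs r hr h3).le
    · exact absurd (h3 ▸ hr) ht

/-- The sum of the velocity jumps up to time `t`. -/
def jumps (S : CLS n m) (x : CLSTraj n) (t : ℝ) : Vec n :=
  jumpSum x.imp (fun s => S.invMn (x.q s)) t

theorem jumps_congr {x : CLSTraj n} {c t : ℝ} (hct : c ≤ t)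
    (h : ∀ s ∈ x.imp.support, s ∉ Ioc c t) : S.jumps x t = S.jumps x c :=
  jumpSum_congr _ hct h

theorem eventually_jumps_left (x : CLSTraj n) (t : ℝ) :
    ∀ᶠ s in 𝓝[<] t, S.jumps x s = S.jumps x t - x.imp t • S.invMn (x.q t) :=
  eventually_jumpSum_left _ _ t

theorem eventually_no_impulse_right (x : CLSTraj n) (t : ℝ) :
    ∃ d > t, ∀ s ∈ x.imp.support, s ∉ Ioc t d := by
  have h : ∀ᶠ d in 𝓝[>] t, ∀ r ∈ x.imp.support, t < r → d < r := by
    rw [Filter.eventually_all_finset]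
    intro r _
    by_cases hr : t < r
    · filter_upwards [mem_nhdsWithin_of_mem_nhds (Iio_mem_nhds hr)] with s hs _ using hs
    · exact Eventually.of_forall fun s h => absurd h hr
  obtain ⟨d, hd, hd'⟩ := (h.and self_mem_nhdsWithin).exists
  exact ⟨d, hd', fun s hs hsd => (hd s hs hsd.1).not_ge hsd.2⟩

namespace IsSolution

variable {u : ℝ → Vec m} {q0 v0 : Vec n} {tf : ℝ} {x : CLSTraj n}

theorem q_zero (hx : S.IsSolution u q0 v0 tf x) (htf : 0 ≤ tf) : x.q 0 = q0 := by
  simpa using hx.q_eq 0 ⟨le_rfl, htf⟩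

theorem q_prim (hx : S.IsSolution u q0 v0 tf x) : IsPrimitiveOn x.q x.v 0 tf :=
  ⟨hx.v_integrable, fun t ht => by rw [hx.q_zero (ht.1.trans ht.2)]; exact hx.q_eq t ht⟩

theorem continuousOn_q (hx : S.IsSolution u q0 v0 tf x) : ContinuousOn x.q (Icc 0 tf) :=
  hx.q_prim.continuousOn

theorem force_integrable (hx : S.IsSolution u q0 v0 tf x) :
    IntegrableOn (fun t => x.lam t • S.invMn (x.q t)) (Icc 0 tf) :=
  hx.lam_integrable.smul_continuousOn (S.contDiff_invMn.continuous.comp_continuousOn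
    hx.continuousOn_q) isCompact_Icc

theorem accel_integrable (hx : S.IsSolution u q0 v0 tf x) :
    IntegrableOn (S.accel u x) (Icc 0 tf) :=
  hx.fv_integrable.add hx.force_integrable

theorem v_eq' (hx : S.IsSolution u q0 v0 tf x) {t : ℝ} (ht : t ∈ Icc 0 tf) :
    x.v t = v0 + (∫ s in (0 : ℝ)..t, S.accel u x s) + S.jumps x t := hx.v_eq t ht

theorem mem_of_support (hx : S.IsSolution u q0 v0 tf x) {t : ℝ} (ht : t ∈ x.imp.support) :
    t ∈ Icc 0 tf ∧ S.fc (x.q t) = 0 := by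
  have := hx.imp_only t (Finsupp.mem_support_iff.1 ht)
  exact ⟨this.1, this.2.1⟩

/-- The velocity is an indefinite integral of the acceleration where there are no impulses. -/
theorem v_prim (hx : S.IsSolution u q0 v0 tf x) {c d : ℝ} (hc : 0 ≤ c) (hd : d ≤ tf)
    (h : ∀ s ∈ x.imp.support, s ∉ Ioc c d) : IsPrimitiveOn x.v (S.accel u x) c d := by
  have hp := (IsPrimitiveOn.of_integrableOn hx.accel_integrable).mono hc hd
  refine ⟨hp.1, fun t ht => ?_⟩
  have hcI : c ∈ Icc c d := ⟨le_rfl, ht.1.trans ht.2⟩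
  have h2 := hp.sub_eq hcI ht
  rw [hx.v_eq' ⟨hc.trans ht.1, ht.2.trans hd⟩, hx.v_eq' ⟨hc, hcI.2.trans hd⟩,
    jumps_congr ht.1 (fun s hs hst => h s hs ⟨hst.1, hst.2.trans ht.2⟩), ← h2]
  abel

theorem tendsto_left (hx : S.IsSolution u q0 v0 tf x) {t : ℝ} (ht : t ∈ Icc 0 tf) :
    Tendsto x.v (𝓝[<] t) (𝓝 (x.v t - x.imp t • S.invMn (x.q t))) := by
  rcases ht.1.lt_or_eq with h0 | h0
  · have hc : Tendsto (fun s => ∫ r in (0 : ℝ)..s, S.accel u x r) (𝓝[<] t)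
        (𝓝 (∫ r in (0 : ℝ)..t, S.accel u x r)) := by
      have h1 := (IsPrimitiveOn.of_integrableOn hx.accel_integrable).continuousOn t ht
      exact h1.mono_left (nhdsWithin_le_of_mem
        (mem_of_superset (Ioo_mem_nhdsLT h0) fun s hs => ⟨hs.1.le, hs.2.le.trans ht.2⟩))
    have h2 : x.v t - x.imp t • S.invMn (x.q t) = v0 + (∫ r in (0 : ℝ)..t, S.accel u x r)
        + (S.jumps x t - x.imp t • S.invMn (x.q t)) := by
      rw [hx.v_eq' ht]; abel
    rw [h2]
    refine ((hc.const_add v0).add_const _).congr' ?_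
    filter_upwards [eventually_jumps_left (S := S) x t, Ioo_mem_nhdsLT h0] with s hs hs0
    rw [← hs, hx.v_eq' ⟨hs0.1.le, hs0.2.le.trans ht.2⟩]
  -- At time zero the left limit comes from the extension by `v0`, and the only jump counted so far
  -- is the one at zero.
  · subst h0
    have h1 : x.v 0 - x.imp 0 • S.invMn (x.q 0) = v0 := by
      rw [hx.v_eq' ht, intervalIntegral.integral_same]
      obtain ⟨s, hs, hs0⟩ := ((eventually_jumps_left (S := S) x 0).and self_mem_nhdsWithin).exists
      have hs0' : s < 0 := hs0
      have : S.jumps x s = 0 := by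
        unfold jumps jumpSum
        rw [Finset.filter_eq_empty_iff.2, Finset.sum_empty]
        intro r hr hrs
        linarith [(hx.mem_of_support hr).1.1]
      rw [this] at hs
      rw [add_zero, add_sub_assoc, ← hs, add_zero]
    rw [h1]
    refine tendsto_const_nhds.congr' ?_
    filter_upwards [self_mem_nhdsWithin] with s hs
    exact (hx.v_init s hs).symm

theorem leftLim_eq (hx : S.IsSolution u q0 v0 tf x) {t : ℝ} (ht : t ∈ Icc 0 tf) :
    Function.leftLim x.v t = x.v t - x.imp t • S.invMn (x.q t) :=
  leftLim_eq_of_tendsto (hx.tendsto_left ht)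

/-- Without an impulse the left limit is the velocity itself, whose normal component is zero by the
impact law and not negative. -/
theorem isImpactTime_iff (hx : S.IsSolution u q0 v0 tf x) {t : ℝ} :
    S.IsImpactTime tf x t ↔ x.imp t ≠ 0 := by
  refine ⟨fun h h0 => ?_, hx.imp_only t⟩
  have h1 := h.2.2
  rw [hx.leftLim_eq h.1, h0, zero_smul, sub_zero, hx.impact_law t h] at h1
  exact lt_irrefl _ h1

/-- Either the impact law applies, or there is no impulse and the velocity equals its left limit,
which does not approach the constraint. -/
theorem normalVel_nonneg (hx : S.IsSolution u q0 v0 tf x) {t : ℝ} (ht : t ∈ Icc 0 tf)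
    (hc : S.fc (x.q t) = 0) : 0 ≤ S.normalVel (x.q t, x.v t) := by
  by_cases hi : S.IsImpactTime tf x t
  · exact (hx.impact_law t hi).ge
  · have h0 : x.imp t = 0 := by
      by_contra h
      exact hi (hx.imp_only t h)
    have h1 : ¬ (inner ℝ (S.normal (x.q t)) (Function.leftLim x.v t) : ℝ) < 0 :=
      fun h => hi ⟨ht, hc, h⟩
    rw [hx.leftLim_eq ht, h0, zero_smul, sub_zero] at h1
    exact not_lt.1 h1

theorem ae_hasDerivAt_v (hx : S.IsSolution u q0 v0 tf x) :
    ∀ᵐ t ∂(volume.restrict (Icc 0 tf)), HasDerivAt x.v (S.accel u x t) t := by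
  have h1 := (IsPrimitiveOn.of_integrableOn hx.accel_integrable).ae_hasDerivAt
  have h2 : ∀ᵐ t ∂(volume.restrict (Icc 0 tf)), t ∉ (↑(insert 0 (insert tf x.imp.support)) : Set ℝ) :=
    ae_restrict_of_ae (measure_eq_zero_iff_ae_notMem.1
      ((Finset.finite_toSet _).measure_zero _))
  filter_upwards [h1, h2, ae_restrict_mem measurableSet_Icc] with t ht hn hI
  simp only [Finset.coe_insert, mem_insert_iff, not_or] at hn
  have hl : 0 < t := lt_of_le_of_ne hI.1 (Ne.symm hn.1)
  have hr : t < tf := lt_of_le_of_ne hI.2 hn.2.1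
  obtain ⟨d, hd, hd'⟩ := eventually_no_impulse_right x t
  have hjr : ∀ᶠ s in 𝓝[>] t, S.jumps x s = S.jumps x t := by
    filter_upwards [Ioo_mem_nhdsGT hd] with s hs
    exact jumps_congr hs.1.le fun r hr' h => hd' r hr' ⟨h.1, h.2.trans hs.2.le⟩
  have hj : ∀ᶠ s in 𝓝 t, S.jumps x s = S.jumps x t := by
    rw [← nhdsNE_sup_pure t, ← nhdsLT_sup_nhdsGT t, eventually_sup, eventually_sup]
    refine ⟨⟨?_, hjr⟩, by simp⟩
    filter_upwards [eventually_jumps_left (S := S) x t] with s hs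
    rw [hs, Finsupp.notMem_support_iff.1 hn.2.2, zero_smul, sub_zero]
  refine ((ht.const_add v0).add_const (S.jumps x t)).congr_of_eventuallyEq ?_
  filter_upwards [hj, Ioo_mem_nhds hl hr] with s hs hs'
  rw [hx.v_eq' ⟨hs'.1.le, hs'.2.le⟩, hs]

/-- Almost everywhere on the contact set the normal velocity vanishes and the contact force is
`-D⁻¹ φ`; elsewhere the contact force vanishes. -/
theorem ae_contact (hx : S.IsSolution u q0 v0 tf x) :
    ∀ᵐ t ∂(volume.restrict (Icc 0 tf)),
      (S.fc (x.q t) = 0 → S.normalVel (x.q t, x.v t) = 0 ∧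
        x.lam t = -((S.D (x.q t))⁻¹ * S.phi (x.q t) (x.v t) (u t))) ∧
      (S.fc (x.q t) ≠ 0 → x.lam t = 0) := by
  have hq := hx.q_prim.ae_hasDerivAt
  have h1 : ∀ᵐ t ∂(volume.restrict (Icc 0 tf)),
      HasDerivAt (fun t => S.fc (x.q t)) (S.normalVel (x.q t, x.v t)) t := by
    filter_upwards [hq] with t ht
    have := (S.fc_smooth.differentiable (by norm_num) (x.q t)).hasFDerivAt.comp_hasDerivAt t ht
    rwa [fderiv_fc] at this
  have h2 : ∀ᵐ t ∂(volume.restrict (Icc 0 tf)),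
      HasDerivAt (fun t => S.normalVel (x.q t, x.v t))
        (S.phi (x.q t) (x.v t) (u t) + x.lam t * S.D (x.q t)) t := by
    filter_upwards [hq, hx.ae_hasDerivAt_v] with t ht ht'
    have := (S.contDiff_normalVel.differentiable one_ne_zero
      (x.q t, x.v t)).hasFDerivAt.comp_hasDerivAt t (ht.prodMk ht')
    rwa [accel, fderiv_normalVel_force] at this
  -- Used twice: on contact the normal velocity vanishes almost everywhere, and on that zero set so
  -- does its derivative `φ + λ D`.
  filter_upwards [ae_deriv_eq_zero_of_eq_zero h1, ae_deriv_eq_zero_of_eq_zero h2, hx.compl]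
    with t h3 h4 h5
  refine ⟨fun h => ⟨h3 h, ?_⟩, fun h => (mul_eq_zero.1 h5.2).resolve_right h⟩
  have h6 := h4 (h3 h)
  have h7 := S.D_pos h
  field_simp
  linarith

end IsSolution

/-- The impulse of the contact force around `s` tends to the size of the Dirac impulse at `s`. -/
theorem tendsto_contactForce {x : CLSTraj n} {tf : ℝ} (hl : IntegrableOn x.lam (Icc 0 tf))
    (hi : ∀ t, 0 ≤ x.imp t) (s : ℝ) :
    Tendsto (fun ε => (x.contactForce tf).real (Icc (s - ε) (s + ε))) (𝓝[>] 0) (𝓝 (x.imp s)) := by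
  have hfin : IsFiniteMeasure (x.contactForce tf) := by
    unfold CLSTraj.contactForce
    have h1 : IsFiniteMeasure ((volume.restrict (Icc 0 tf)).withDensity
        (fun t => ENNReal.ofReal (x.lam t))) :=
      isFiniteMeasure_withDensity_ofReal hl.2
    have h2 : IsFiniteMeasure
        (∑ s ∈ x.imp.support, ENNReal.ofReal (x.imp s) • Measure.dirac s) := by
      refine ⟨?_⟩
      rw [Measure.finsetSum_apply]
      simp
    infer_instance
  have hs : (x.contactForce tf) {s} = ENNReal.ofReal (x.imp s) := by
    unfold CLSTraj.contactForce
    rw [Measure.add_apply, Measure.finsetSum_apply]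
    have h1 : ((volume.restrict (Icc 0 tf)).withDensity
        (fun t => ENNReal.ofReal (x.lam t))) {s} = 0 :=
      withDensity_absolutelyContinuous _ _ (by simp)
    rw [h1, zero_add]
    by_cases h : s ∈ x.imp.support
    · rw [Finset.sum_eq_single s]
      · simp
      · intro r _ hr
        simp [hr]
      · exact fun h' => absurd h h'
    · rw [Finsupp.notMem_support_iff.1 h, ENNReal.ofReal_zero]
      refine Finset.sum_eq_zero fun r hr => ?_
      have : r ≠ s := fun h' => h (h' ▸ hr)
      simp [this]
  -- Continuity from above of a finite measure: the intervals shrink to the point, which the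
  -- absolutely continuous part does not charge.
  have := tendsto_measure_Icc_nhdsWithin_right' (x.contactForce tf) s
  rw [hs] at this
  have h2 := (ENNReal.tendsto_toReal ENNReal.ofReal_ne_top).comp this
  rw [ENNReal.toReal_ofReal (hi s)] at h2
  exact h2

end CLS

/-- A continuous function that starts nonnegative has a last nonnegative value. -/
theorem exists_last_nonneg {h : ℝ → ℝ} {a b : ℝ} (hab : a ≤ b) (hc : ContinuousOn h (Icc a b))
    (ha : 0 ≤ h a) : ∃ s ∈ Icc a b, 0 ≤ h s ∧ ∀ r ∈ Ioc s b, h r < 0 := by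
  have hK : IsCompact (Icc a b ∩ h ⁻¹' Ici 0) :=
    isCompact_Icc.of_isClosed_subset (hc.preimage_isClosed_of_isClosed isClosed_Icc isClosed_Ici)
      inter_subset_left
  obtain ⟨s, hs, hmax⟩ := hK.exists_isGreatest ⟨a, ⟨le_rfl, hab⟩, ha⟩
  refine ⟨s, hs.1, hs.2, fun r hr => ?_⟩
  by_contra hn
  exact hr.1.not_ge (hmax ⟨⟨hs.1.1.trans hr.1.le, hr.2⟩, not_lt.1 hn⟩)

namespace CLS

variable {n m : ℕ} {S : CLS n m}

/-! ### Solutions of the time-freezing system -/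

/-- The right-hand side of the time-freezing system with weight `θ` of the unconstrained
dynamics. -/
def tfField (S : CLS n m) (a : ℝ) (w : ℝ → Vec m) (y : ℝ → TFState n) (θ : ℝ → ℝ) (τ : ℝ) :
    TFState n :=
  (θ τ • (y τ).2.1, θ τ • S.fv (y τ).1 (y τ).2.1 (w τ) + ((1 - θ τ) * a) • S.invMn (y τ).1, θ τ)

/-- A solution of the time-freezing system with a given clock rate `θ`. -/
structure IsClockedSolution (S : CLS n m) (a : ℝ) (w : ℝ → Vec m) (τf : ℝ) (y : ℝ → TFState n)
    (θ : ℝ → ℝ) : Prop where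
  prim : IsPrimitiveOn y (S.tfField a w y θ) 0 τf
  θ_nonneg : ∀ᵐ τ ∂(volume.restrict (Icc 0 τf)), 0 ≤ θ τ
  θ_le_one : ∀ᵐ τ ∂(volume.restrict (Icc 0 τf)), θ τ ≤ 1
  ae_R1 : ∀ᵐ τ ∂(volume.restrict (Icc 0 τf)), θ τ ≠ 0 → y τ ∈ closure S.R1
  ae_R2 : ∀ᵐ τ ∂(volume.restrict (Icc 0 τf)), θ τ ≠ 1 → y τ ∈ closure S.R2

theorem IsTFSolution.exists_clocked {a : ℝ} {w : ℝ → Vec m} {y0 : TFState n} {τf : ℝ}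
    {y : ℝ → TFState n} (hτ : 0 ≤ τf) (h : S.IsTFSolution a w y0 τf y) :
    y 0 = y0 ∧ ∃ θ, S.IsClockedSolution a w τf y θ := by
  obtain ⟨g, hg, hy, hF⟩ := h
  have h0 : y 0 = y0 := by simpa using hy 0 ⟨le_rfl, hτ⟩
  -- The clock components of the two fields are 1 and 0, so the weight is the clock component of `g`
  -- and inherits its integrability.
  refine ⟨h0, fun τ => (g τ).2.2, ?_, ?_, ?_, ?_, ?_⟩
  · have hp : IsPrimitiveOn y g 0 τf := ⟨hg, fun t ht => by rw [h0]; exact hy t ht⟩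
    refine hp.congr_ae ?_
    filter_upwards [hF] with τ hτ
    obtain ⟨θ₁, θ₂, -, -, hs, -, -, hz⟩ := hτ
    have h2 : θ₂ = 1 - θ₁ := by linarith
    have h3 : (g τ).2.2 = θ₁ := by rw [hz]; simp [f1, faux]
    rw [tfField, h3, hz, h2]
    simp [f1, faux, smul_smul]
  all_goals
    filter_upwards [hF] with τ hτ
    obtain ⟨θ₁, θ₂, hp1, hp2, hs, hc1, hc2, hz⟩ := hτ
    have h3 : (g τ).2.2 = θ₁ := by rw [hz]; simp [f1, faux]
    rw [h3]
  · exact hp1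
  · linarith
  · intro h
    by_contra hn
    exact h (hc1 hn)
  · intro h
    by_contra hn
    exact h (by linarith [hc2 hn])

theorem fderiv_normalVel_tf (q v : Vec n) (u : Vec m) (θ b : ℝ) :
    fderiv ℝ S.normalVel (q, v) (θ • v, θ • S.fv q v u + b • S.invMn q)
      = θ * S.phi q v u + b * S.D q := by
  have : ((θ • v, θ • S.fv q v u + b • S.invMn q) : Vec n × Vec n)
      = θ • (v, S.fv q v u) + b • (0, S.invMn q) := by simp
  rw [this, map_add, map_smul, map_smul, fderiv_normalVel_vert, ← phi_eq_fderiv, smul_eq_mul,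
    smul_eq_mul, D]

namespace IsClockedSolution

variable {a : ℝ} {w : ℝ → Vec m} {τf : ℝ} {y : ℝ → TFState n} {θ : ℝ → ℝ}

theorem prim_q (h : S.IsClockedSolution a w τf y θ) :
    IsPrimitiveOn (fun τ => (y τ).1) (fun τ => θ τ • (y τ).2.1) 0 τf := by
  simpa [fderiv_fst, tfField] using h.prim.comp (Ψ := Prod.fst) contDiff_fst

theorem prim_vt (h : S.IsClockedSolution a w τf y θ) :
    IsPrimitiveOn (fun τ => (y τ).2) (fun τ => (S.tfField a w y θ τ).2) 0 τf := by
  simpa [fderiv_snd] using h.prim.comp (Ψ := Prod.snd) contDiff_snd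

theorem prim_v (h : S.IsClockedSolution a w τf y θ) :
    IsPrimitiveOn (fun τ => (y τ).2.1)
      (fun τ => θ τ • S.fv (y τ).1 (y τ).2.1 (w τ) + ((1 - θ τ) * a) • S.invMn (y τ).1) 0 τf := by
  simpa [fderiv_fst, tfField] using h.prim_vt.comp (Ψ := Prod.fst) contDiff_fst

theorem prim_t (h : S.IsClockedSolution a w τf y θ) :
    IsPrimitiveOn (fun τ => (y τ).2.2) θ 0 τf := by
  simpa [fderiv_snd, tfField] using h.prim_vt.comp (Ψ := Prod.snd) contDiff_snd

theorem prim_c1 (h : S.IsClockedSolution a w τf y θ) :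
    IsPrimitiveOn (fun τ => S.c1 (y τ)) (fun τ => θ τ * S.c2 (y τ)) 0 τf := by
  have := h.prim_q.comp (Ψ := S.fc) (S.fc_smooth.of_le (by norm_num))
  simp only [fderiv_fc, real_inner_smul_right] at this
  exact this

theorem prim_c2 (h : S.IsClockedSolution a w τf y θ) :
    IsPrimitiveOn (fun τ => S.c2 (y τ))
      (fun τ => θ τ * S.phi (y τ).1 (y τ).2.1 (w τ) + (1 - θ τ) * a * S.D (y τ).1) 0 τf := by
  have := (h.prim_q.prodMk h.prim_v).comp (Ψ := S.normalVel) S.contDiff_normalVel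
  simp only [fderiv_normalVel_tf] at this
  exact this

/-- After a last time with `c1 ≥ 0` the state would have `c1 < 0`, where the unconstrained dynamics
are active only if `c2 ≥ 0`. Then the derivative `θ c2` is nonnegative, and `c1` could not have
decreased. -/
theorem c1_nonneg (h : S.IsClockedSolution a w τf y θ) (h0 : 0 ≤ S.c1 (y 0)) {τ : ℝ}
    (hτ : τ ∈ Icc 0 τf) : 0 ≤ S.c1 (y τ) := by
  by_contra hn
  have hp := h.prim_c1.mono le_rfl hτ.2
  obtain ⟨s, hs, hs0, hneg⟩ := exists_last_nonneg hτ.1 hp.continuousOn h0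
  have hp' := hp.mono hs.1 le_rfl
  have hsub : Icc s τ ⊆ Icc 0 τf := Icc_subset_Icc hs.1 hτ.2
  have hmono := hp'.monotoneOn ?_
  · exact hn (hs0.trans (hmono ⟨le_rfl, hs.2⟩ ⟨hs.2, le_rfl⟩ hs.2))
  · have hns : ∀ᵐ r ∂(volume.restrict (Icc s τ)), r ≠ s :=
      ae_restrict_of_ae (by simp [ae_iff, measure_singleton])
    filter_upwards [ae_mono (Measure.restrict_mono hsub le_rfl) h.θ_nonneg,
      ae_mono (Measure.restrict_mono hsub le_rfl) h.ae_R1, ae_restrict_mem measurableSet_Icc, hns]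
      with r h1 h2 hr hrs
    have h3 : S.c1 (y r) < 0 := hneg r ⟨lt_of_le_of_ne hr.1 hrs.symm, hr.2⟩
    by_cases hθ : θ r = 0
    · simp [hθ]
    · exact mul_nonneg h1 ((S.of_mem_closure_R1 (h2 hθ)).resolve_left h3.not_ge)

/-- The derivative `θ c2` of `c1` vanishes almost everywhere on `c1 = 0`. -/
theorem ae_impacting (h : S.IsClockedSolution a w τf y θ) :
    ∀ᵐ τ ∂(volume.restrict (Icc 0 τf)), y τ ∈ S.Impacting → θ τ = 0 := by
  filter_upwards [ae_deriv_eq_zero_of_eq_zero h.prim_c1.ae_hasDerivAt] with τ h1 h2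
  exact (mul_eq_zero.1 (h1 h2.1)).resolve_right h2.2.ne

open Classical in
/-- Outside of impacts the auxiliary dynamics produce the contact force. -/
theorem ae_not_impacting (h : S.IsClockedSolution a w τf y θ) (ha : 0 < a)
    (h0 : 0 ≤ S.c1 (y 0)) :
    ∀ᵐ τ ∂(volume.restrict (Icc 0 τf)), y τ ∉ S.Impacting → ∃ l, 0 ≤ l ∧ (1 - θ τ) * a = θ τ * l ∧
      l = if y τ ∈ S.Sigma then -((S.D (y τ).1)⁻¹ * S.phi (y τ).1 (y τ).2.1 (w τ)) else 0 := by
  filter_upwards [ae_deriv_eq_zero_of_eq_zero h.prim_c2.ae_hasDerivAt, h.θ_nonneg, h.θ_le_one,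
    h.ae_R2, ae_restrict_mem measurableSet_Icc] with τ h1 h2 h3 h4 hI hn
  by_cases hS : y τ ∈ S.Sigma
  · rw [if_pos hS]
    -- Sliding: `θ φ + (1 - θ) a D = 0`. Here `θ = 0` is impossible, since it would leave `a D = 0`.
    have h5 := h1 hS.2
    have hD : 0 < S.D (y τ).1 := S.D_pos hS.1
    have h6 : θ τ ≠ 0 := by
      intro h6
      rw [h6] at h5
      have : 0 < a * S.D (y τ).1 := mul_pos ha hD
      linarith
    have h7 : 0 < θ τ := lt_of_le_of_ne h2 h6.symm
    have h8 : (1 - θ τ) * a = θ τ * -((S.D (y τ).1)⁻¹ * S.phi (y τ).1 (y τ).2.1 (w τ)) := by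
      field_simp
      linarith
    refine ⟨_, ?_, h8, rfl⟩
    refine (mul_nonneg_iff_of_pos_left h7).1 ?_
    rw [← h8]
    exact mul_nonneg (by linarith) ha.le
  · rw [if_neg hS]
    refine ⟨0, le_rfl, ?_, rfl⟩
    have : θ τ = 1 := by
      -- A share of the auxiliary dynamics puts the state in the closure of `R2`; with `c1 ≥ 0` this
      -- leaves only impacts and `Sigma`.
      by_contra h5
      have h6 := S.of_mem_closure_R2 (h4 h5)
      have h7 := le_antisymm h6.1 (h.c1_nonneg h0 hI)
      rcases h6.2.lt_or_eq with h8 | h8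
      · exact hn ⟨h7, h8⟩
      · exact hS ⟨h7, h8⟩
    rw [this]
    simp

theorem monotoneOn_t (h : S.IsClockedSolution a w τf y θ) :
    MonotoneOn (fun τ => (y τ).2.2) (Icc 0 τf) :=
  h.prim_t.monotoneOn h.θ_nonneg

/-- Where the clock stands still, the state follows the auxiliary dynamics. -/
theorem frozen (h : S.IsClockedSolution a w τf y θ) {τ₁ τ₂ : ℝ} (h1 : 0 ≤ τ₁)
    (h2 : τ₂ ≤ τf) (hz : ∀ᵐ τ ∂(volume.restrict (Icc τ₁ τ₂)), θ τ = 0) {τ : ℝ}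
    (hτ : τ ∈ Icc τ₁ τ₂) :
    (y τ).1 = (y τ₁).1 ∧ (y τ).2.2 = (y τ₁).2.2 ∧
      S.c2 (y τ) = S.c2 (y τ₁) + (τ - τ₁) * (a * S.D (y τ₁).1) := by
  have hzero : ∀ {E : Type} [NormedAddCommGroup E] [NormedSpace ℝ E] {F g : ℝ → E},
      IsPrimitiveOn F g 0 τf → (∀ τ, θ τ = 0 → g τ = 0) → ∀ τ ∈ Icc τ₁ τ₂, F τ = F τ₁ := by
    intro E _ _ F g hF hg τ hτ
    have hp := (hF.mono h1 h2).congr_ae (g' := fun _ => 0) (hz.mono fun τ => hg τ)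
    simpa using hp.2 τ hτ
  have hq : ∀ τ ∈ Icc τ₁ τ₂, (y τ).1 = (y τ₁).1 :=
    hzero h.prim_q fun τ hτ => by simp [hτ]
  refine ⟨hq τ hτ, hzero h.prim_t (fun τ hτ => hτ) τ hτ, ?_⟩
  have hp := (h.prim_c2.mono h1 h2).congr_ae (g' := fun _ => a * S.D (y τ₁).1) (by
    filter_upwards [hz, ae_restrict_mem measurableSet_Icc] with s hs hI
    rw [hs, hq s hI]
    ring)
  have := hp.2 τ hτ
  rwa [intervalIntegral.integral_const, smul_eq_mul] at this

/-- If the clock stands still, then there is an impact. -/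
theorem impacting_of_t_eq (h : S.IsClockedSolution a w τf y θ) (ha : 0 < a)
    (h0 : 0 ≤ S.c1 (y 0)) {τ₁ τ₂ : ℝ} (h1 : 0 ≤ τ₁) (h12 : τ₁ < τ₂) (h2 : τ₂ ≤ τf)
    (ht : (y τ₁).2.2 = (y τ₂).2.2) :
    (∀ τ ∈ Icc τ₁ τ₂, (y τ).1 = (y τ₁).1) ∧ (∀ τ ∈ Ico τ₁ τ₂, y τ ∈ S.Impacting) ∧
      S.c1 (y τ₂) = 0 ∧ S.c2 (y τ₂) ≤ 0 := by
  have hsub : Icc τ₁ τ₂ ⊆ Icc 0 τf := Icc_subset_Icc h1 h2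
  have hz : ∀ᵐ τ ∂(volume.restrict (Icc τ₁ τ₂)), θ τ = 0 := by
    have hp := h.prim_t.mono h1 h2
    have h3 : ∫ τ in Icc τ₁ τ₂, θ τ = 0 := by
      have := hp.2 τ₂ ⟨h12.le, le_rfl⟩
      rw [intervalIntegral.integral_of_le h12.le, ← integral_Icc_eq_integral_Ioc] at this
      simp only at this
      linarith
    exact (integral_eq_zero_iff_of_nonneg_ae
      (ae_mono (Measure.restrict_mono hsub le_rfl) h.θ_nonneg) hp.1).1 h3
  have hfr := fun τ hτ => h.frozen h1 h2 hz (τ := τ) hτ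
  have hR2 : ∀ᵐ τ ∂(volume.restrict (Icc τ₁ τ₂)), S.c1 (y τ) ≤ 0 ∧ S.c2 (y τ) ≤ 0 := by
    filter_upwards [hz, ae_mono (Measure.restrict_mono hsub le_rfl) h.ae_R2] with τ h3 h4
    exact S.of_mem_closure_R2 (h4 (by rw [h3]; norm_num))
  -- The inequalities hold only almost everywhere, which still provides points beyond any `r < τ₂`.
  have hex : ∀ r < τ₂, τ₁ ≤ r → ∃ s ∈ Ioo r τ₂, S.c1 (y s) ≤ 0 ∧ S.c2 (y s) ≤ 0 := by
    intro r hr hr1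
    have h3 : ∀ᵐ τ ∂(volume.restrict (Ioo r τ₂)), S.c1 (y τ) ≤ 0 ∧ S.c2 (y τ) ≤ 0 :=
      ae_mono (Measure.restrict_mono (Ioo_subset_Icc_self.trans (Icc_subset_Icc hr1 le_rfl)) le_rfl) hR2
    have hne : (ae (volume.restrict (Ioo r τ₂))).NeBot := by
      rw [ae_neBot, Ne, Measure.restrict_eq_zero]
      simp [hr]
    obtain ⟨s, hs, hs'⟩ := (h3.and (ae_restrict_mem measurableSet_Ioo)).exists
    exact ⟨s, hs', hs⟩
  obtain ⟨s, hs, hs1, -⟩ := hex τ₁ h12 le_rfl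
  have hc1 : S.c1 (y τ₁) = 0 := by
    have h3 : S.c1 (y s) = S.c1 (y τ₁) := by
      simp only [c1, (hfr s ⟨hs.1.le, hs.2.le⟩).1]
    exact le_antisymm (h3 ▸ hs1) (h.c1_nonneg h0 (hsub ⟨le_rfl, h12.le⟩))
  have hc1' : ∀ τ ∈ Icc τ₁ τ₂, S.c1 (y τ) = 0 := by
    intro τ hτ
    rw [← hc1]
    simp only [c1, (hfr τ hτ).1]
  have haD : 0 < a * S.D (y τ₁).1 := mul_pos ha (S.D_pos hc1)
  -- `c2` increases at the rate `a D > 0` and is still nonpositive at some later time.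
  have himp : ∀ τ ∈ Ico τ₁ τ₂, S.c2 (y τ) < 0 := by
    intro τ hτ
    obtain ⟨s, hs, -, hs2⟩ := hex τ hτ.2 hτ.1
    have h3 := (hfr τ ⟨hτ.1, hτ.2.le⟩).2.2
    have h4 := (hfr s ⟨hτ.1.trans hs.1.le, hs.2.le⟩).2.2
    nlinarith [mul_pos (sub_pos.2 hs.1) haD]
  refine ⟨fun τ hτ => (hfr τ hτ).1, fun τ hτ => And.intro (hc1' τ ⟨hτ.1, hτ.2.le⟩) (himp τ hτ),
    hc1' _ ⟨h12.le, le_rfl⟩, ?_⟩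
  have hcl : τ₂ ∈ closure (Ico τ₁ τ₂) := by
    rw [closure_Ico h12.ne]
    exact ⟨h12.le, le_rfl⟩
  have hcont : ContinuousWithinAt (fun τ => S.c2 (y τ)) (Ico τ₁ τ₂) τ₂ :=
    (h.prim_c2.continuousOn τ₂ ⟨h1.trans h12.le, h2⟩).mono
      (Ico_subset_Icc_self.trans hsub)
  exact hcont.closure_le hcl continuousWithinAt_const fun τ hτ => (himp τ hτ).le

/-- At the beginning of an impact the clock stops. -/
theorem exists_t_eq_of_impacting (h : S.IsClockedSolution a w τf y θ)
    (h0 : 0 ≤ S.c1 (y 0)) {τ₁ : ℝ} (h1 : 0 ≤ τ₁) (h2 : τ₁ < τf) (hi : y τ₁ ∈ S.Impacting) :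
    ∃ τ₂, τ₁ < τ₂ ∧ τ₂ ≤ τf ∧ (y τ₂).2.2 = (y τ₁).2.2 := by
  have hcont : ContinuousWithinAt (fun τ => S.c2 (y τ)) (Ici τ₁) τ₁ := by
    refine (h.prim_c2.continuousOn τ₁ ⟨h1, h2.le⟩).mono_of_mem_nhdsWithin ?_
    exact mem_of_superset (Icc_mem_nhdsGE h2) (Icc_subset_Icc_left h1)
  have hev : ∀ᶠ τ in 𝓝[≥] τ₁, S.c2 (y τ) < 0 :=
    hcont.eventually_lt continuousWithinAt_const hi.2
  obtain ⟨d, hd, hdI⟩ := mem_nhdsGE_iff_exists_Icc_subset.1 hev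
  have hd : τ₁ < d := hd
  refine ⟨min d τf, lt_min hd h2, min_le_right _ _, ?_⟩
  set e := min d τf
  have he : τ₁ < e := lt_min hd h2
  have hsub : Icc τ₁ e ⊆ Icc 0 τf := Icc_subset_Icc h1 (min_le_right _ _)
  have hneg : ∀ τ ∈ Icc τ₁ e, S.c2 (y τ) < 0 := fun τ hτ => hdI ⟨hτ.1, hτ.2.trans (min_le_left _ _)⟩
  have hp := h.prim_c1.mono h1 (min_le_right d τf)
  -- As long as `c2 < 0`, the function `c1` is nonincreasing; starting at its lower bound zero it
  -- stays there, so the impact goes on.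
  have hc1 : ∀ τ ∈ Icc τ₁ e, S.c1 (y τ) = 0 := by
    intro τ hτ
    refine le_antisymm ?_ (h.c1_nonneg h0 (hsub hτ))
    have h3 := hp.sub_eq (s := τ) (t := τ₁) hτ ⟨le_rfl, he.le⟩
    have h4 : 0 ≤ ∫ r in τ..τ₁, θ r * S.c2 (y r) := by
      rw [intervalIntegral.integral_symm, ← intervalIntegral.integral_neg]
      refine intervalIntegral.integral_nonneg_of_ae_restrict hτ.1 ?_
      have hsub' : Icc τ₁ τ ⊆ Icc τ₁ e := Icc_subset_Icc_right hτ.2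
      filter_upwards [ae_mono (Measure.restrict_mono (hsub'.trans hsub) le_rfl) h.θ_nonneg,
        ae_restrict_mem measurableSet_Icc] with r hr hrI
      have := mul_nonneg hr (neg_pos.2 (hneg r (hsub' hrI))).le
      simp only [Pi.zero_apply]
      linarith
    have h5 : S.c1 (y τ₁) = 0 := hi.1
    linarith
  have hz : ∀ᵐ τ ∂(volume.restrict (Icc τ₁ e)), θ τ = 0 := by
    filter_upwards [ae_mono (Measure.restrict_mono hsub le_rfl) h.ae_impacting,
      ae_restrict_mem measurableSet_Icc] with τ h3 hI
    exact h3 ⟨hc1 τ hI, hneg τ hI⟩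
  exact (h.frozen h1 (min_le_right _ _) hz ⟨he.le, le_rfl⟩).2.1

end IsClockedSolution

end CLS

/-! ### Changes of clock -/

/-- The last time in `[0, b]` at which the clock `T` has not passed `t`. -/
def lastTime (T : ℝ → ℝ) (b t : ℝ) : ℝ := sSup {τ | τ ∈ Icc 0 b ∧ T τ ≤ t}

/-- The first time in `[0, b]` at which the clock `T` has reached `t`. -/
def firstTime (T : ℝ → ℝ) (b t : ℝ) : ℝ := sInf {τ | τ ∈ Icc 0 b ∧ t ≤ T τ}

theorem lastTime_mem {T : ℝ → ℝ} {b : ℝ} (hb : 0 ≤ b) (t : ℝ) : lastTime T b t ∈ Icc 0 b := by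
  rcases eq_empty_or_nonempty {τ | τ ∈ Icc 0 b ∧ T τ ≤ t} with h | h
  · rw [lastTime, h, Real.sSup_empty]
    exact ⟨le_rfl, hb⟩
  · exact ⟨Real.sSup_nonneg fun x hx => hx.1.1, csSup_le h fun x hx => hx.1.2⟩

theorem monotone_lastTime {T : ℝ → ℝ} {b : ℝ} : Monotone (lastTime T b) := by
  intro s t hst
  rcases eq_empty_or_nonempty {τ | τ ∈ Icc 0 b ∧ T τ ≤ s} with h | h
  · rw [lastTime, h, Real.sSup_empty]
    exact Real.sSup_nonneg fun x hx => hx.1.1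
  · exact csSup_le_csSup ⟨b, fun x hx => hx.1.2⟩ h fun x hx => ⟨hx.1, hx.2.trans hst⟩

/-- A clock: continuous, nondecreasing, started at zero. -/
structure IsClock (T : ℝ → ℝ) (b : ℝ) : Prop where
  nonneg : 0 ≤ b
  cont : ContinuousOn T (Icc 0 b)
  mono : MonotoneOn T (Icc 0 b)
  zero : T 0 = 0

namespace IsClock

variable {T : ℝ → ℝ} {b t τ : ℝ}

theorem mem (h : IsClock T b) (hτ : τ ∈ Icc 0 b) : T τ ∈ Icc 0 (T b) :=
  ⟨h.zero ▸ h.mono ⟨le_rfl, h.nonneg⟩ hτ hτ.1, h.mono hτ ⟨h.nonneg, le_rfl⟩ hτ.2⟩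

/-- A Galois connection between the clock and its generalised inverse; the supremum is attained by
compactness. -/
theorem le_lastTime_iff (h : IsClock T b) (ht : 0 ≤ t) (hτ : τ ∈ Icc 0 b) :
    τ ≤ lastTime T b t ↔ T τ ≤ t := by
  have hK : IsCompact (Icc 0 b ∩ T ⁻¹' Iic t) :=
    isCompact_Icc.of_isClosed_subset (h.cont.preimage_isClosed_of_isClosed isClosed_Icc isClosed_Iic)
      inter_subset_left
  have hne : (Icc 0 b ∩ T ⁻¹' Iic t).Nonempty :=
    ⟨0, ⟨le_rfl, h.nonneg⟩, by simpa [h.zero] using ht⟩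
  have hmem : lastTime T b t ∈ Icc 0 b ∩ T ⁻¹' Iic t := hK.sSup_mem hne
  refine ⟨fun hle => (h.mono hτ hmem.1 hle).trans hmem.2, fun hle => ?_⟩
  exact le_csSup ⟨b, fun x hx => hx.1.2⟩ ⟨hτ, hle⟩

theorem T_lastTime (h : IsClock T b) (ht : t ∈ Icc 0 (T b)) : T (lastTime T b t) = t := by
  have hm := lastTime_mem (T := T) h.nonneg t
  refine le_antisymm ((h.le_lastTime_iff ht.1 hm).1 le_rfl) ?_
  obtain ⟨τ, hτ, rfl⟩ := intermediate_value_Icc h.nonneg h.cont (by rwa [h.zero])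
  exact h.mono hτ hm ((h.le_lastTime_iff ht.1 hτ).2 le_rfl)

theorem firstTime_le_iff (h : IsClock T b) (ht : t ∈ Icc 0 (T b)) (hτ : τ ∈ Icc 0 b) :
    firstTime T b t ≤ τ ↔ t ≤ T τ := by
  have hK : IsCompact (Icc 0 b ∩ T ⁻¹' Ici t) :=
    isCompact_Icc.of_isClosed_subset (h.cont.preimage_isClosed_of_isClosed isClosed_Icc isClosed_Ici)
      inter_subset_left
  have hne : (Icc 0 b ∩ T ⁻¹' Ici t).Nonempty := ⟨b, ⟨h.nonneg, le_rfl⟩, ht.2⟩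
  have hmem : firstTime T b t ∈ Icc 0 b ∩ T ⁻¹' Ici t := hK.sInf_mem hne
  refine ⟨fun hle => hmem.2.trans (h.mono hmem.1 hτ hle), fun hle => ?_⟩
  exact csInf_le ⟨0, fun x hx => hx.1.1⟩ ⟨hτ, hle⟩

theorem firstTime_mem (h : IsClock T b) (ht : t ∈ Icc 0 (T b)) : firstTime T b t ∈ Icc 0 b := by
  have hne : {τ | τ ∈ Icc 0 b ∧ t ≤ T τ}.Nonempty := ⟨b, ⟨h.nonneg, le_rfl⟩, ht.2⟩
  exact ⟨le_csInf hne fun x hx => hx.1.1,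
    (h.firstTime_le_iff ht ⟨h.nonneg, le_rfl⟩).2 ht.2⟩

theorem firstTime_le_lastTime (h : IsClock T b) (ht : t ∈ Icc 0 (T b)) :
    firstTime T b t ≤ lastTime T b t :=
  (h.firstTime_le_iff ht (lastTime_mem h.nonneg t)).2 (h.T_lastTime ht).ge

theorem T_eq_iff (h : IsClock T b) (ht : t ∈ Icc 0 (T b)) (hτ : τ ∈ Icc 0 b) :
    T τ = t ↔ τ ∈ Icc (firstTime T b t) (lastTime T b t) := by
  rw [mem_Icc, h.firstTime_le_iff ht hτ, h.le_lastTime_iff ht.1 hτ, le_antisymm_iff, and_comm]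

theorem T_firstTime (h : IsClock T b) (ht : t ∈ Icc 0 (T b)) : T (firstTime T b t) = t :=
  (h.T_eq_iff ht (h.firstTime_mem ht)).2 ⟨le_rfl, h.firstTime_le_lastTime ht⟩

/-- `lastTime` jumps over the interval on which the clock shows `t`, so its left limit is the
beginning of that interval. -/
theorem tendsto_left (h : IsClock T b) (ht : t ∈ Icc 0 (T b)) (h0 : 0 < t) :
    Tendsto (lastTime T b) (𝓝[<] t) (𝓝 (firstTime T b t)) := by
  refine tendsto_order.2 ⟨fun c hc => ?_, fun c hc => ?_⟩
  · rcases lt_or_ge c 0 with hc0 | hc0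
    · exact Eventually.of_forall fun s => hc0.trans_le (lastTime_mem h.nonneg s).1
    · have hcI : (c + firstTime T b t) / 2 ∈ Icc 0 b :=
        ⟨by linarith, by linarith [(h.firstTime_mem ht).2]⟩
      have hlt : T ((c + firstTime T b t) / 2) < t := by
        by_contra hn
        have := (h.firstTime_le_iff ht hcI).2 (not_lt.1 hn)
        linarith
      filter_upwards [Ioo_mem_nhdsLT hlt] with s hs
      have := (h.le_lastTime_iff ((h.mem hcI).1.trans hs.1.le) hcI).2 hs.1.le
      linarith
  · filter_upwards [Ioo_mem_nhdsLT h0] with s hs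
    refine lt_of_le_of_lt ?_ hc
    by_contra hn
    have := (h.firstTime_le_iff ht (lastTime_mem h.nonneg s)).1 (not_le.1 hn).le
    rw [h.T_lastTime ⟨hs.1.le, hs.2.le.trans ht.2⟩] at this
    exact hs.2.not_ge this

theorem lt_lastTime (h : IsClock T b) {s : ℝ} (hs : 0 ≤ s) (hst : s < t) (ht : t ≤ T b) :
    lastTime T b s < lastTime T b t := by
  by_contra hn
  have := (h.le_lastTime_iff hs (lastTime_mem h.nonneg t)).1 (not_lt.1 hn)
  rw [h.T_lastTime ⟨hs.trans hst.le, ht⟩] at this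
  exact hst.not_ge this

/-- The limit lies in a punctured right neighbourhood because `lastTime` is strictly increasing.
Thus properties of `y` just after a numerical time transfer to physical time. -/
theorem tendsto_right (h : IsClock T b) (ht0 : 0 ≤ t) (ht : t < T b) :
    Tendsto (lastTime T b) (𝓝[>] t) (𝓝[>] (lastTime T b t)) := by
  refine tendsto_nhdsWithin_iff.2 ⟨tendsto_order.2 ⟨fun c hc => ?_, fun c hc => ?_⟩, ?_⟩
  · filter_upwards [self_mem_nhdsWithin] with s hs
    exact hc.trans_le (monotone_lastTime (le_of_lt hs))
  · rcases le_or_gt b c with hbc | hbc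
    · filter_upwards [Ioo_mem_nhdsGT ht] with s hs
      have := h.lt_lastTime (ht0.trans hs.1.le) hs.2 le_rfl
      exact this.trans_le ((lastTime_mem h.nonneg _).2.trans hbc)
    · have hcI : c ∈ Icc 0 b := ⟨(lastTime_mem h.nonneg t).1.trans hc.le, hbc.le⟩
      have hlt : t < T c := by
        by_contra hn
        exact hc.not_ge ((h.le_lastTime_iff ht0 hcI).2 (not_lt.1 hn))
      filter_upwards [Ioo_mem_nhdsGT hlt] with s hs
      by_contra hn
      exact hs.2.not_ge ((h.le_lastTime_iff (ht0.trans hs.1.le) hcI).1 (not_lt.1 hn))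
  · filter_upwards [Ioo_mem_nhdsGT ht] with s hs
    exact h.lt_lastTime ht0 hs.1 hs.2.le

end IsClock

/-! ### Image measures under a clock and substitution -/

/-- Two measures agree if one is the image of the other under a clock, as soon as they agree on
initial segments. -/
theorem map_clock_eq {T : ℝ → ℝ} {c : ℝ} {μ ν : Measure ℝ} [IsFiniteMeasure μ]
    (hc : 0 ≤ c) (hT : AEMeasurable T μ) (hμ : ∀ᵐ τ ∂μ, T τ ∈ Icc 0 c) (hν : ∀ᵐ t ∂ν, t ∈ Icc 0 c)
    (h : ∀ t ∈ Icc 0 c, μ {τ | T τ ≤ t} = ν (Iic t)) : μ.map T = ν := by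
  refine Measure.ext_of_Iic _ _ fun t => ?_
  rw [Measure.map_apply_of_aemeasurable hT measurableSet_Iic]
  rcases lt_or_ge t 0 with ht | ht
  · have h1 : μ (T ⁻¹' Iic t) = 0 := by
      refine measure_mono_null (fun τ hτ => ?_) hμ
      exact fun h' => (hτ.trans_lt ht).not_ge h'.1
    have h2 : ν (Iic t) = 0 := by
      refine measure_mono_null (fun τ hτ => ?_) hν
      exact fun h' => (lt_of_le_of_lt hτ ht).not_ge h'.1
    rw [h1, h2]
  · have h1 : μ (T ⁻¹' Iic t) = μ {τ | T τ ≤ min t c} := by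
      refine measure_congr ?_
      filter_upwards [hμ] with τ hτ
      refine propext ⟨fun h' => le_min h' hτ.2, fun h' => le_trans h' (min_le_left _ _)⟩
    have h2 : ν (Iic t) = ν (Iic (min t c)) := by
      refine measure_congr ?_
      filter_upwards [hν] with τ hτ
      refine propext ⟨fun h' => le_min h' hτ.2, fun h' => le_trans h' (min_le_left _ _)⟩
    rw [h1, h2]
    exact h _ ⟨le_min ht hc, min_le_right _ _⟩

/-- The image of Lebesgue measure weighted with the clock rate. -/
theorem map_clock_withDensity {T θ : ℝ → ℝ} {b : ℝ} (hb : 0 ≤ b) (hT : IsPrimitiveOn T θ 0 b)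
    (h0 : T 0 = 0) (hθ : ∀ᵐ τ ∂(volume.restrict (Icc 0 b)), 0 ≤ θ τ) :
    ((volume.restrict (Icc 0 b)).withDensity fun τ => ENNReal.ofReal (θ τ)).map T
      = volume.restrict (Icc 0 (T b)) := by
  have hclock : IsClock T b := ⟨hb, hT.continuousOn, hT.monotoneOn hθ, h0⟩
  have hac := withDensity_absolutelyContinuous (volume.restrict (Icc 0 b))
    (fun τ => ENNReal.ofReal (θ τ))
  have hfin : IsFiniteMeasure ((volume.restrict (Icc 0 b)).withDensity
      fun τ => ENNReal.ofReal (θ τ)) := isFiniteMeasure_withDensity_ofReal hT.1.2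
  have hI : ∀ᵐ τ ∂((volume.restrict (Icc 0 b)).withDensity fun τ => ENNReal.ofReal (θ τ)),
      τ ∈ Icc 0 b := hac.ae_le (ae_restrict_mem measurableSet_Icc)
  refine map_clock_eq (hclock.mem ⟨hb, le_rfl⟩).1
    ((hclock.cont.aemeasurable measurableSet_Icc).mono_ac hac)
    (hI.mono fun τ hτ => hclock.mem hτ) (ae_restrict_mem measurableSet_Icc) fun t ht => ?_
  -- Up to null sets, the clock has not passed `t` exactly on `[0, lastTime t]`, and the integral of
  -- `θ` over this segment is the clock value `t`.
  have h1 : ((volume.restrict (Icc 0 b)).withDensity fun τ => ENNReal.ofReal (θ τ)) {τ | T τ ≤ t}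
      = ((volume.restrict (Icc 0 b)).withDensity fun τ => ENNReal.ofReal (θ τ))
        (Icc 0 (lastTime T b t)) := by
    refine measure_congr ?_
    filter_upwards [hI] with τ hτ
    exact propext ⟨fun h' => ⟨hτ.1, (hclock.le_lastTime_iff ht.1 hτ).2 h'⟩,
      fun h' => (hclock.le_lastTime_iff ht.1 hτ).1 h'.2⟩
  have hm := lastTime_mem (T := T) hb t
  have hsub : Icc 0 (lastTime T b t) ⊆ Icc 0 b := Icc_subset_Icc_right hm.2
  rw [h1, withDensity_apply _ measurableSet_Icc, Measure.restrict_restrict measurableSet_Icc,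
    inter_eq_left.2 hsub, ← ofReal_integral_eq_lintegral_ofReal (hT.1.mono_set hsub)
      (ae_mono (Measure.restrict_mono hsub le_rfl) hθ)]
  have h2 : T (lastTime T b t) = ∫ τ in Icc 0 (lastTime T b t), θ τ := by
    rw [hT.2 _ hm, h0, zero_add, intervalIntegral.integral_of_le hm.1, integral_Icc_eq_integral_Ioc]
  rw [← h2, hclock.T_lastTime ht, Measure.restrict_apply measurableSet_Iic]
  have h3 : Iic t ∩ Icc 0 (T b) = Icc 0 t := by
    ext s
    exact ⟨fun h => ⟨h.2.1, h.1⟩, fun h => ⟨h.2, h.1, h.2.trans ht.2⟩⟩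
  rw [h3, Real.volume_Icc, sub_zero]

/-- Substitution of a clock in an integral. -/
theorem integral_comp_clock {E : Type*} [NormedAddCommGroup E] [NormedSpace ℝ E] {T θ : ℝ → ℝ}
    {b : ℝ} (hb : 0 ≤ b) (hT : IsPrimitiveOn T θ 0 b) (h0 : T 0 = 0)
    (hθ : ∀ᵐ τ ∂(volume.restrict (Icc 0 b)), 0 ≤ θ τ) {F : ℝ → E} (hF : StronglyMeasurable F) :
    ∫ t in (0 : ℝ)..T b, F t = ∫ τ in (0 : ℝ)..b, θ τ • F (T τ) := by
  have hclock : IsClock T b := ⟨hb, hT.continuousOn, hT.monotoneOn hθ, h0⟩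
  have hac := withDensity_absolutelyContinuous (volume.restrict (Icc 0 b))
    (fun τ => ENNReal.ofReal (θ τ))
  rw [intervalIntegral.integral_of_le (hclock.mem ⟨hb, le_rfl⟩).1,
    intervalIntegral.integral_of_le hb, ← integral_Icc_eq_integral_Ioc,
    ← integral_Icc_eq_integral_Ioc, ← map_clock_withDensity hb hT h0 hθ,
    integral_map ((hclock.cont.aemeasurable measurableSet_Icc).mono_ac hac)
      hF.aestronglyMeasurable,
    integral_withDensity_eq_integral_toReal_smul₀ hT.1.1.aemeasurable.ennreal_ofReal (by simp)]
  refine integral_congr_ae ?_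
  filter_upwards [hθ] with τ hτ
  rw [ENNReal.toReal_ofReal hτ]

namespace CLS

variable {n m : ℕ} {S : CLS n m}

/-! ### From the time-freezing system to physical time -/

/-- The clock of a trajectory of the time-freezing system. -/
def clock (y : ℝ → TFState n) (τ : ℝ) : ℝ := (y τ).2.2

open Classical in
/-- The trajectory in physical time that is traced out by a trajectory of the time-freezing system;
the impulses occur at the times in `J`. -/
def unfreeze (S : CLS n m) (a : ℝ) (u : ℝ → Vec m) (τf : ℝ) (y : ℝ → TFState n) (J : Finset ℝ) :
    CLSTraj n where
  q t := (y (lastTime (clock y) τf t)).1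
  v t := (y (lastTime (clock y) τf t)).2.1
  lam t := if y (lastTime (clock y) τf t) ∈ S.Sigma then
    -((S.D (y (lastTime (clock y) τf t)).1)⁻¹ * S.phi (y (lastTime (clock y) τf t)).1
      (y (lastTime (clock y) τf t)).2.1 (u t)) else 0
  imp := Finsupp.onFinset J
    (fun t => if t ∈ J then a * (lastTime (clock y) τf t - firstTime (clock y) τf t) else 0)
    (fun t ht => by
      by_contra h
      simp [h] at ht)

/-- A solution of the time-freezing system that starts in the admissible region at time zero and
does not end during an impact. -/
structure IsTame (S : CLS n m) (a : ℝ) (u w : ℝ → Vec m) (τf : ℝ) (y : ℝ → TFState n)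
    (θ : ℝ → ℝ) : Prop where
  a_pos : 0 < a
  τf_nonneg : 0 ≤ τf
  clocked : S.IsClockedSolution a w τf y θ
  c1_zero : 0 ≤ S.c1 (y 0)
  clock_zero : clock y 0 = 0
  agree : S.ControlsAgree u w τf y
  final : y τf ∉ S.Impacting

/-- A solution of the time-freezing system in a setting where it can be translated to physical
time; `J` is the set of times at which there are impacts. -/
structure IsRegular (S : CLS n m) (a : ℝ) (u w : ℝ → Vec m) (τf : ℝ) (y : ℝ → TFState n)
    (θ : ℝ → ℝ) (J : Finset ℝ) : Prop extends S.IsTame a u w τf y θ where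
  mem_J : ∀ t, t ∈ J ↔ ∃ τ ∈ Icc 0 τf, y τ ∈ S.Impacting ∧ clock y τ = t

/-- The supremum of the empty set is zero by convention. This default makes the unfrozen velocity
equal to the initial velocity at negative times, as required by `v(0⁻) = v0`. -/
theorem lastTime_of_neg {T : ℝ → ℝ} {b t : ℝ} (h : IsClock T b) (ht : t < 0) :
    lastTime T b t = 0 := by
  rw [lastTime]
  convert Real.sSup_empty
  rw [eq_empty_iff_forall_notMem]
  rintro τ ⟨hτ, hle⟩
  exact (hle.trans_lt ht).not_ge (h.mem hτ).1

/-! ### Pauses of the clock -/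

namespace IsTame

variable {a : ℝ} {u w : ℝ → Vec m} {τf : ℝ} {y : ℝ → TFState n} {θ : ℝ → ℝ}

theorem isClock (h : S.IsTame a u w τf y θ) : IsClock (clock y) τf :=
  ⟨h.τf_nonneg, h.clocked.prim_t.continuousOn, h.clocked.monotoneOn_t, h.clock_zero⟩

theorem last_mem (h : S.IsTame a u w τf y θ) (t : ℝ) :
    lastTime (clock y) τf t ∈ Icc 0 τf := lastTime_mem h.τf_nonneg t

/-- From an impacting state the clock would rest a little longer, against the choice of the last
time; at `τf` an impact is excluded by assumption. -/
theorem last_not_impacting (h : S.IsTame a u w τf y θ) {t : ℝ}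
    (ht : t ∈ Icc 0 (clock y τf)) : y (lastTime (clock y) τf t) ∉ S.Impacting := by
  intro hi
  have hm := h.last_mem t
  rcases hm.2.lt_or_eq with hlt | heq
  · obtain ⟨τ₂, h1, h2, h3⟩ := h.clocked.exists_t_eq_of_impacting h.c1_zero hm.1 hlt hi
    have h4 : clock y τ₂ = t := Eq.trans h3 (h.isClock.T_lastTime ht)
    exact h1.not_ge ((h.isClock.le_lastTime_iff ht.1 ⟨hm.1.trans h1.le, h2⟩).2 h4.le)
  · rw [heq] at hi
    exact h.final hi

/-- The pause is maximal, so its last state is not impacting; since `c2 ≤ 0` there, it lies in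
`Sigma`. -/
theorem impact_interval (h : S.IsTame a u w τf y θ) {t : ℝ} (ht : t ∈ Icc 0 (clock y τf))
    (hlt : firstTime (clock y) τf t < lastTime (clock y) τf t) :
    (∀ τ ∈ Icc (firstTime (clock y) τf t) (lastTime (clock y) τf t),
      (y τ).1 = (y (lastTime (clock y) τf t)).1) ∧
    (∀ τ ∈ Ico (firstTime (clock y) τf t) (lastTime (clock y) τf t), y τ ∈ S.Impacting) ∧
    y (lastTime (clock y) τf t) ∈ S.Sigma := by
  obtain ⟨h1, h2, h3, h4⟩ := h.clocked.impacting_of_t_eq h.a_pos h.c1_zero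
    (h.isClock.firstTime_mem ht).1 hlt (h.last_mem t).2
    ((h.isClock.T_firstTime ht).trans (h.isClock.T_lastTime ht).symm)
  refine ⟨fun τ hτ => (h1 τ hτ).trans (h1 _ ⟨hlt.le, le_rfl⟩).symm, h2, h3, ?_⟩
  by_contra hn
  exact h.last_not_impacting ht ⟨h3, lt_of_le_of_ne h4 hn⟩

/-- The clock rests only in impacts, so reading `y` at `lastTime` loses no state outside them. -/
theorem last_clock (h : S.IsTame a u w τf y θ) {τ : ℝ} (hτ : τ ∈ Icc 0 τf)
    (hn : y τ ∉ S.Impacting) : lastTime (clock y) τf (clock y τ) = τ := by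
  have ht := h.isClock.mem hτ
  have h1 := (h.isClock.T_eq_iff ht hτ).1 rfl
  by_contra hne
  have h2 : τ < lastTime (clock y) τf (clock y τ) := lt_of_le_of_ne h1.2 (Ne.symm hne)
  exact hn ((h.impact_interval ht (h1.1.trans_lt h2)).2.1 τ ⟨h1.1, h2⟩)

theorem lt_last_clock (h : S.IsTame a u w τf y θ) {τ : ℝ} (hτ : τ ∈ Icc 0 τf)
    (hi : y τ ∈ S.Impacting) :
    τ ∈ Ico (firstTime (clock y) τf (clock y τ)) (lastTime (clock y) τf (clock y τ)) := by
  have ht := h.isClock.mem hτ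
  have h1 := (h.isClock.T_eq_iff ht hτ).1 rfl
  refine ⟨h1.1, lt_of_le_of_ne h1.2 fun he => ?_⟩
  exact h.last_not_impacting ht (he ▸ hi)

end IsTame

/-! ### The unfrozen trajectory and its integral equations -/

namespace IsRegular

variable {a : ℝ} {u w : ℝ → Vec m} {τf : ℝ} {y : ℝ → TFState n} {θ : ℝ → ℝ} {J : Finset ℝ}

theorem mem_J_iff (h : S.IsRegular a u w τf y θ J) {t : ℝ} :
    t ∈ J ↔ t ∈ Icc 0 (clock y τf) ∧ firstTime (clock y) τf t < lastTime (clock y) τf t := by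
  rw [h.mem_J]
  constructor
  · rintro ⟨τ, hτ, hi, rfl⟩
    have := h.lt_last_clock hτ hi
    exact ⟨h.isClock.mem hτ, this.1.trans_lt this.2⟩
  · rintro ⟨ht, hlt⟩
    exact ⟨_, h.isClock.firstTime_mem ht, (h.impact_interval ht hlt).2.1 _ ⟨le_rfl, hlt⟩,
      h.isClock.T_firstTime ht⟩

theorem imp_of_mem {t : ℝ} (ht : t ∈ J) : (S.unfreeze a u τf y J).imp t
    = a * (lastTime (clock y) τf t - firstTime (clock y) τf t) := by
  simp [unfreeze, ht]

theorem imp_of_notMem {t : ℝ} (ht : t ∉ J) : (S.unfreeze a u τf y J).imp t = 0 := by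
  simp [unfreeze, ht]

theorem imp_pos (h : S.IsRegular a u w τf y θ J) {t : ℝ} (ht : t ∈ J) :
    0 < (S.unfreeze a u τf y J).imp t := by
  rw [imp_of_mem ht]
  exact mul_pos h.a_pos (sub_pos.2 (h.mem_J_iff.1 ht).2)

theorem support_imp (h : S.IsRegular a u w τf y θ J) : (S.unfreeze a u τf y J).imp.support = J := by
  ext t
  rw [Finsupp.mem_support_iff]
  exact ⟨fun ht => by_contra fun hn => ht (imp_of_notMem hn), fun ht => (h.imp_pos ht).ne'⟩

/-- From the left, `lastTime` tends to the beginning of the pause, so an impact runs from the left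
limit to the value. -/
theorem leftLim_v (h : S.IsRegular a u w τf y θ J) {t : ℝ} (ht : t ∈ Icc 0 (clock y τf)) :
    Function.leftLim (S.unfreeze a u τf y J).v t = (y (firstTime (clock y) τf t)).2.1 := by
  refine leftLim_eq_of_tendsto ?_
  rcases ht.1.lt_or_eq with h0 | h0
  · have hc := h.clocked.prim_v.continuousOn _ (h.isClock.firstTime_mem ht)
    refine hc.tendsto.comp (tendsto_nhdsWithin_iff.2 ⟨h.isClock.tendsto_left ht h0, ?_⟩)
    exact Eventually.of_forall fun s => h.last_mem s
  · subst h0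
    have h1 : firstTime (clock y) τf 0 = 0 :=
      le_antisymm ((h.isClock.firstTime_le_iff ht ⟨le_rfl, h.τf_nonneg⟩).2 h.clock_zero.ge)
        (h.isClock.firstTime_mem ht).1
    rw [h1]
    refine tendsto_const_nhds.congr' ?_
    filter_upwards [self_mem_nhdsWithin] with s hs
    simp only [unfreeze, lastTime_of_neg h.isClock hs]

theorem isImpactTime_iff (h : S.IsRegular a u w τf y θ J) {t : ℝ} :
    S.IsImpactTime (clock y τf) (S.unfreeze a u τf y J) t ↔ t ∈ J := by
  rw [h.mem_J_iff]
  constructor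
  · rintro ⟨ht, h1, h2⟩
    rw [h.leftLim_v ht] at h2
    refine ⟨ht, lt_of_le_of_ne (h.isClock.firstTime_le_lastTime ht) fun he => ?_⟩
    rw [he] at h2
    exact h.last_not_impacting ht ⟨h1, h2⟩
  · rintro ⟨ht, hlt⟩
    obtain ⟨h1, h2, h3⟩ := h.impact_interval ht hlt
    refine ⟨ht, h3.1, ?_⟩
    rw [h.leftLim_v ht]
    have h4 := (h2 _ ⟨le_rfl, hlt⟩).2
    rw [c2, h1 _ ⟨le_rfl, hlt.le⟩] at h4
    exact h4

/-- Nothing is known of `y` outside `[0, τf]`; measurability is derived from a globally continuous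
replacement. -/
theorem exists_continuous_extension (h : S.IsRegular a u w τf y θ J) :
    ∃ Y : ℝ → TFState n, Continuous Y ∧ ∀ τ ∈ Icc 0 τf, Y τ = y τ := by
  refine ⟨IccExtend h.τf_nonneg ((Icc 0 τf).domRestrict y), ?_, fun τ hτ => ?_⟩
  · exact (continuousOn_iff_continuous_domRestrict.1 h.clocked.prim.continuousOn).Icc_extend'
  · rw [IccExtend_of_mem _ _ hτ]
    rfl

theorem measurable_state (h : S.IsRegular a u w τf y θ J) :
    Measurable fun t => y (lastTime (clock y) τf t) := by
  obtain ⟨Y, hY, hYy⟩ := h.exists_continuous_extension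
  have : (fun t => y (lastTime (clock y) τf t)) = fun t => Y (lastTime (clock y) τf t) :=
    funext fun t => (hYy _ (h.last_mem t)).symm
  rw [this]
  exact hY.measurable.comp monotone_lastTime.measurable

theorem exists_bound (h : S.IsRegular a u w τf y θ J) :
    ∃ R, ∀ t, ‖y (lastTime (clock y) τf t)‖ ≤ R := by
  obtain ⟨R, hR⟩ := isCompact_Icc.exists_bound_of_continuousOn h.clocked.prim.continuousOn
  exact ⟨R, fun t => hR _ (h.last_mem t)⟩

theorem integrableOn_of_measurable_bound {E : Type*} [NormedAddCommGroup E] {F : ℝ → E} {C c : ℝ}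
    (hF : StronglyMeasurable F) (hC : ∀ t, ‖F t‖ ≤ C) : IntegrableOn F (Icc 0 c) :=
  Measure.integrableOn_of_bounded (by simp) hF.aestronglyMeasurable (M := C)
    (Eventually.of_forall hC)

theorem measurable_args (h : S.IsRegular a u w τf y θ J) (hu : Measurable u) :
    Measurable fun t => ((y (lastTime (clock y) τf t)).1,
      (y (lastTime (clock y) τf t)).2.1, u t) :=
  h.measurable_state.fst.prodMk (h.measurable_state.snd.fst.prodMk hu)

theorem bounded_comp (h : S.IsRegular a u w τf y θ J) (hub : ∃ K, ∀ t, ‖u t‖ ≤ K)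
    {E : Type*} [NormedAddCommGroup E] {Φ : Vec n × Vec n × Vec m → E} (hΦ : Continuous Φ) :
    ∃ C, ∀ t, ‖Φ ((y (lastTime (clock y) τf t)).1, (y (lastTime (clock y) τf t)).2.1, u t)‖ ≤ C := by
  obtain ⟨R, hR⟩ := h.exists_bound
  obtain ⟨K, hK⟩ := hub
  obtain ⟨C, hC⟩ := (isCompact_closedBall (0 : Vec n × Vec n × Vec m)
    (max R K)).exists_bound_of_continuousOn hΦ.continuousOn
  refine ⟨C, fun t => hC _ ?_⟩
  rw [mem_closedBall_zero_iff, Prod.norm_def, Prod.norm_def]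
  refine max_le ?_ (max_le ?_ ((hK t).trans (le_max_right _ _)))
  · exact (norm_fst_le (y (lastTime (clock y) τf t))).trans ((hR t).trans (le_max_left _ _))
  · exact (norm_fst_le (y (lastTime (clock y) τf t)).2).trans
      ((norm_snd_le (y (lastTime (clock y) τf t))).trans ((hR t).trans (le_max_left _ _)))

theorem measurable_lam (h : S.IsRegular a u w τf y θ J) (hu : Measurable u) :
    Measurable (S.unfreeze a u τf y J).lam := by
  obtain ⟨Φ, hΦ, hΦm⟩ : ∃ Φ : Vec n × Vec n × Vec m → ℝ,
      (∀ q v u, Φ (q, v, u) = -((S.D q)⁻¹ * S.phi q v u)) ∧ Measurable Φ :=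
    ⟨fun p => -((S.D p.1)⁻¹ * S.phi p.1 p.2.1 p.2.2), fun _ _ _ => rfl,
      ((S.contDiff_D.continuous.measurable.comp measurable_fst).inv.mul
        S.continuous_phi.measurable).neg⟩
  have hΦc := hΦm.comp (h.measurable_args hu)
  simp only [unfreeze, ← hΦ]
  exact Measurable.ite (h.measurable_state S.isClosed_Sigma.measurableSet) hΦc measurable_const

/-- `D` may degenerate away from contact, but on the compact set of contact times, where alone it is
inverted, `D⁻¹` is bounded. -/
theorem lam_integrable (h : S.IsRegular a u w τf y θ J) (hu : Measurable u)
    (hub : ∃ K, ∀ t, ‖u t‖ ≤ K) : IntegrableOn (S.unfreeze a u τf y J).lam (Icc 0 (clock y τf)) := by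
  have hK : IsCompact (Icc 0 τf ∩ (fun τ => S.c1 (y τ)) ⁻¹' {0}) :=
    isCompact_Icc.of_isClosed_subset (h.clocked.prim_c1.continuousOn.preimage_isClosed_of_isClosed
      isClosed_Icc isClosed_singleton) inter_subset_left
  have hc : ContinuousOn (fun τ => (S.D (y τ).1)⁻¹) (Icc 0 τf ∩ (fun τ => S.c1 (y τ)) ⁻¹' {0}) := by
    refine ContinuousOn.inv₀ ?_ fun τ hτ => (S.D_pos hτ.2).ne'
    exact S.contDiff_D.continuous.comp_continuousOn
      (h.clocked.prim_q.continuousOn.mono inter_subset_left)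
  obtain ⟨C, hC⟩ := hK.exists_bound_of_continuousOn hc
  obtain ⟨B, hB⟩ := h.bounded_comp hub S.continuous_phi
  have hB0 : 0 ≤ B := (norm_nonneg _).trans (hB 0)
  refine integrableOn_of_measurable_bound (C := |C| * B) (h.measurable_lam hu).stronglyMeasurable
    fun t => ?_
  simp only [unfreeze]
  split_ifs with hS
  · rw [norm_neg, norm_mul]
    refine mul_le_mul ?_ (hB t) (norm_nonneg _) (abs_nonneg _)
    exact (hC _ ⟨h.last_mem t, hS.1⟩).trans (le_abs_self C)
  · rw [norm_zero]
    positivity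

theorem fv_measurable (h : S.IsRegular a u w τf y θ J) (hu : Measurable u) :
    Measurable fun t => S.fv ((S.unfreeze a u τf y J).q t) ((S.unfreeze a u τf y J).v t) (u t) :=
  S.continuous_fv.measurable.comp (h.measurable_args hu)

theorem fv_integrable (h : S.IsRegular a u w τf y θ J) (hu : Measurable u)
    (hub : ∃ K, ∀ t, ‖u t‖ ≤ K) :
    IntegrableOn (fun t => S.fv ((S.unfreeze a u τf y J).q t) ((S.unfreeze a u τf y J).v t) (u t))
      (Icc 0 (clock y τf)) := by
  obtain ⟨B, hB⟩ := h.bounded_comp hub S.continuous_fv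
  exact integrableOn_of_measurable_bound (h.fv_measurable hu).stronglyMeasurable hB

theorem v_integrable (h : S.IsRegular a u w τf y θ J) :
    IntegrableOn (S.unfreeze a u τf y J).v (Icc 0 (clock y τf)) := by
  obtain ⟨R, hR⟩ := h.exists_bound
  exact integrableOn_of_measurable_bound h.measurable_state.snd.fst.stronglyMeasurable
    fun t => (norm_fst_le _).trans ((norm_snd_le _).trans (hR t))

theorem integral_comp (h : S.IsRegular a u w τf y θ J) {E : Type*} [NormedAddCommGroup E]
    [NormedSpace ℝ E] {F : ℝ → E} (hF : StronglyMeasurable F) {t : ℝ}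
    (ht : t ∈ Icc 0 (clock y τf)) :
    ∫ s in (0 : ℝ)..t, F s
      = ∫ τ in (0 : ℝ)..lastTime (clock y) τf t, θ τ • F (clock y τ) := by
  have hm := h.last_mem t
  have := integral_comp_clock hm.1 (h.clocked.prim_t.mono le_rfl hm.2) h.clock_zero
    (ae_mono (Measure.restrict_mono (Icc_subset_Icc_right hm.2) le_rfl) h.clocked.θ_nonneg) hF
  refine Eq.trans ?_ this
  congr 1
  exact (h.isClock.T_lastTime ht).symm

theorem q_eq (h : S.IsRegular a u w τf y θ J) {t : ℝ} (ht : t ∈ Icc 0 (clock y τf)) :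
    (S.unfreeze a u τf y J).q t = (y 0).1 + ∫ s in (0 : ℝ)..t, (S.unfreeze a u τf y J).v s := by
  have hm := h.last_mem t
  have hv : StronglyMeasurable (S.unfreeze a u τf y J).v :=
    h.measurable_state.snd.fst.stronglyMeasurable
  rw [h.integral_comp hv ht]
  refine (h.clocked.prim_q.2 _ hm).trans ?_
  congr 1
  refine intervalIntegral.integral_congr_ae ?_
  have h1 := h.clocked.ae_impacting
  rw [ae_restrict_iff' measurableSet_Icc] at h1
  filter_upwards [h1] with τ hτ hI
  rw [uIoc_of_le hm.1] at hI
  have hI' : τ ∈ Icc 0 τf := ⟨hI.1.le, hI.2.trans hm.2⟩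
  -- The integrands can differ only in impacts, where both carry the factor `θ = 0`.
  by_cases hi : y τ ∈ S.Impacting
  · rw [hτ hI' hi, zero_smul, zero_smul]
  · simp only [unfreeze, h.last_clock hI' hi]

theorem measurableSet_impacting (h : S.IsRegular a u w τf y θ J) :
    MeasurableSet {τ | τ ∈ Icc 0 τf ∧ y τ ∈ S.Impacting} := by
  obtain ⟨Y, hY, hYy⟩ := h.exists_continuous_extension
  have : {τ | τ ∈ Icc 0 τf ∧ y τ ∈ S.Impacting}
      = Icc 0 τf ∩ ({τ | S.c1 (Y τ) = 0} ∩ {τ | S.c2 (Y τ) < 0}) := by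
    ext τ
    constructor
    · rintro ⟨h1, h2⟩
      refine ⟨h1, ?_⟩
      simp only [mem_inter_iff, mem_ofPred_eq, hYy τ h1]
      exact h2
    · rintro ⟨h1, h2⟩
      simp only [mem_inter_iff, mem_ofPred_eq, hYy τ h1] at h2
      exact ⟨h1, h2⟩
  rw [this]
  refine measurableSet_Icc.inter (MeasurableSet.inter ?_ ?_)
  · exact (isClosed_eq (S.continuous_c1.comp hY) continuous_const).measurableSet
  · exact (isOpen_lt (S.continuous_c2.comp hY) continuous_const).measurableSet

/-- The impacting times form disjoint intervals, one for each impact up to `t`. On each the position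
is fixed, so the contribution is `a` times the length times `M⁻¹ n`, which is the jump. -/
theorem integral_impacts (h : S.IsRegular a u w τf y θ J) {t : ℝ} (ht : t ∈ Icc 0 (clock y τf)) :
    ∫ τ in (0 : ℝ)..lastTime (clock y) τf t,
      indicator {τ | τ ∈ Icc 0 τf ∧ y τ ∈ S.Impacting} (fun τ => a • S.invMn (y τ).1) τ
      = S.jumps (S.unfreeze a u τf y J) t := by
  have hm := h.last_mem t
  have hset : ({τ | τ ∈ Icc 0 τf ∧ y τ ∈ S.Impacting} ∩ Icc 0 (lastTime (clock y) τf t) : Set ℝ)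
      = ⋃ s ∈ J.filter (· ≤ t), Ico (firstTime (clock y) τf s) (lastTime (clock y) τf s) := by
    ext τ
    simp only [mem_inter_iff, mem_ofPred_eq, mem_iUnion, Finset.mem_filter, exists_prop]
    constructor
    · rintro ⟨⟨hI, hi⟩, hle⟩
      exact ⟨clock y τ, ⟨(h.mem_J _).2 ⟨τ, hI, hi, rfl⟩,
        (h.isClock.le_lastTime_iff ht.1 hI).1 hle.2⟩, h.lt_last_clock hI hi⟩
    · rintro ⟨s, ⟨hs, hst⟩, hτ⟩
      obtain ⟨hsI, hlt⟩ := h.mem_J_iff.1 hs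
      have hτ0 : 0 ≤ τ := (h.isClock.firstTime_mem hsI).1.trans hτ.1
      refine ⟨⟨⟨hτ0, hτ.2.le.trans (h.last_mem s).2⟩, (h.impact_interval hsI hlt).2.1 τ hτ⟩, hτ0, ?_⟩
      exact hτ.2.le.trans (monotone_lastTime hst)
  have hval : ∀ s ∈ J.filter (· ≤ t),
      ∀ τ ∈ Ico (firstTime (clock y) τf s) (lastTime (clock y) τf s),
      a • S.invMn (y τ).1 = a • S.invMn ((S.unfreeze a u τf y J).q s) := by
    intro s hs τ hτ
    obtain ⟨hsI, hlt⟩ := h.mem_J_iff.1 (Finset.mem_filter.1 hs).1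
    rw [(h.impact_interval hsI hlt).1 τ ⟨hτ.1, hτ.2.le⟩]
    rfl
  rw [intervalIntegral.integral_of_le hm.1, ← integral_Icc_eq_integral_Ioc,
    setIntegral_indicator h.measurableSet_impacting, inter_comm, hset, integral_biUnion_finset]
  · rw [jumps, jumpSum, h.support_imp]
    refine Finset.sum_congr rfl fun s hs => ?_
    obtain ⟨hsI, hlt⟩ := h.mem_J_iff.1 (Finset.mem_filter.1 hs).1
    rw [setIntegral_congr_fun measurableSet_Ico (hval s hs), setIntegral_const,
      imp_of_mem (Finset.mem_filter.1 hs).1, Measure.real, Real.volume_Ico,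
      ENNReal.toReal_ofReal (sub_pos.2 hlt).le, smul_smul, mul_comm]
  · exact fun s _ => measurableSet_Ico
  · intro s hs r hr hsr
    refine Set.disjoint_left.2 fun τ h1 h2 => hsr ?_
    have key : ∀ s ∈ J.filter (· ≤ t),
        τ ∈ Ico (firstTime (clock y) τf s) (lastTime (clock y) τf s) → clock y τ = s := by
      intro s hs h1
      have hsI := (h.mem_J_iff.1 (Finset.mem_filter.1 hs).1).1
      exact (h.isClock.T_eq_iff hsI ⟨(h.isClock.firstTime_mem hsI).1.trans h1.1,
        h1.2.le.trans (h.last_mem s).2⟩).2 ⟨h1.1, h1.2.le⟩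
    rw [← key s hs h1, ← key r hr h2]
  · intro s hs
    rw [integrableOn_congr_fun (hval s hs) measurableSet_Ico]
    exact integrableOn_const (by simp)

theorem v_eq (h : S.IsRegular a u w τf y θ J) (hu : Measurable u) {t : ℝ}
    (ht : t ∈ Icc 0 (clock y τf)) :
    (S.unfreeze a u τf y J).v t = (y 0).2.1
      + (∫ s in (0 : ℝ)..t, S.accel u (S.unfreeze a u τf y J) s)
      + S.jumps (S.unfreeze a u τf y J) t := by
  have hm := h.last_mem t
  have hF : StronglyMeasurable (S.accel u (S.unfreeze a u τf y J)) :=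
    ((h.fv_measurable hu).add ((h.measurable_lam hu).smul
      (S.contDiff_invMn.continuous.measurable.comp h.measurable_state.fst))).stronglyMeasurable
  set G : ℝ → Vec n := indicator {τ | τ ∈ Icc 0 τf ∧ y τ ∈ S.Impacting}
    (fun τ => a • S.invMn (y τ).1) with hG
  rw [h.integral_comp hF ht, ← h.integral_impacts ht, ← hG]
  have hp := h.clocked.prim_v.mono le_rfl hm.2
  -- In impacts only the auxiliary dynamics remain; elsewhere `(1 - θ) a = θ λ` turns them into the
  -- contact force at the rate of the clock.
  have hsplit : ∀ᵐ τ ∂(volume.restrict (Icc 0 τf)),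
      θ τ • S.fv (y τ).1 (y τ).2.1 (w τ) + ((1 - θ τ) * a) • S.invMn (y τ).1
      = θ τ • S.accel u (S.unfreeze a u τf y J) (clock y τ) + G τ := by
    filter_upwards [h.clocked.ae_impacting, h.clocked.ae_not_impacting h.a_pos h.c1_zero,
      ae_restrict_mem measurableSet_Icc] with τ h1 h2 hI
    by_cases hi : y τ ∈ S.Impacting
    · rw [h1 hi, hG, indicator_of_mem (show τ ∈ {τ | τ ∈ Icc 0 τf ∧ y τ ∈ S.Impacting} from ⟨hI, hi⟩)]
      simp
    · obtain ⟨l, -, h3, h4⟩ := h2 hi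
      rw [hG, indicator_of_notMem (fun h' => hi h'.2), h3, add_zero, h.agree τ hI hi, mul_smul,
        ← smul_add, h4, h.agree τ hI hi]
      simp only [accel, unfreeze]
      rw [h.last_clock hI hi]
      rfl
  have hGint : IntegrableOn G (Icc 0 (lastTime (clock y) τf t)) := by
    refine IntegrableOn.indicator ?_ h.measurableSet_impacting
    refine ContinuousOn.integrableOn_Icc ?_
    exact ((S.contDiff_invMn.continuous.comp_continuousOn h.clocked.prim_q.continuousOn).mono
      (Icc_subset_Icc_right hm.2)).const_smul a
  have hp2 := hp.congr_ae
    (ae_mono (Measure.restrict_mono (Icc_subset_Icc_right hm.2) le_rfl) hsplit)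
  have h0 : (0 : ℝ) ∈ Icc 0 (lastTime (clock y) τf t) := ⟨le_rfl, hm.1⟩
  have h1 : lastTime (clock y) τf t ∈ Icc 0 (lastTime (clock y) τf t) := ⟨hm.1, le_rfl⟩
  have hGi : IntervalIntegrable G volume 0 (lastTime (clock y) τf t) :=
    (IsPrimitiveOn.of_integrableOn hGint).intervalIntegrable h0 h1
  have hp3 := hp2.2 _ h1
  have hAi : IntervalIntegrable (fun τ => θ τ • S.accel u (S.unfreeze a u τf y J) (clock y τ))
      volume 0 (lastTime (clock y) τf t) := by
    have := (hp2.intervalIntegrable h0 h1).sub hGi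
    simpa using this
  rw [intervalIntegral.integral_add hAi hGi] at hp3
  refine hp3.trans ?_
  abel

end IsRegular

end CLS

/-! ### The unfrozen trajectory solves the CLS and is related -/

namespace CLS

variable {n m : ℕ} {S : CLS n m}

namespace IsRegular

variable {a : ℝ} {u w : ℝ → Vec m} {τf : ℝ} {y : ℝ → TFState n} {θ : ℝ → ℝ} {J : Finset ℝ}

open Classical in
theorem unfreeze_lam_clock (h : S.IsRegular a u w τf y θ J) {τ : ℝ} (hτ : τ ∈ Icc 0 τf)
    (hn : y τ ∉ S.Impacting) : (S.unfreeze a u τf y J).lam (clock y τ) =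
      if y τ ∈ S.Sigma then -((S.D (y τ).1)⁻¹ * S.phi (y τ).1 (y τ).2.1 (u (clock y τ))) else 0 := by
  simp only [unfreeze]
  rw [h.last_clock hτ hn]

/-- Lebesgue measure in physical time is the image of `θ dτ`, so only numerical times with `θ ≠ 0`
matter. These are almost all outside impacts, where the sign of the force is known. -/
theorem ae_lam_nonneg (h : S.IsRegular a u w τf y θ J) (hu : Measurable u) :
    ∀ᵐ t ∂(volume.restrict (Icc 0 (clock y τf))), 0 ≤ (S.unfreeze a u τf y J).lam t := by
  have hmap : ((volume.restrict (Icc 0 τf)).withDensity fun τ => ENNReal.ofReal (θ τ)).map (clock y)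
      = volume.restrict (Icc 0 (clock y τf)) :=
    map_clock_withDensity h.τf_nonneg h.clocked.prim_t h.clock_zero h.clocked.θ_nonneg
  rw [← hmap, ae_map_iff
    ((h.isClock.cont.aemeasurable measurableSet_Icc).mono_ac (withDensity_absolutelyContinuous _ _))
    (measurableSet_le measurable_const (h.measurable_lam hu)),
    ae_withDensity_iff' h.clocked.prim_t.1.1.aemeasurable.ennreal_ofReal]
  filter_upwards [h.clocked.ae_impacting, h.clocked.ae_not_impacting h.a_pos h.c1_zero,
    ae_restrict_mem measurableSet_Icc] with τ h1 h2 hI hne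
  have hi : y τ ∉ S.Impacting := fun hi => hne (by simp [h1 hi])
  obtain ⟨l, hl, -, h4⟩ := h2 hi
  rw [h.agree τ hI hi] at h4
  rw [h.unfreeze_lam_clock hI hi]
  exact hl.trans_eq h4

theorem isSolution (h : S.IsRegular a u w τf y θ J) (hu : Measurable u)
    (hub : ∃ K, ∀ t, ‖u t‖ ≤ K) :
    S.IsSolution u (y 0).1 (y 0).2.1 (clock y τf) (S.unfreeze a u τf y J) where
  lam_integrable := h.lam_integrable hu hub
  fv_integrable := h.fv_integrable hu hub
  v_integrable := h.v_integrable
  v_init t ht := by simp only [unfreeze, lastTime_of_neg h.isClock ht]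
  q_eq t ht := h.q_eq ht
  v_eq t ht := h.v_eq hu ht
  fc_nonneg t _ := h.clocked.c1_nonneg h.c1_zero (h.last_mem t)
  compl := by
    filter_upwards [h.ae_lam_nonneg hu] with t ht
    refine ⟨ht, ?_⟩
    simp only [unfreeze]
    split_ifs with hS
    · rw [show S.fc (y (lastTime (clock y) τf t)).1 = 0 from hS.1, mul_zero]
    · rw [zero_mul]
  imp_nonneg t := by
    by_cases ht : t ∈ J
    · exact (h.imp_pos ht).le
    · exact (imp_of_notMem ht).ge
  imp_only t ht := h.isImpactTime_iff.2 (by_contra fun hn => ht (imp_of_notMem hn))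
  impact_law t ht := by
    have h1 := h.mem_J_iff.1 (h.isImpactTime_iff.1 ht)
    exact (h.impact_interval h1.1 h1.2).2.2.2

theorem related (h : S.IsRegular a u w τf y θ J) (hu : Measurable u)
    (hub : ∃ K, ∀ t, ‖u t‖ ≤ K) : S.Related a u τf y (S.unfreeze a u τf y J) where
  state_eq τ hτ hn := by
    have hi : y τ ∉ S.Impacting := fun hi =>
      hn (h.isImpactTime_iff.2 ((h.mem_J _).2 ⟨τ, hτ, hi, rfl⟩))
    have h1 : lastTime (clock y) τf (y τ).2.2 = τ := h.last_clock hτ hi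
    simp only [unfreeze, h1]
  lam_eq := by
    -- Off the finite set `J` every `τ` with clock value `t` is non-impacting, hence the last one
    -- with this value.
    have hJ : ∀ᵐ t ∂(volume.restrict (Icc 0 (y τf).2.2)), t ∉ (J : Set ℝ) :=
      ae_restrict_of_ae (measure_eq_zero_iff_ae_notMem.1 (J.finite_toSet.measure_zero _))
    filter_upwards [hJ] with t ht τ hτ hτt
    have hi : y τ ∉ S.Impacting := fun hi => ht ((h.mem_J _).2 ⟨τ, hτ, hi, hτt⟩)
    subst hτt
    have h1 : lastTime (clock y) τf (y τ).2.2 = τ := h.last_clock hτ hi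
    simp only [unfreeze]
    rw [h1]
  impulse_eq ts hts := by
    have hJ := h.isImpactTime_iff.1 hts
    obtain ⟨htI, hlt⟩ := h.mem_J_iff.1 hJ
    obtain ⟨-, h2, h3⟩ := h.impact_interval htI hlt
    refine ⟨_, _, (h.isClock.firstTime_mem htI).1, hlt, (h.last_mem ts).2,
      fun τ hτ => h.isClock.T_eq_iff htI hτ, h2, h3, ?_⟩
    have hs := h.isSolution hu hub
    rw [intervalIntegral.integral_const, smul_eq_mul, mul_comm, ← imp_of_mem (S := S) (u := u) hJ]
    exact tendsto_contactForce hs.lam_integrable hs.imp_nonneg ts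

theorem atMostOneImpact (h : S.IsRegular a u w τf y θ J) (hJ : S.AtMostOneImpactTF τf y) :
    S.AtMostOneImpact (clock y τf) (S.unfreeze a u τf y J) := by
  intro t s ht hs
  obtain ⟨τ, hτ, hi, rfl⟩ := (h.mem_J t).1 (h.isImpactTime_iff.1 ht)
  obtain ⟨σ, hσ, hi', rfl⟩ := (h.mem_J s).1 (h.isImpactTime_iff.1 hs)
  exact hJ τ hτ σ hσ hi hi'

end IsRegular

/-- The times at which a trajectory of the time-freezing system is in an impact. -/
def impactTimes (S : CLS n m) (τf : ℝ) (y : ℝ → TFState n) : Set ℝ :=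
  {t | ∃ τ ∈ Icc 0 τf, y τ ∈ S.Impacting ∧ clock y τ = t}

theorem IsTFSolution.exists_isTame {a : ℝ} {u w : ℝ → Vec m} {q0 v0 : Vec n} {τf : ℝ}
    {y : ℝ → TFState n} (ha : 0 < a) (h0 : 0 ≤ S.fc q0) (hτ : 0 ≤ τf)
    (hy : S.IsTFSolution a w (q0, v0, 0) τf y) (hc : S.ControlsAgree u w τf y)
    (hf : y τf ∉ S.Impacting) : y 0 = (q0, v0, 0) ∧ ∃ θ, S.IsTame a u w τf y θ := by
  obtain ⟨hy0, θ, hθ⟩ := hy.exists_clocked hτ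
  refine ⟨hy0, θ, ha, hτ, hθ, ?_, ?_, hc, hf⟩
  · rw [hy0]
    exact h0
  · rw [clock, hy0]

theorem IsTame.isRegular {a : ℝ} {u w : ℝ → Vec m} {τf : ℝ} {y : ℝ → TFState n} {θ : ℝ → ℝ}
    (h : S.IsTame a u w τf y θ) (hJ : (S.impactTimes τf y).Finite) :
    S.IsRegular a u w τf y θ hJ.toFinset :=
  ⟨h, fun t => by rw [Finite.mem_toFinset]; rfl⟩

theorem AtMostOneImpactTF.finite {τf : ℝ} {y : ℝ → TFState n} (h : S.AtMostOneImpactTF τf y) :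
    (S.impactTimes τf y).Finite := by
  refine Set.Subsingleton.finite ?_
  rintro _ ⟨τ, hτ, hi, rfl⟩ _ ⟨σ, hσ, hi', rfl⟩
  exact h τ hτ σ hσ hi hi'

/-- Solutions of the time-freezing system with finitely many impacts yield solutions in physical
time. -/
theorem IsTFSolution.exists_isSolution {a : ℝ} {u w : ℝ → Vec m} {q0 v0 : Vec n} {τf : ℝ}
    {y : ℝ → TFState n} (ha : 0 < a) (h0 : 0 ≤ S.fc q0) (hu : Measurable u)
    (hub : ∃ K, ∀ t, ‖u t‖ ≤ K) (hτ : 0 ≤ τf) (hy : S.IsTFSolution a w (q0, v0, 0) τf y)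
    (hc : S.ControlsAgree u w τf y) (hf : y τf ∉ S.Impacting) (hJ : S.AtMostOneImpactTF τf y) :
    ∃ x : CLSTraj n, S.IsSolution u q0 v0 (y τf).2.2 x ∧ S.AtMostOneImpact (y τf).2.2 x ∧
      S.Related a u τf y x := by
  obtain ⟨hy0, θ, ht⟩ := hy.exists_isTame ha h0 hτ hc hf
  have hr := ht.isRegular hJ.finite
  have hs := hr.isSolution hu hub
  rw [hy0] at hs
  exact ⟨_, hs, hr.atMostOneImpact hJ, hr.related hu hub⟩

end CLS

namespace CLS

variable {n m : ℕ} {S : CLS n m}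

theorem jumpSum_zero_of_forall {E : Type*} [AddCommGroup E] [Module ℝ E] {p : ℝ →₀ ℝ} (c : ℝ → E)
    {t : ℝ} (h : ∀ s ∈ p.support, t < s) : jumpSum p c t = 0 := by
  rw [jumpSum, Finset.filter_eq_empty_iff.2 fun s hs => (h s hs).not_ge, Finset.sum_empty]

/-! ### From physical time to the time-freezing system -/

/-- The sum of the impulses up to time `t`. -/
def impulse (x : CLSTraj n) (t : ℝ) : ℝ := jumpSum x.imp (fun _ => (1 : ℝ)) t

/-- The numerical time at which the physical time `t` is left. -/
def dilate (a : ℝ) (x : CLSTraj n) (t : ℝ) : ℝ :=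
  t + a⁻¹ * ((∫ s in (0 : ℝ)..t, x.lam s) + impulse x t)

/-- The clock state as a function of numerical time. -/
def dilateClock (a tf : ℝ) (x : CLSTraj n) (τ : ℝ) : ℝ := lastTime (dilate a x) tf τ

/-- The rate of the clock as a function of physical time. -/
def clockRate (a : ℝ) (x : CLSTraj n) (t : ℝ) : ℝ :=
  if t ∈ x.imp.support then 0 else a / (a + x.lam t)

/-- The trajectory of the time-freezing system defined by a trajectory in physical time. -/
def freeze (S : CLS n m) (a tf : ℝ) (x : CLSTraj n) (τ : ℝ) : TFState n :=
  (x.q (dilateClock a tf x τ),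
    x.v (dilateClock a tf x τ) - (a * (dilate a x (dilateClock a tf x τ) - τ)) •
      S.invMn (x.q (dilateClock a tf x τ)),
    dilateClock a tf x τ)

/-- The velocity of `freeze` as a function of physical time. -/
def freezeField (S : CLS n m) (a : ℝ) (u : ℝ → Vec m) (x : CLSTraj n) (t : ℝ) : TFState n :=
  (clockRate a x t • x.v t, clockRate a x t • S.fv (x.q t) (x.v t) (u t)
    + ((1 - clockRate a x t) * a) • S.invMn (x.q t), clockRate a x t)

/-- The image of numerical time in physical time. -/
def dilateMeasure (a tf : ℝ) (x : CLSTraj n) : Measure ℝ :=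
  (volume.restrict (Icc 0 tf)).withDensity (fun t => ENNReal.ofReal (1 + a⁻¹ * x.lam t)) +
    ∑ s ∈ x.imp.support, ENNReal.ofReal (a⁻¹ * x.imp s) • Measure.dirac s

namespace IsSolution

variable {u : ℝ → Vec m} {q0 v0 : Vec n} {tf : ℝ} {x : CLSTraj n} {a : ℝ}

theorem impulse_add_le (hx : S.IsSolution u q0 v0 tf x) {s t : ℝ} (hst : s < t) :
    impulse x s + x.imp t ≤ impulse x t := by
  simp only [impulse, jumpSum, smul_eq_mul, mul_one]
  by_cases ht : t ∈ x.imp.support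
  · have h1 : ∑ r ∈ x.imp.support with r ≤ s, x.imp r + x.imp t
        = ∑ r ∈ insert t (x.imp.support.filter (· ≤ s)), x.imp r := by
      rw [Finset.sum_insert (by simp [hst]), add_comm]
    rw [h1]
    refine Finset.sum_le_sum_of_subset_of_nonneg ?_ fun r _ _ => hx.imp_nonneg r
    intro r hr
    rcases Finset.mem_insert.1 hr with rfl | hr
    · exact Finset.mem_filter.2 ⟨ht, le_rfl⟩
    · have := Finset.mem_filter.1 hr
      exact Finset.mem_filter.2 ⟨this.1, this.2.trans hst.le⟩
  · rw [Finsupp.notMem_support_iff.1 ht, add_zero]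
    refine Finset.sum_le_sum_of_subset_of_nonneg ?_ fun r _ _ => hx.imp_nonneg r
    intro r hr
    have := Finset.mem_filter.1 hr
    exact Finset.mem_filter.2 ⟨this.1, this.2.trans hst.le⟩

theorem impulse_zero (hx : S.IsSolution u q0 v0 tf x) : impulse x 0 = x.imp 0 := by
  obtain ⟨s, hs, hs0⟩ := ((eventually_jumpSum_left x.imp (fun _ => (1 : ℝ)) 0).and
    self_mem_nhdsWithin).exists
  rw [jumpSum_zero_of_forall _ fun r hr => lt_of_lt_of_le hs0 (hx.mem_of_support hr).1.1] at hs
  simp only [smul_eq_mul, mul_one] at hs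
  rw [impulse]
  linarith

theorem lam_prim (hx : S.IsSolution u q0 v0 tf x) :
    IsPrimitiveOn (fun t => ∫ s in (0 : ℝ)..t, x.lam s) x.lam 0 tf :=
  IsPrimitiveOn.of_integrableOn hx.lam_integrable

theorem ae_lam_nonneg (hx : S.IsSolution u q0 v0 tf x) :
    ∀ᵐ t ∂(volume.restrict (Icc 0 tf)), 0 ≤ x.lam t := hx.compl.mono fun _ h => h.1

/-- Besides strict monotonicity, this keeps earlier values below the jump of `dilate` at `t`, which
locates the pause. -/
theorem dilate_add_le (hx : S.IsSolution u q0 v0 tf x) (ha : 0 < a) {s t : ℝ}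
    (hs : s ∈ Icc 0 tf) (ht : t ∈ Icc 0 tf) (hst : s < t) :
    dilate a x s + (t - s) + a⁻¹ * x.imp t ≤ dilate a x t := by
  have h1 := hx.lam_prim.monotoneOn hx.ae_lam_nonneg hs ht hst.le
  have h2 := hx.impulse_add_le hst
  have h3 : 0 < a⁻¹ := inv_pos.2 ha
  simp only at h1
  unfold dilate
  nlinarith

theorem dilate_strictMonoOn (hx : S.IsSolution u q0 v0 tf x) (ha : 0 < a) :
    StrictMonoOn (dilate a x) (Icc 0 tf) := by
  intro s hs t ht hst
  have h1 := hx.dilate_add_le ha hs ht hst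
  have h2 := mul_nonneg (inv_pos.2 ha).le (hx.imp_nonneg t)
  linarith

theorem dilate_zero (hx : S.IsSolution u q0 v0 tf x) : dilate a x 0 = a⁻¹ * x.imp 0 := by
  rw [dilate, hx.impulse_zero]
  simp

theorem dilate_mem (hx : S.IsSolution u q0 v0 tf x) (ha : 0 < a) {t : ℝ} (ht : t ∈ Icc 0 tf) :
    dilate a x t ∈ Icc 0 (dilate a x tf) := by
  have h0 : (0 : ℝ) ∈ Icc 0 tf := ⟨le_rfl, ht.1.trans ht.2⟩
  have h1 := (hx.dilate_strictMonoOn ha).monotoneOn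
  refine ⟨?_, h1 ht ⟨h0.2, le_rfl⟩ ht.2⟩
  refine le_trans ?_ (h1 h0 ht ht.1)
  rw [hx.dilate_zero]
  exact mul_nonneg (inv_pos.2 ha).le (hx.imp_nonneg 0)

/-- Right-continuity in the form that inverting `dilate` needs; the next statement plays the same
role for left limits. -/
theorem dilate_right (hx : S.IsSolution u q0 v0 tf x) {t c : ℝ} (ht : 0 ≤ t) (ht' : t < tf)
    (hc : dilate a x t < c) : ∃ s ∈ Ioc t tf, dilate a x s < c := by
  obtain ⟨d, hd, hd'⟩ := eventually_no_impulse_right x t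
  have hcont : ContinuousWithinAt (fun s => s + a⁻¹ * ((∫ r in (0 : ℝ)..s, x.lam r) + impulse x t))
      (Ioi t) t := by
    have h1 : ContinuousWithinAt (fun s => ∫ r in (0 : ℝ)..s, x.lam r) (Ioi t) t :=
      (hx.lam_prim.continuousOn t ⟨ht, ht'.le⟩).mono_of_mem_nhdsWithin
        (mem_of_superset (Ioo_mem_nhdsGT ht') fun s hs => ⟨ht.trans hs.1.le, hs.2.le⟩)
    exact continuousWithinAt_id.add (continuousWithinAt_const.mul (h1.add continuousWithinAt_const))
  have hev := hcont.eventually_lt_const hc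
  obtain ⟨s, hs, hs1, hs2⟩ := (hev.and ((eventually_mem_set.2 (Ioo_mem_nhdsGT ht')).and
    (eventually_mem_set.2 (Ioo_mem_nhdsGT hd)))).exists
  refine ⟨s, ⟨hs1.1, hs1.2.le⟩, ?_⟩
  have h2 : impulse x s = impulse x t :=
    jumpSum_congr _ hs1.1.le fun r hr hrs => hd' r hr ⟨hrs.1, hrs.2.trans hs2.2.le⟩
  rw [dilate, h2]
  exact hs

theorem dilate_left (hx : S.IsSolution u q0 v0 tf x) {t c : ℝ} (ht : t ∈ Icc 0 tf) (h0 : 0 < t)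
    (hc : c < dilate a x t - a⁻¹ * x.imp t) : ∃ s ∈ Ico 0 t, c < dilate a x s := by
  have hcont : ContinuousWithinAt
      (fun s => s + a⁻¹ * ((∫ r in (0 : ℝ)..s, x.lam r) + (impulse x t - x.imp t))) (Iio t) t := by
    have h1 : ContinuousWithinAt (fun s => ∫ r in (0 : ℝ)..s, x.lam r) (Iio t) t :=
      (hx.lam_prim.continuousOn t ht).mono_of_mem_nhdsWithin
        (mem_of_superset (Ioo_mem_nhdsLT h0) fun s hs => ⟨hs.1.le, hs.2.le.trans ht.2⟩)
    exact continuousWithinAt_id.add (continuousWithinAt_const.mul (h1.add continuousWithinAt_const))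
  have hc' : c < t + a⁻¹ * ((∫ r in (0 : ℝ)..t, x.lam r) + (impulse x t - x.imp t)) := by
    unfold dilate at hc
    linarith
  have hev := hcont.eventually_const_lt hc'
  obtain ⟨s, hs, hs1, hs2⟩ := (hev.and ((eventually_mem_set.2 (Ioo_mem_nhdsLT h0)).and
    (eventually_jumpSum_left x.imp (fun _ => (1 : ℝ)) t))).exists
  refine ⟨s, ⟨hs1.1.le, hs1.2⟩, ?_⟩
  have h2 : impulse x s = impulse x t - x.imp t := by
    rw [impulse, hs2, smul_eq_mul, mul_one, impulse]
  rw [dilate, h2]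
  exact hs

theorem dilateClock_mem (htf : 0 ≤ tf) (τ : ℝ) : dilateClock a tf x τ ∈ Icc 0 tf :=
  lastTime_mem htf τ

theorem dilateClock_le_iff (hx : S.IsSolution u q0 v0 tf x) (ha : 0 < a) {t τ : ℝ}
    (ht : t ∈ Icc 0 tf) (hτ : τ ≤ dilate a x tf) :
    dilateClock a tf x τ ≤ t ↔ τ ≤ dilate a x t := by
  have hbdd : BddAbove {s | s ∈ Icc 0 tf ∧ dilate a x s ≤ τ} := ⟨tf, fun s hs => hs.1.2⟩
  constructor
  · intro h
    by_contra hn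
    rcases ht.2.lt_or_eq with hlt | heq
    · obtain ⟨s, hs, hs'⟩ := hx.dilate_right (a := a) ht.1 hlt (not_le.1 hn)
      have : s ≤ dilateClock a tf x τ :=
        le_csSup hbdd ⟨⟨ht.1.trans hs.1.le, hs.2⟩, hs'.le⟩
      exact hs.1.not_ge (this.trans h)
    · exact hn (heq ▸ hτ)
  · intro h
    refine Real.sSup_le (fun s hs => ?_) ht.1
    exact ((hx.dilate_strictMonoOn ha).le_iff_le hs.1 ht).1 (hs.2.trans h)

theorem dilateClock_dilate (hx : S.IsSolution u q0 v0 tf x) (ha : 0 < a) {t : ℝ}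
    (ht : t ∈ Icc 0 tf) : dilateClock a tf x (dilate a x t) = t := by
  refine le_antisymm ((hx.dilateClock_le_iff ha ht (hx.dilate_mem ha ht).2).2 le_rfl) ?_
  exact le_csSup ⟨tf, fun s hs => hs.1.2⟩ ⟨ht, le_rfl⟩

theorem le_dilate_dilateClock (hx : S.IsSolution u q0 v0 tf x) (ha : 0 < a) (htf : 0 ≤ tf) {τ : ℝ}
    (hτ : τ ≤ dilate a x tf) : τ ≤ dilate a x (dilateClock a tf x τ) :=
  (hx.dilateClock_le_iff ha (dilateClock_mem htf τ) hτ).1 le_rfl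

/-- The clock rests at `t` on the interval that `dilate` jumps over there; its length is the impulse
divided by `a`. -/
theorem dilateClock_eq_iff (hx : S.IsSolution u q0 v0 tf x) (ha : 0 < a) {t τ : ℝ}
    (ht : t ∈ Icc 0 tf) (hτ : τ ∈ Icc 0 (dilate a x tf)) :
    dilateClock a tf x τ = t ↔ τ ∈ Icc (dilate a x t - a⁻¹ * x.imp t) (dilate a x t) := by
  have hm := dilateClock_mem (a := a) (x := x) (ht.1.trans ht.2) τ
  rw [le_antisymm_iff, hx.dilateClock_le_iff ha ht hτ.2, mem_Icc, and_comm]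
  refine and_congr_left fun hle => ⟨fun h => ?_, fun h => ?_⟩
  · rcases ht.1.lt_or_eq with h0 | h0
    · by_contra hn
      obtain ⟨s, hs, hs'⟩ := hx.dilate_left ht h0 (not_le.1 hn)
      have := (hx.dilateClock_le_iff ha ⟨hs.1, hs.2.le.trans ht.2⟩ hτ.2).2 hs'.le
      exact hs.2.not_ge (h.trans this)
    · rw [← h0, hx.dilate_zero, sub_self]
      exact hτ.1
  · by_contra hn
    have h1 := hx.dilate_add_le ha hm ht (not_le.1 hn)
    have h2 := (hx.dilateClock_le_iff ha hm hτ.2).1 le_rfl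
    linarith [not_le.1 hn]

theorem mem_support_of_lt (hx : S.IsSolution u q0 v0 tf x) (ha : 0 < a) (htf : 0 ≤ tf) {τ : ℝ}
    (hτ : τ ∈ Icc 0 (dilate a x tf)) (hlt : τ < dilate a x (dilateClock a tf x τ)) :
    dilateClock a tf x τ ∈ x.imp.support := by
  have h1 := ((hx.dilateClock_eq_iff ha (dilateClock_mem htf τ) hτ).1 rfl).1
  rw [Finsupp.mem_support_iff]
  intro h0
  rw [h0, mul_zero, sub_zero] at h1
  exact hlt.not_ge h1

theorem monotone_dilateClock : Monotone (dilateClock a tf x) := monotone_lastTime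

/-- Both measures have the distribution function `dilate`. -/
theorem map_dilateClock (hx : S.IsSolution u q0 v0 tf x) (ha : 0 < a) (htf : 0 ≤ tf) :
    (volume.restrict (Icc 0 (dilate a x tf))).map (dilateClock a tf x) = dilateMeasure a tf x := by
  refine map_clock_eq htf (monotone_dilateClock.measurable.aemeasurable)
    (Eventually.of_forall fun τ => dilateClock_mem htf τ) ?_ fun t ht => ?_
  · rw [dilateMeasure, ae_add_measure_iff, ae_finsetSum_measure_iff]
    refine ⟨(withDensity_absolutelyContinuous _ _).ae_le (ae_restrict_mem measurableSet_Icc),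
      fun s hs => Measure.ae_smul_measure ?_ _⟩
    rw [ae_dirac_eq]
    exact (hx.mem_of_support hs).1
  · have h1 : volume.restrict (Icc 0 (dilate a x tf)) {τ | dilateClock a tf x τ ≤ t}
        = ENNReal.ofReal (dilate a x t) := by
      rw [Measure.restrict_apply
        (measurableSet_le monotone_dilateClock.measurable measurable_const)]
      have : {τ | dilateClock a tf x τ ≤ t} ∩ Icc 0 (dilate a x tf) = Icc 0 (dilate a x t) := by
        ext τ
        constructor
        · rintro ⟨h1, h2⟩
          exact ⟨h2.1, (hx.dilateClock_le_iff ha ht h2.2).1 h1⟩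
        · rintro ⟨h1, h2⟩
          have h3 := h2.trans (hx.dilate_mem ha ht).2
          exact ⟨(hx.dilateClock_le_iff ha ht h3).2 h2, h1, h3⟩
      rw [this, Real.volume_Icc, sub_zero]
    have h3 : Iic t ∩ Icc 0 tf = Icc 0 t := by
      ext s
      exact ⟨fun h => ⟨h.2.1, h.1⟩, fun h => ⟨h.2, h.1, h.2.trans ht.2⟩⟩
    have hone : IntegrableOn (fun _ => (1 : ℝ)) (Icc 0 t) := integrableOn_const (by simp)
    have hint : IntegrableOn (fun s => 1 + a⁻¹ * x.lam s) (Icc 0 t) :=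
      hone.add
        ((hx.lam_integrable.mono_set (Icc_subset_Icc_right ht.2)).const_mul _)
    have hnn : ∀ᵐ s ∂(volume.restrict (Icc 0 t)), 0 ≤ 1 + a⁻¹ * x.lam s := by
      filter_upwards [ae_mono (Measure.restrict_mono (Icc_subset_Icc_right ht.2) le_rfl)
        hx.ae_lam_nonneg] with s hs
      have := mul_nonneg (inv_pos.2 ha).le hs
      linarith
    have h4 : ∫ s in Icc 0 t, (1 + a⁻¹ * x.lam s) = t + a⁻¹ * ∫ s in (0 : ℝ)..t, x.lam s := by
      rw [integral_add hone ((hx.lam_integrable.mono_set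
        (Icc_subset_Icc_right ht.2)).const_mul _), integral_const_mul,
        intervalIntegral.integral_of_le ht.1, integral_Icc_eq_integral_Ioc (f := x.lam)]
      simp [ht.1]
    have h5 : (∑ s ∈ x.imp.support, ENNReal.ofReal (a⁻¹ * x.imp s) • Measure.dirac s) (Iic t)
        = ENNReal.ofReal (a⁻¹ * impulse x t) := by
      rw [Measure.finsetSum_apply, impulse, jumpSum, Finset.mul_sum,
        ENNReal.ofReal_sum_of_nonneg, Finset.sum_filter]
      · refine Finset.sum_congr rfl fun s _ => ?_
        by_cases hs : s ≤ t <;> simp [hs]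
      · intro s _
        have := mul_nonneg (inv_pos.2 ha).le (hx.imp_nonneg s)
        simpa using this
    rw [h1, dilateMeasure, Measure.add_apply, withDensity_apply _ measurableSet_Iic,
      Measure.restrict_restrict measurableSet_Iic, h3,
      ← ofReal_integral_eq_lintegral_ofReal hint hnn, h4, h5, ← ENNReal.ofReal_add, dilate]
    · ring_nf
    · rw [← h4]
      exact integral_nonneg_of_ae hnn
    · refine mul_nonneg (inv_pos.2 ha).le (Finset.sum_nonneg fun s _ => ?_)
      simpa using hx.imp_nonneg s

end IsSolution

end CLS

/-! ### The frozen trajectory solves the time-freezing system and is related -/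

namespace CLS

variable {n m : ℕ} {S : CLS n m}

namespace IsSolution

variable {u : ℝ → Vec m} {q0 v0 : Vec n} {tf : ℝ} {x : CLSTraj n} {a : ℝ}

theorem ae_notMem_support (x : CLSTraj n) (s : Set ℝ) :
    ∀ᵐ t ∂(volume.restrict s), t ∉ x.imp.support :=
  ae_restrict_of_ae (measure_eq_zero_iff_ae_notMem.1 (x.imp.support.finite_toSet.measure_zero _))

theorem freezeField_of_mem {t : ℝ} (ht : t ∈ x.imp.support) :
    S.freezeField a u x t = (0, a • S.invMn (x.q t), 0) := by
  simp [freezeField, clockRate, Finsupp.mem_support_iff.1 ht]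

/-- The density `1 + λ / a` is the reciprocal of the clock rate `a / (a + λ)`; it turns the weight
`(1 - θ) a` into `λ`. -/
theorem density_smul_freezeField (ha : 0 < a) {t : ℝ} (hl : 0 ≤ x.lam t)
    (ht : t ∉ x.imp.support) :
    (ENNReal.ofReal (1 + a⁻¹ * x.lam t)).toReal • S.freezeField a u x t
      = (x.v t, S.accel u x t, 1) := by
  have h1 : 0 ≤ a⁻¹ * x.lam t := mul_nonneg (inv_pos.2 ha).le hl
  have hne : a + x.lam t ≠ 0 := by positivity
  have hk : (1 + a⁻¹ * x.lam t) * (a / (a + x.lam t)) = 1 := by field_simp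
  have hk2 : (1 + a⁻¹ * x.lam t) * ((1 - a / (a + x.lam t)) * a) = x.lam t := by
    field_simp
    ring
  rw [ENNReal.toReal_ofReal (by linarith)]
  simp only [freezeField, clockRate, if_neg ht, Prod.smul_mk, smul_add, smul_smul, hk, hk2,
    one_smul, smul_eq_mul, accel]

theorem integrable_state (hx : S.IsSolution u q0 v0 tf x) :
    IntegrableOn (fun t => ((x.v t, S.accel u x t, 1) : TFState n)) (Icc 0 tf) :=
  hx.v_integrable.prodMk (hx.accel_integrable.prodMk (integrableOn_const (by simp)))

theorem aemeasurable_density (hx : S.IsSolution u q0 v0 tf x) (a : ℝ) :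
    AEMeasurable (fun t => ENNReal.ofReal (1 + a⁻¹ * x.lam t)) (volume.restrict (Icc 0 tf)) :=
  ((hx.lam_integrable.1.aemeasurable.const_mul _).const_add _).ennreal_ofReal

theorem integrable_withDensity_freezeField (hx : S.IsSolution u q0 v0 tf x) (ha : 0 < a) :
    Integrable (S.freezeField a u x)
      ((volume.restrict (Icc 0 tf)).withDensity (fun t => ENNReal.ofReal (1 + a⁻¹ * x.lam t))) := by
  rw [integrable_withDensity_iff_integrable_smul₀' (hx.aemeasurable_density a)
    (Eventually.of_forall fun t => ENNReal.ofReal_lt_top)]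
  refine Integrable.congr hx.integrable_state ?_
  filter_upwards [ae_notMem_support x (Icc 0 tf), hx.ae_lam_nonneg] with t h1 h2
  exact (density_smul_freezeField ha h2 h1).symm

theorem integrable_dirac_freezeField :
    ∀ s ∈ x.imp.support, Integrable (S.freezeField a u x)
      (ENNReal.ofReal (a⁻¹ * x.imp s) • Measure.dirac s) :=
  fun _ _ => (integrable_dirac (by simp)).smul_measure ENNReal.ofReal_ne_top

theorem integrable_freezeField (hx : S.IsSolution u q0 v0 tf x) (ha : 0 < a) :
    Integrable (S.freezeField a u x) (dilateMeasure a tf x) := by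
  rw [dilateMeasure, integrable_add_measure, integrable_finsetSum_measure]
  exact ⟨hx.integrable_withDensity_freezeField ha, integrable_dirac_freezeField⟩

theorem integrable_freezeField_comp (hx : S.IsSolution u q0 v0 tf x) (ha : 0 < a) (htf : 0 ≤ tf) :
    IntegrableOn (fun τ => S.freezeField a u x (dilateClock a tf x τ))
      (Icc 0 (dilate a x tf)) := by
  have h := hx.integrable_freezeField ha
  rw [← hx.map_dilateClock ha htf] at h
  exact h.comp_measurable monotone_dilateClock.measurable

/-- After passing to the image measure, the density produces the integrals of `v` and of the
acceleration, and an atom of mass `a⁻¹ p` produces the velocity jump `p M⁻¹ n`. -/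
theorem integral_freezeField_comp (hx : S.IsSolution u q0 v0 tf x) (ha : 0 < a) {t : ℝ}
    (ht : t ∈ Icc 0 tf) :
    ∫ τ in (0 : ℝ)..dilate a x t, S.freezeField a u x (dilateClock a tf x τ)
      = (x.q t - q0, x.v t - v0, t) := by
  have htf := ht.1.trans ht.2
  have hm := hx.dilate_mem ha ht
  have h1 : ∫ τ in (0 : ℝ)..dilate a x t, S.freezeField a u x (dilateClock a tf x τ)
      = ∫ s, (Iic t).indicator (S.freezeField a u x) s ∂(dilateMeasure a tf x) := by
    rw [← hx.map_dilateClock ha htf, integral_map monotone_dilateClock.measurable.aemeasurable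
      (by
        rw [hx.map_dilateClock ha htf]
        exact (hx.integrable_freezeField ha).1.indicator measurableSet_Iic),
      intervalIntegral.integral_of_le hm.1, ← integral_Icc_eq_integral_Ioc,
      ← integral_indicator measurableSet_Icc, ← integral_indicator measurableSet_Icc]
    congr 1
    funext τ
    by_cases hτ : τ ∈ Icc 0 (dilate a x t)
    · have hτ' : τ ≤ dilate a x tf := hτ.2.trans hm.2
      rw [indicator_of_mem hτ, indicator_of_mem (show τ ∈ Icc 0 (dilate a x tf) from ⟨hτ.1, hτ'⟩),
        indicator_of_mem (show dilateClock a tf x τ ∈ Iic t from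
          (hx.dilateClock_le_iff ha ht hτ').2 hτ.2)]
    · rw [indicator_of_notMem hτ]
      by_cases hτ' : τ ∈ Icc 0 (dilate a x tf)
      · rw [indicator_of_mem hτ', indicator_of_notMem]
        exact fun h => hτ ⟨hτ'.1, (hx.dilateClock_le_iff ha ht hτ'.2).1 h⟩
      · rw [indicator_of_notMem hτ']
  have h2 : ∫ s, (Iic t).indicator (S.freezeField a u x) s ∂((volume.restrict (Icc 0 tf)).withDensity
      (fun t => ENNReal.ofReal (1 + a⁻¹ * x.lam t)))
      = (∫ s in (0 : ℝ)..t, x.v s, ∫ s in (0 : ℝ)..t, S.accel u x s, t) := by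
    rw [integral_withDensity_eq_integral_toReal_smul₀ (hx.aemeasurable_density a) (by simp)]
    have h3 : ∀ᵐ s ∂(volume.restrict (Icc 0 tf)), (ENNReal.ofReal (1 + a⁻¹ * x.lam s)).toReal •
        (Iic t).indicator (S.freezeField a u x) s
        = (Iic t).indicator (fun s => ((x.v s, S.accel u x s, 1) : TFState n)) s := by
      filter_upwards [ae_notMem_support x (Icc 0 tf), hx.ae_lam_nonneg] with s h4 h5
      by_cases hs : s ∈ Iic t
      · rw [indicator_of_mem hs, indicator_of_mem hs, density_smul_freezeField ha h5 h4]
      · rw [indicator_of_notMem hs, indicator_of_notMem hs, smul_zero]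
    have h6 : Icc 0 tf ∩ Iic t = Icc 0 t := by
      ext s
      exact ⟨fun h => ⟨h.1.1, h.2⟩, fun h => ⟨⟨h.1, h.2.trans ht.2⟩, h.2⟩⟩
    rw [integral_congr_ae h3, setIntegral_indicator measurableSet_Iic, h6,
      integral_Icc_eq_integral_Ioc, ← intervalIntegral.integral_of_le ht.1]
    have hone : IsPrimitiveOn (fun t : ℝ => t) (fun _ => (1 : ℝ)) 0 tf :=
      ⟨integrableOn_const (by simp), fun s _ => by simp⟩
    have hp := (IsPrimitiveOn.of_integrableOn hx.v_integrable).prodMk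
      ((IsPrimitiveOn.of_integrableOn hx.accel_integrable).prodMk hone)
    have := hp.2 t ht
    simp only [intervalIntegral.integral_same] at this
    rw [this]
    exact (zero_add (_ : TFState n)).symm
  have h3 : ∫ s, (Iic t).indicator (S.freezeField a u x) s
      ∂(∑ s ∈ x.imp.support, ENNReal.ofReal (a⁻¹ * x.imp s) • Measure.dirac s)
      = (0, S.jumps x t, 0) := by
    rw [integral_finsetSum_measure fun s hs => (integrable_dirac_freezeField s hs).indicator
      measurableSet_Iic]
    have h4 : ∀ s ∈ x.imp.support, ∫ r, (Iic t).indicator (S.freezeField a u x) r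
        ∂(ENNReal.ofReal (a⁻¹ * x.imp s) • Measure.dirac s)
        = (ContinuousLinearMap.inr ℝ (Vec n) (Vec n × ℝ) ∘L ContinuousLinearMap.inl ℝ (Vec n) ℝ)
          (if s ≤ t then x.imp s • S.invMn (x.q s) else 0) := by
      intro s hs
      rw [integral_smul_measure, integral_dirac,
        ENNReal.toReal_ofReal (mul_nonneg (inv_pos.2 ha).le (hx.imp_nonneg s))]
      by_cases hst : s ≤ t
      · rw [indicator_of_mem (show s ∈ Iic t from hst), freezeField_of_mem hs, if_pos hst]
        simp only [Prod.smul_mk, smul_zero, smul_smul, ContinuousLinearMap.comp_apply,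
          ContinuousLinearMap.inl_apply, ContinuousLinearMap.inr_apply]
        rw [mul_comm, ← mul_assoc, mul_inv_cancel₀ ha.ne', one_mul]
      · rw [indicator_of_notMem (show s ∉ Iic t from hst), if_neg hst, map_zero, smul_zero]
    rw [Finset.sum_congr rfl h4, ← map_sum, ← Finset.sum_filter]
    rfl
  rw [h1, dilateMeasure, integral_add_measure
    ((hx.integrable_withDensity_freezeField ha).indicator measurableSet_Iic)
    (integrable_finsetSum_measure.2 fun s hs => (integrable_dirac_freezeField s hs).indicator
      measurableSet_Iic), h2, h3, hx.q_eq t ht, hx.v_eq' ht]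
  simp only [Prod.mk_add_mk, add_zero, add_sub_cancel_left]
  congr 2
  abel

/-- At the end of each pause the integral is known. An earlier time with the same clock value lies
within the pause, where the field is constant, so the difference is linear. -/
theorem freeze_eq (hx : S.IsSolution u q0 v0 tf x) (ha : 0 < a) (htf : 0 ≤ tf) {τ : ℝ}
    (hτ : τ ∈ Icc 0 (dilate a x tf)) : S.freeze a tf x τ = (q0, v0, 0)
      + ∫ r in (0 : ℝ)..τ, S.freezeField a u x (dilateClock a tf x r) := by
  set t := dilateClock a tf x τ with ht
  have htI : t ∈ Icc 0 tf := dilateClock_mem htf τ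
  have hm := hx.dilate_mem ha htI
  have hle : τ ≤ dilate a x t := hx.le_dilate_dilateClock ha htf hτ.2
  have hp := IsPrimitiveOn.of_integrableOn (hx.integrable_freezeField_comp ha htf)
  have h1 := hp.sub_eq hτ hm
  simp only at h1
  rw [hx.integral_freezeField_comp ha htI] at h1
  have h2 : ∫ r in τ..dilate a x t, S.freezeField a u x (dilateClock a tf x r)
      = (0, (a * (dilate a x t - τ)) • S.invMn (x.q t), 0) := by
    have h3 : ∫ r in τ..dilate a x t, S.freezeField a u x (dilateClock a tf x r)
        = ∫ _r in τ..dilate a x t, S.freezeField a u x t := by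
      refine intervalIntegral.integral_congr fun r hr => ?_
      rw [uIcc_of_le hle] at hr
      have : dilateClock a tf x r = t :=
        le_antisymm ((hx.dilateClock_le_iff ha htI (hr.2.trans hm.2)).2 hr.2)
          (monotone_dilateClock hr.1)
      simp only [this]
    rw [h3, intervalIntegral.integral_const]
    rcases hle.lt_or_eq with hlt | heq
    · rw [freezeField_of_mem (hx.mem_support_of_lt ha htf hτ hlt), ← ht]
      simp [smul_smul, mul_comm]
    · rw [← heq]
      simp only [sub_self, zero_smul, mul_zero]
      rfl
  rw [h2] at h1
  rw [← sub_sub_self (x.q t - q0, x.v t - v0, t)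
    (∫ r in (0 : ℝ)..τ, S.freezeField a u x (dilateClock a tf x r)), h1, freeze, ← ht]
  simp only [Prod.mk_sub_mk, Prod.mk_add_mk, sub_zero]
  refine Prod.ext ?_ (Prod.ext ?_ ?_)
  · simp
  · simp only
    abel
  · simp

theorem c2_freeze (τ : ℝ) : S.c2 (S.freeze a tf x τ) =
    S.normalVel (x.q (dilateClock a tf x τ), x.v (dilateClock a tf x τ))
      - a * (dilate a x (dilateClock a tf x τ) - τ) * S.D (x.q (dilateClock a tf x τ)) := by
  simp only [freeze, c2, normalVel, inner_sub_right, real_inner_smul_right, D]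

theorem freeze_of_eq {τ : ℝ} (h : τ = dilate a x (dilateClock a tf x τ)) :
    S.freeze a tf x τ
      = (x.q (dilateClock a tf x τ), x.v (dilateClock a tf x τ), dilateClock a tf x τ) := by
  rw [freeze, ← h, sub_self, mul_zero, zero_smul, sub_zero]

/-- The normal velocity of `freeze` is that of `x` minus `a D` times the rest of the pause: at the
end it is nonnegative on contact, before the end it is zero minus a positive number. -/
theorem freeze_impacting_iff (hx : S.IsSolution u q0 v0 tf x) (ha : 0 < a) (htf : 0 ≤ tf) {τ : ℝ}
    (hτ : τ ∈ Icc 0 (dilate a x tf)) :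
    S.freeze a tf x τ ∈ S.Impacting ↔ τ < dilate a x (dilateClock a tf x τ) := by
  have htI : dilateClock a tf x τ ∈ Icc 0 tf := dilateClock_mem htf τ
  have hle := hx.le_dilate_dilateClock ha htf hτ.2
  constructor
  · intro hi
    refine lt_of_le_of_ne hle fun he => ?_
    have h1 := hi.2
    rw [c2_freeze, ← he, sub_self, mul_zero, zero_mul, sub_zero] at h1
    exact h1.not_ge (hx.normalVel_nonneg htI hi.1)
  · intro hlt
    have hs := hx.mem_support_of_lt ha htf hτ hlt
    have hi := hx.imp_only _ (Finsupp.mem_support_iff.1 hs)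
    have hD := S.D_pos hi.2.1
    refine ⟨hi.2.1, ?_⟩
    rw [c2_freeze, show S.normalVel (x.q (dilateClock a tf x τ), x.v (dilateClock a tf x τ)) = 0 from
      hx.impact_law _ hi, zero_sub]
    exact neg_neg_of_pos (mul_pos (mul_pos ha (sub_pos.2 hlt)) hD)

theorem freeze_isTFSolution (hx : S.IsSolution u q0 v0 tf x) (ha : 0 < a) (htf : 0 ≤ tf)
    {w : ℝ → Vec m} (hw : S.ControlsAgree u w (dilate a x tf) (S.freeze a tf x)) :
    S.IsTFSolution a w (q0, v0, 0) (dilate a x tf) (S.freeze a tf x) := by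
  refine ⟨_, hx.integrable_freezeField_comp ha htf, fun τ hτ => hx.freeze_eq ha htf hτ, ?_⟩
  have hae : ∀ᵐ t ∂(dilateMeasure a tf x), t ∈ x.imp.support ∨ (0 ≤ x.lam t ∧
      (S.fc (x.q t) = 0 → S.normalVel (x.q t, x.v t) = 0) ∧ (S.fc (x.q t) ≠ 0 → x.lam t = 0)) := by
    rw [dilateMeasure, ae_add_measure_iff, ae_finsetSum_measure_iff]
    refine ⟨(withDensity_absolutelyContinuous _ _).ae_le ?_,
      fun s hs => Measure.ae_smul_measure ?_ _⟩
    · filter_upwards [hx.ae_lam_nonneg, hx.ae_contact] with t h1 h2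
      exact Or.inr ⟨h1, fun h => (h2.1 h).1, h2.2⟩
    · rw [ae_dirac_eq]
      exact Or.inl hs
  rw [← hx.map_dilateClock ha htf] at hae
  -- The right ends of the pauses are discarded: there the clock shows an impulse time although the
  -- impact is over.
  have hfin : ∀ᵐ τ ∂(volume.restrict (Icc 0 (dilate a x tf))),
      τ ∉ dilate a x '' (x.imp.support : Set ℝ) :=
    ae_restrict_of_ae (measure_eq_zero_iff_ae_notMem.1
      ((x.imp.support.finite_toSet.image _).measure_zero _))
  filter_upwards [ae_of_ae_map monotone_dilateClock.measurable.aemeasurable hae, hfin,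
    ae_restrict_mem measurableSet_Icc] with τ h1 h2 hτ
  have htI : dilateClock a tf x τ ∈ Icc 0 tf := dilateClock_mem htf τ
  have hle := hx.le_dilate_dilateClock ha htf hτ.2
  by_cases hs : dilateClock a tf x τ ∈ x.imp.support
  · have hlt : τ < dilate a x (dilateClock a tf x τ) :=
      lt_of_le_of_ne hle fun he => h2 ⟨_, hs, he.symm⟩
    have hi := (hx.freeze_impacting_iff ha htf hτ).2 hlt
    refine ⟨0, 1, le_rfl, zero_le_one, by norm_num, fun _ => rfl,
      fun h => absurd (S.mem_closure_R2 hi.1 hi.2.le) h, ?_⟩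
    rw [freezeField_of_mem hs]
    simp [faux, freeze]
  · obtain ⟨hl, hc0, hc1⟩ := h1.resolve_left hs
    have heq : τ = dilate a x (dilateClock a tf x τ) := by
      refine le_antisymm hle (not_lt.1 fun hlt => hs (hx.mem_support_of_lt ha htf hτ hlt))
    have hfr := freeze_of_eq (S := S) heq
    have hni : S.freeze a tf x τ ∉ S.Impacting := fun hi =>
      ((hx.freeze_impacting_iff ha htf hτ).1 hi).ne heq
    have hwu : w τ = u (dilateClock a tf x τ) := hw τ hτ hni
    have hpos : 0 < a + x.lam (dilateClock a tf x τ) := by positivity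
    refine ⟨clockRate a x (dilateClock a tf x τ), 1 - clockRate a x (dilateClock a tf x τ), ?_, ?_,
      by ring, fun h => absurd (S.mem_closure_R1 (y := S.freeze a tf x τ)
        (hx.fc_nonneg _ htI)) h, fun h => ?_, ?_⟩
    · rw [clockRate, if_neg hs]
      positivity
    · rw [clockRate, if_neg hs, sub_nonneg, div_le_one hpos]
      linarith
    -- Almost everywhere contact forces `c2 = 0` and thus membership in the closure of `R2`. Outside
    -- this closure there is no contact, so `λ = 0` and the clock runs at full rate.
    · have hfc : S.fc (x.q (dilateClock a tf x τ)) ≠ 0 := by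
        intro h0
        refine h (S.mem_closure_R2 h0 ?_)
        rw [hfr]
        exact (hc0 h0).le
      rw [clockRate, if_neg hs, hc1 hfc, add_zero, div_self ha.ne', sub_self]
    · rw [hfr, freezeField, hwu]
      simp [f1, faux, smul_smul]

theorem clock_freeze_last (hx : S.IsSolution u q0 v0 tf x) (ha : 0 < a) (htf : 0 ≤ tf) :
    (S.freeze a tf x (dilate a x tf)).2.2 = tf :=
  hx.dilateClock_dilate ha ⟨htf, le_rfl⟩

theorem freeze_last_not_impacting (hx : S.IsSolution u q0 v0 tf x) (ha : 0 < a) (htf : 0 ≤ tf) :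
    S.freeze a tf x (dilate a x tf) ∉ S.Impacting := by
  have hm := hx.dilate_mem ha ⟨htf, le_rfl⟩
  rw [hx.freeze_impacting_iff ha htf hm, hx.dilateClock_dilate ha ⟨htf, le_rfl⟩]
  exact lt_irrefl _

theorem freeze_atMostOneImpact (hx : S.IsSolution u q0 v0 tf x) (ha : 0 < a) (htf : 0 ≤ tf)
    (h1 : S.AtMostOneImpact tf x) : S.AtMostOneImpactTF (dilate a x tf) (S.freeze a tf x) := by
  have key : ∀ τ ∈ Icc 0 (dilate a x tf), S.freeze a tf x τ ∈ S.Impacting →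
      S.IsImpactTime tf x (dilateClock a tf x τ) := fun τ hτ hi =>
    hx.imp_only _ (Finsupp.mem_support_iff.1
      (hx.mem_support_of_lt ha htf hτ ((hx.freeze_impacting_iff ha htf hτ).1 hi)))
  exact fun τ hτ σ hσ hi hi' => h1 _ _ (key τ hτ hi) (key σ hσ hi')

theorem freeze_related (hx : S.IsSolution u q0 v0 tf x) (ha : 0 < a) (htf : 0 ≤ tf) :
    S.Related a u (dilate a x tf) (S.freeze a tf x) x := by
  have hlast := hx.clock_freeze_last ha htf
  have heq : ∀ τ ∈ Icc 0 (dilate a x tf), dilateClock a tf x τ ∉ x.imp.support →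
      τ = dilate a x (dilateClock a tf x τ) := fun τ hτ hs =>
    le_antisymm (hx.le_dilate_dilateClock ha htf hτ.2)
      (not_lt.1 fun hlt => hs (hx.mem_support_of_lt ha htf hτ hlt))
  refine ⟨fun τ hτ hn => ?_, ?_, fun ts hts => ?_⟩
  · rw [hlast, hx.isImpactTime_iff, ← Finsupp.mem_support_iff] at hn
    rw [freeze_of_eq (heq τ hτ hn)]
  · rw [hlast]
    filter_upwards [ae_notMem_support x (Icc 0 tf), hx.ae_contact] with t h1 h2 τ hτ hτt
    have hτt' : dilateClock a tf x τ = t := hτt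
    have h3 := freeze_of_eq (S := S) (heq τ hτ (hτt' ▸ h1))
    rw [hτt'] at h3
    rw [h3]
    split_ifs with hS
    · exact (h2.1 hS.1).2
    · exact h2.2 fun h0 => hS ⟨h0, (h2.1 h0).1⟩
  · rw [hlast] at hts ⊢
    have himp : 0 < x.imp ts :=
      lt_of_le_of_ne (hx.imp_nonneg ts) (Ne.symm (hx.isImpactTime_iff.1 hts))
    have hpos : 0 < a⁻¹ * x.imp ts := mul_pos (inv_pos.2 ha) himp
    have hm := hx.dilate_mem ha hts.1
    have h0 : 0 ≤ dilate a x ts - a⁻¹ * x.imp ts := by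
      rcases hts.1.1.lt_or_eq with h0 | h0
      · have h1 := hx.dilate_add_le ha ⟨le_rfl, htf⟩ hts.1 h0
        have h2 := (hx.dilate_mem ha ⟨le_rfl, htf⟩).1
        linarith
      · rw [← h0, hx.dilate_zero, sub_self]
    have hiff : ∀ τ ∈ Icc 0 (dilate a x tf), (S.freeze a tf x τ).2.2 = ts ↔
        τ ∈ Icc (dilate a x ts - a⁻¹ * x.imp ts) (dilate a x ts) :=
      fun τ hτ => hx.dilateClock_eq_iff ha hts.1 hτ
    refine ⟨_, _, h0, by linarith, hm.2, hiff, fun τ hτ => ?_, ?_, ?_⟩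
    · have hτI : τ ∈ Icc 0 (dilate a x tf) := ⟨h0.trans hτ.1, hτ.2.le.trans hm.2⟩
      rw [hx.freeze_impacting_iff ha htf hτI]
      have h1 : dilateClock a tf x τ = ts := (hiff τ hτI).2 ⟨hτ.1, hτ.2.le⟩
      rw [h1]
      exact hτ.2
    · have h1 := hx.dilateClock_dilate ha hts.1
      rw [freeze_of_eq (by rw [h1]), h1]
      exact ⟨hts.2.1, hx.impact_law ts hts⟩
    · rw [intervalIntegral.integral_const, smul_eq_mul, sub_sub_cancel, mul_comm, ← mul_assoc,
        mul_inv_cancel₀ ha.ne', one_mul]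
      exact tendsto_contactForce hx.lam_integrable hx.imp_nonneg ts

end IsSolution

end CLS

/-- Comparison of two indefinite integrals. -/
theorem IsPrimitiveOn.norm_sub_le {E : Type*} [NormedAddCommGroup E] [NormedSpace ℝ E]
    {F G f g : ℝ → E} {k : ℝ → ℝ} {a b : ℝ} (hF : IsPrimitiveOn F f a b)
    (hG : IsPrimitiveOn G g a b) (h0 : F a = G a) (hk : IntegrableOn k (Icc a b))
    (h : ∀ᵐ s ∂(volume.restrict (Icc a b)), ‖g s - f s‖ ≤ k s) {t : ℝ} (ht : t ∈ Icc a b) :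
    ‖G t - F t‖ ≤ ∫ s in a..t, k s := by
  have ha : a ∈ Icc a b := ⟨le_rfl, ht.1.trans ht.2⟩
  have h1 : G t - F t = ∫ s in a..t, (g s - f s) := by
    rw [intervalIntegral.integral_sub (hG.intervalIntegrable ha ht) (hF.intervalIntegrable ha ht),
      hG.2 t ht, hF.2 t ht, h0]
    abel
  rw [h1]
  refine intervalIntegral.norm_integral_le_of_norm_le ht.1 ?_
    ((IsPrimitiveOn.of_integrableOn hk).intervalIntegrable ha ht)
  rw [ae_restrict_iff' measurableSet_Icc] at h
  filter_upwards [h] with s hs hst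
  exact hs ⟨hst.1.le, hst.2.trans ht.2⟩

namespace CLS

variable {n m : ℕ} {S : CLS n m}

/-! ### Uniqueness of solutions in physical time -/

/-- A piece of a trajectory without impulses. -/
structure IsArc (S : CLS n m) (u : ℝ → Vec m) (x : CLSTraj n) (c d : ℝ) : Prop where
  prim_q : IsPrimitiveOn x.q x.v c d
  prim_v : IsPrimitiveOn x.v (S.accel u x) c d
  lam_int : IntegrableOn x.lam (Icc c d)
  fc_nonneg : ∀ t ∈ Icc c d, 0 ≤ S.fc (x.q t)
  lam_nonneg : ∀ᵐ t ∂(volume.restrict (Icc c d)), 0 ≤ x.lam t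
  contact : ∀ᵐ t ∂(volume.restrict (Icc c d)),
      (S.fc (x.q t) = 0 → S.normalVel (x.q t, x.v t) = 0 ∧
        x.lam t = -((S.D (x.q t))⁻¹ * S.phi (x.q t) (x.v t) (u t))) ∧
      (S.fc (x.q t) ≠ 0 → x.lam t = 0)

theorem IsSolution.isArc {u : ℝ → Vec m} {q0 v0 : Vec n} {tf : ℝ} {x : CLSTraj n}
    (hx : S.IsSolution u q0 v0 tf x) {c d : ℝ} (hc : 0 ≤ c) (hd : d ≤ tf)
    (h : ∀ s ∈ x.imp.support, s ∉ Ioc c d) : S.IsArc u x c d :=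
  have hsub : Icc c d ⊆ Icc 0 tf := Icc_subset_Icc hc hd
  have hle := ae_mono (Measure.restrict_mono hsub (le_refl volume))
  { prim_q := hx.q_prim.mono hc hd
    prim_v := hx.v_prim hc hd h
    lam_int := hx.lam_integrable.mono_set hsub
    fc_nonneg := fun t ht => hx.fc_nonneg t (hsub ht)
    lam_nonneg := hle hx.ae_lam_nonneg
    contact := hle hx.ae_contact }

/-- The distance of two trajectories. -/
def gap (x x' : CLSTraj n) (t : ℝ) : ℝ := ‖x'.q t - x.q t‖ + ‖x'.v t - x.v t‖

theorem exists_lipschitz {E : Type*} [NormedAddCommGroup E] [NormedSpace ℝ E]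
    {Φ : Vec n × Vec n × Vec m → E} (hΦ : ContDiff ℝ 1 Φ) (R : ℝ) :
    ∃ L, 0 ≤ L ∧ ∀ q v q' v' u, ‖q‖ ≤ R → ‖v‖ ≤ R → ‖q'‖ ≤ R → ‖v'‖ ≤ R → ‖u‖ ≤ R →
      ‖Φ (q', v', u) - Φ (q, v, u)‖ ≤ L * (‖q' - q‖ + ‖v' - v‖) := by
  obtain ⟨K, hK⟩ := hΦ.contDiffOn.exists_lipschitzOnWith (s := Metric.closedBall 0 R) (by simp)
    (convex_closedBall _ _) (isCompact_closedBall _ _)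
  refine ⟨K, K.2, fun q v q' v' u h1 h2 h3 h4 h5 => ?_⟩
  have hmem : ∀ q v : Vec n, ‖q‖ ≤ R → ‖v‖ ≤ R →
      ((q, v, u) : Vec n × Vec n × Vec m) ∈ Metric.closedBall 0 R := by
    intro q v hq hv
    rw [mem_closedBall_zero_iff, Prod.norm_def, Prod.norm_def]
    exact max_le hq (max_le hv h5)
  have h6 := hK.dist_le_mul _ (hmem q' v' h3 h4) _ (hmem q v h1 h2)
  rw [dist_eq_norm, dist_eq_norm] at h6
  refine h6.trans ?_
  gcongr
  simp only [Prod.mk_sub_mk, sub_self, Prod.norm_def, norm_zero]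
  refine max_le ?_ (max_le ?_ ?_)
  · linarith [norm_nonneg (v' - v)]
  · linarith [norm_nonneg (q' - q)]
  · positivity

/-- The part of the momentum on which the contact force has no influence. -/
def tangential (S : CLS n m) (p : Vec n × Vec n) : Vec n :=
  S.D p.1 • p.2 - S.normalVel p • S.invMn p.1

theorem contDiff_tangential (h : ContDiff ℝ 2 S.c2) : ContDiff ℝ 2 S.tangential := by
  have hn := contDiff_normal_of_c2 h
  exact (((S.contDiff_D_of le_rfl hn).comp contDiff_fst).smul contDiff_snd).sub
    ((contDiff_normalVel_of_c2 h).smul ((S.contDiff_invMn_of le_rfl hn).comp contDiff_fst))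

/-- In the velocity argument, `v ↦ D v - (nᵀ v) M⁻¹ n` is linear and kills `M⁻¹ n` by the definition
of `D`. -/
theorem fderiv_tangential_force (h : ContDiff ℝ 2 S.c2) (q v : Vec n) (f : Vec n) (l : ℝ) :
    fderiv ℝ S.tangential (q, v) (v, f + l • S.invMn q) = fderiv ℝ S.tangential (q, v) (v, f) := by
  have h0 : ((v, f + l • S.invMn q) : Vec n × Vec n) = (v, f) + l • (0, S.invMn q) := by simp
  have h1 : HasFDerivAt (fun v' : Vec n => S.tangential (q, v'))
      ((fderiv ℝ S.tangential (q, v)).comp (ContinuousLinearMap.inr ℝ (Vec n) (Vec n))) v :=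
    HasFDerivAt.comp (g := S.tangential) (f := fun e => (q, e)) v
      ((contDiff_tangential h).differentiable (by norm_num) (q, v)).hasFDerivAt
      (hasFDerivAt_prodMk_right q v)
  have h2 : HasFDerivAt (fun v' : Vec n => S.tangential (q, v'))
      (S.D q • ContinuousLinearMap.id ℝ (Vec n) -
        (innerSL ℝ (S.normal q)).smulRight (S.invMn q)) v := by
    refine HasFDerivAt.sub ((hasFDerivAt_id v).const_smul (S.D q)) ?_
    exact (innerSL ℝ (S.normal q)).hasFDerivAt.smul_const (S.invMn q)
  have h3 : fderiv ℝ S.tangential (q, v) (0, S.invMn q) = 0 := by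
    have := DFunLike.congr_fun (h1.unique h2) (S.invMn q)
    simpa [D] using this
  rw [h0, map_add, map_smul, h3, smul_zero, add_zero]

namespace IsArc

variable {u : ℝ → Vec m} {x x' : CLSTraj n} {c d : ℝ}

theorem mono (h : S.IsArc u x c d) {d' : ℝ} (hd : d' ≤ d) : S.IsArc u x c d' :=
  have hsub : Icc c d' ⊆ Icc c d := Icc_subset_Icc_right hd
  have hle := ae_mono (Measure.restrict_mono hsub (le_refl volume))
  ⟨h.prim_q.mono le_rfl hd, h.prim_v.mono le_rfl hd, h.lam_int.mono_set hsub,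
    fun t ht => h.fc_nonneg t (hsub ht), hle h.lam_nonneg, hle h.contact⟩

theorem prim_fc (h : S.IsArc u x c d) :
    IsPrimitiveOn (fun t => S.fc (x.q t)) (fun t => S.normalVel (x.q t, x.v t)) c d := by
  have := h.prim_q.comp (Ψ := S.fc) (S.fc_smooth.of_le (by norm_num))
  simp only [fderiv_fc] at this
  exact this

theorem prim_normalVel (h : S.IsArc u x c d) :
    IsPrimitiveOn (fun t => S.normalVel (x.q t, x.v t))
      (fun t => S.phi (x.q t) (x.v t) (u t) + x.lam t * S.D (x.q t)) c d := by
  have := (h.prim_q.prodMk h.prim_v).comp (Ψ := S.normalVel) S.contDiff_normalVel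
  simp only [accel, fderiv_normalVel_force] at this
  exact this

theorem prim_tangential (h : S.IsArc u x c d) (hc : ContDiff ℝ 2 S.c2) :
    IsPrimitiveOn (fun t => S.tangential (x.q t, x.v t))
      (fun t => fderiv ℝ S.tangential (x.q t, x.v t) (x.v t, S.fv (x.q t) (x.v t) (u t))) c d := by
  have := (h.prim_q.prodMk h.prim_v).comp (Ψ := S.tangential)
    ((contDiff_tangential hc).of_le (by norm_num))
  simp only [accel, fderiv_tangential_force hc] at this
  exact this

theorem exists_bound (h : S.IsArc u x c d) :
    ∃ R, ∀ t ∈ Icc c d, ‖x.q t‖ ≤ R ∧ ‖x.v t‖ ≤ R := by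
  obtain ⟨R, hR⟩ := isCompact_Icc.exists_bound_of_continuousOn h.prim_q.continuousOn
  obtain ⟨R', hR'⟩ := isCompact_Icc.exists_bound_of_continuousOn h.prim_v.continuousOn
  exact ⟨max R R', fun t ht => ⟨(hR t ht).trans (le_max_left _ _),
    (hR' t ht).trans (le_max_right _ _)⟩⟩

theorem exists_D_bound (h : S.IsArc u x c d) :
    ∃ δ > 0, ∀ t ∈ Icc c d, S.fc (x.q t) = 0 → δ ≤ S.D (x.q t) := by
  have hK : IsCompact (Icc c d ∩ (fun t => S.fc (x.q t)) ⁻¹' {0}) :=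
    isCompact_Icc.of_isClosed_subset (h.prim_fc.continuousOn.preimage_isClosed_of_isClosed
      isClosed_Icc isClosed_singleton) inter_subset_left
  rcases eq_empty_or_nonempty (Icc c d ∩ (fun t => S.fc (x.q t)) ⁻¹' {0}) with he | hne
  · refine ⟨1, one_pos, fun t ht h0 => ?_⟩
    have : t ∈ Icc c d ∩ (fun t => S.fc (x.q t)) ⁻¹' {0} := ⟨ht, h0⟩
    rw [he] at this
    exact absurd this (notMem_empty t)
  · obtain ⟨s, hs, hmin⟩ := hK.exists_isMinOn hne (f := fun t => S.D (x.q t))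
      (S.contDiff_D.continuous.comp_continuousOn (h.prim_q.continuousOn.mono inter_subset_left))
    exact ⟨_, S.D_pos hs.2, fun t ht h0 => hmin ⟨ht, h0⟩⟩

theorem gap_nonneg (x x' : CLSTraj n) (t : ℝ) : 0 ≤ gap x x' t :=
  add_nonneg (norm_nonneg _) (norm_nonneg _)

theorem continuousOn_gap (h : S.IsArc u x c d) (h' : S.IsArc u x' c d) :
    ContinuousOn (gap x x') (Icc c d) :=
  (h'.prim_q.continuousOn.sub h.prim_q.continuousOn).norm.add
    (h'.prim_v.continuousOn.sub h.prim_v.continuousOn).norm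

theorem prim_gap (h : S.IsArc u x c d) (h' : S.IsArc u x' c d) :
    IsPrimitiveOn (fun t => ∫ s in c..t, gap x x' s) (gap x x') c d :=
  IsPrimitiveOn.of_integrableOn (h.continuousOn_gap h').integrableOn_Icc

theorem monotoneOn_gap (h : S.IsArc u x c d) (h' : S.IsArc u x' c d) :
    MonotoneOn (fun t => ∫ s in c..t, gap x x' s) (Icc c d) :=
  (h.prim_gap h').monotoneOn (Eventually.of_forall fun t => gap_nonneg x x' t)

theorem integral_gap_nonneg (x x' : CLSTraj n) {t : ℝ} (ht : c ≤ t) :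
    0 ≤ ∫ s in c..t, gap x x' s :=
  intervalIntegral.integral_nonneg ht fun s _ => gap_nonneg x x' s

theorem norm_q_sub_le (h : S.IsArc u x c d) (h' : S.IsArc u x' c d) (hq : x.q c = x'.q c) {t : ℝ}
    (ht : t ∈ Icc c d) : ‖x'.q t - x.q t‖ ≤ ∫ s in c..t, gap x x' s :=
  h.prim_q.norm_sub_le h'.prim_q hq (h.prim_gap h').1
    (Eventually.of_forall fun s => by unfold gap; linarith [norm_nonneg (x'.q s - x.q s)]) ht

/-- Two trajectories agree if the integral of their distance vanishes. -/
theorem eq_of_integral_gap (h : S.IsArc u x c d) (h' : S.IsArc u x' c d) (hcd : c < d)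
    (h0 : ∫ s in c..d, gap x x' s = 0) : ∀ t ∈ Icc c d, x.q t = x'.q t ∧ x.v t = x'.v t := by
  rw [intervalIntegral.integral_of_le hcd.le, ← integral_Icc_eq_integral_Ioc,
    integral_eq_zero_iff_of_nonneg (gap_nonneg x x') (h.prim_gap h').1] at h0
  have h1 : EqOn (gap x x') 0 (Icc c d) :=
    Measure.eqOn_Icc_of_ae_eq volume hcd.ne h0 (h.continuousOn_gap h') continuousOn_const
  intro t ht
  have h2 : ‖x'.q t - x.q t‖ + ‖x'.v t - x.v t‖ = 0 := h1 ht
  have h3 : ‖x'.q t - x.q t‖ = 0 := by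
    linarith [norm_nonneg (x'.q t - x.q t), norm_nonneg (x'.v t - x.v t)]
  have h4 : ‖x'.v t - x.v t‖ = 0 := by linarith
  exact ⟨(sub_eq_zero.1 (norm_eq_zero.1 h3)).symm, (sub_eq_zero.1 (norm_eq_zero.1 h4)).symm⟩

/-- An integral inequality: the bound `k₁ ∫ gap + k s` on the gap can be integrated. -/
theorem integral_gap_le (h : S.IsArc u x c d) (h' : S.IsArc u x' c d) {t C : ℝ} {k : ℝ → ℝ}
    (ht : t ∈ Icc c d) (hk : IntegrableOn k (Icc c d))
    (hg : ∀ s ∈ Icc c t, gap x x' s ≤ C + k s) :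
    ∫ s in c..t, gap x x' s ≤ (t - c) * C + ∫ s in c..t, k s := by
  have hcI : c ∈ Icc c d := ⟨le_rfl, ht.1.trans ht.2⟩
  have hki := (IsPrimitiveOn.of_integrableOn hk).intervalIntegrable hcI ht
  have h1 : ∫ s in c..t, (C + k s) = (t - c) * C + ∫ s in c..t, k s := by
    rw [intervalIntegral.integral_add intervalIntegrable_const hki, intervalIntegral.integral_const,
      smul_eq_mul]
  rw [← h1]
  exact intervalIntegral.integral_mono_on ht.1 ((h.prim_gap h').intervalIntegrable hcI ht)
    (intervalIntegrable_const.add hki) hg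

end IsArc

end CLS

namespace IsPrimitiveOn

theorem sub {E : Type*} [NormedAddCommGroup E] [NormedSpace ℝ E] {F f G g : ℝ → E} {a b : ℝ}
    (hF : IsPrimitiveOn F f a b) (hG : IsPrimitiveOn G g a b) :
    IsPrimitiveOn (fun t => F t - G t) (fun t => f t - g t) a b := by
  refine ⟨hF.1.sub hG.1, fun t ht => ?_⟩
  have ha : a ∈ Icc a b := ⟨le_rfl, ht.1.trans ht.2⟩
  beta_reduce
  rw [hF.2 t ht, hG.2 t ht, intervalIntegral.integral_sub (hF.intervalIntegrable ha ht)
    (hG.intervalIntegrable ha ht)]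
  abel

/-- A lower bound for the derivative bounds increments from below. -/
theorem integral_le_sub {F f k : ℝ → ℝ} {a b : ℝ} (hF : IsPrimitiveOn F f a b)
    (hk : IntegrableOn k (Icc a b)) (h : ∀ᵐ s ∂(volume.restrict (Icc a b)), k s ≤ f s) {s t : ℝ}
    (hs : s ∈ Icc a b) (ht : t ∈ Icc a b) (hst : s ≤ t) : ∫ r in s..t, k r ≤ F t - F s := by
  have hK := IsPrimitiveOn.of_integrableOn hk
  have hm := (hF.sub hK).monotoneOn (by filter_upwards [h] with r hr using sub_nonneg.2 hr) hs ht hst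
  rw [← hK.sub_eq hs ht]
  beta_reduce at hm
  linarith

end IsPrimitiveOn

/-! ### Local uniqueness between impulses -/

namespace CLS

variable {n m : ℕ} {S : CLS n m}

namespace IsArc

variable {u : ℝ → Vec m} {x x' : CLSTraj n} {c d : ℝ}

/-- Along two trajectories, a smooth function of state and control differs by at most a multiple
of their distance. -/
theorem exists_lipschitz_gap (h : S.IsArc u x c d) (h' : S.IsArc u x' c d)
    (hub : ∃ K, ∀ t, ‖u t‖ ≤ K) {E : Type*} [NormedAddCommGroup E] [NormedSpace ℝ E]
    {Φ : Vec n × Vec n × Vec m → E} (hΦ : ContDiff ℝ 1 Φ) :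
    ∃ L, 0 ≤ L ∧ ∀ t ∈ Icc c d,
      ‖Φ (x'.q t, x'.v t, u t) - Φ (x.q t, x.v t, u t)‖ ≤ L * gap x x' t := by
  obtain ⟨R, hR⟩ := h.exists_bound
  obtain ⟨R', hR'⟩ := h'.exists_bound
  obtain ⟨K, hK⟩ := hub
  obtain ⟨L, hL0, hL⟩ := exists_lipschitz hΦ (max R (max R' K))
  have h1 : R ≤ max R (max R' K) := le_max_left _ _
  have h2 : R' ≤ max R (max R' K) := (le_max_left _ _).trans (le_max_right _ _)
  have h3 : K ≤ max R (max R' K) := (le_max_right _ _).trans (le_max_right _ _)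
  exact ⟨L, hL0, fun t ht => hL _ _ _ _ _ ((hR t ht).1.trans h1) ((hR t ht).2.trans h1)
    ((hR' t ht).1.trans h2) ((hR' t ht).2.trans h2) ((hK t).trans h3)⟩

theorem exists_norm_invMn_le (h : S.IsArc u x c d) :
    ∃ C, 0 ≤ C ∧ ∀ t ∈ Icc c d, ‖S.invMn (x.q t)‖ ≤ C := by
  obtain ⟨C, hC⟩ := isCompact_Icc.exists_bound_of_continuousOn
    (S.contDiff_invMn.continuous.comp_continuousOn h.prim_q.continuousOn)
  exact ⟨|C|, abs_nonneg C, fun t ht => (hC t ht).trans (le_abs_self C)⟩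

theorem contDiff_fv (S : CLS n m) :
    ContDiff ℝ 1 (fun p : Vec n × Vec n × Vec m => S.fv p.1 p.2.1 p.2.2) :=
  S.fv_smooth.of_le (by norm_num)

/-- A short initial time span on which a linear rate is at most one. -/
theorem exists_short {N : ℝ} (hN : 0 ≤ N) (hcd : c < d) :
    ∃ d' ∈ Ioc c d, (d' - c) * N ≤ 1 := by
  refine ⟨min d (c + (N + 1)⁻¹), ⟨lt_min hcd (by linarith [inv_pos.2 (by linarith : 0 < N + 1)]),
    min_le_left _ _⟩, ?_⟩
  have h1 : min d (c + (N + 1)⁻¹) - c ≤ (N + 1)⁻¹ := by linarith [min_le_right d (c + (N + 1)⁻¹)]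
  have h2 : (N + 1)⁻¹ * N ≤ 1 := by
    rw [inv_mul_le_iff₀ (by linarith)]
    linarith
  exact (mul_le_mul_of_nonneg_right h1 hN).trans h2

/-- Local uniqueness where contact is lost. -/
theorem exists_eq_of_free (h : S.IsArc u x c d) (h' : S.IsArc u x' c d) (hc2 : ContDiff ℝ 2 S.c2)
    (hub : ∃ K, ∀ t, ‖u t‖ ≤ K) (hcd : c < d) (hq : x.q c = x'.q c) (hv : x.v c = x'.v c)
    (hfree : ∀ t ∈ Ioc c d, 0 < S.fc (x.q t)) :
    ∃ d' ∈ Ioc c d, ∀ t ∈ Icc c d', x.q t = x'.q t ∧ x.v t = x'.v t := by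
  obtain ⟨L, hL0, hL⟩ := h.exists_lipschitz_gap h' hub (contDiff_fv S)
  obtain ⟨L₂, hL₂0, hL₂⟩ := h.exists_lipschitz_gap h' hub (contDiff_phi_of_c2 hc2)
  obtain ⟨C, hC0, hC⟩ := h'.exists_norm_invMn_le
  obtain ⟨δ, hδ, hD⟩ := h'.exists_D_bound
  have hne : ∀ᵐ t ∂(volume.restrict (Icc c d)), t ≠ c :=
    ae_restrict_of_ae (by simp [ae_iff, measure_singleton])
  have hlam : ∀ᵐ t ∂(volume.restrict (Icc c d)), x.lam t = 0 := by
    filter_upwards [hne, h.contact, ae_restrict_mem measurableSet_Icc] with t h1 h2 h3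
    exact h2.2 (hfree t ⟨lt_of_le_of_ne h3.1 h1.symm, h3.2⟩).ne'
  have hZi := (h.prim_gap h').1
  have hZΛ : ∀ p r : ℝ, ∀ t ∈ Icc c d, ∫ s in c..t, (p * gap x x' s + r * x'.lam s)
      = p * (∫ s in c..t, gap x x' s) + r * ∫ s in c..t, x'.lam s := by
    intro p r t ht
    have hcI : c ∈ Icc c d := ⟨le_rfl, hcd.le⟩
    rw [intervalIntegral.integral_add, intervalIntegral.integral_const_mul,
      intervalIntegral.integral_const_mul]
    · exact ((h.prim_gap h').intervalIntegrable hcI ht).const_mul p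
    · exact ((IsPrimitiveOn.of_integrableOn h'.lam_int).intervalIntegrable hcI ht).const_mul r
  have hint : ∀ p r : ℝ, IntegrableOn (fun s => p * gap x x' s + r * x'.lam s) (Icc c d) :=
    fun p r => (hZi.const_mul p).add (h'.lam_int.const_mul r)
  have hΛm : MonotoneOn (fun t => ∫ s in c..t, x'.lam s) (Icc c d) :=
    (IsPrimitiveOn.of_integrableOn h'.lam_int).monotoneOn h'.lam_nonneg
  -- Write `Z` for the integral of the gap and `Λ` for that of the second contact force. The force
  -- is not yet known to vanish, so `Λ` is kept as a separate term.
  have hgap : ∀ t ∈ Icc c d, gap x x' t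
      ≤ (1 + L) * (∫ s in c..t, gap x x' s) + C * ∫ s in c..t, x'.lam s := by
    intro t ht
    have h1 := h.norm_q_sub_le h' hq ht
    have h2 := h.prim_v.norm_sub_le h'.prim_v hv (hint L C) ?_ ht
    · rw [hZΛ L C t ht] at h2
      unfold gap at h1 h2 ⊢
      linarith
    · filter_upwards [hlam, h'.lam_nonneg, ae_restrict_mem measurableSet_Icc] with s h3 h4 hs
      have h5 : S.accel u x' s - S.accel u x s = (S.fv (x'.q s) (x'.v s) (u s) -
          S.fv (x.q s) (x.v s) (u s)) + x'.lam s • S.invMn (x'.q s) := by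
        simp only [accel, h3, zero_smul, add_zero]
        abel
      rw [h5]
      refine (norm_add_le _ _).trans (add_le_add (hL s hs) ?_)
      rw [norm_smul, Real.norm_of_nonneg h4, mul_comm]
      exact mul_le_mul_of_nonneg_right (hC s hs) h4
  -- The force acts away from the constraint, so `Λ` enters the normal velocity with a positive
  -- factor. Off contact the force is zero, so the bound on `D` at contact suffices.
  have hc2le : ∀ t ∈ Icc c d, -L₂ * (∫ s in c..t, gap x x' s) + δ * ∫ s in c..t, x'.lam s
      ≤ S.normalVel (x'.q t, x'.v t) - S.normalVel (x.q t, x.v t) := by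
    intro t ht
    have h1 := (h'.prim_normalVel.sub h.prim_normalVel).integral_le_sub (hint (-L₂) δ) ?_
      ⟨le_rfl, hcd.le⟩ ht ht.1
    · rw [hZΛ _ _ t ht] at h1
      refine h1.trans_eq ?_
      rw [hq, hv]
      ring
    · filter_upwards [hlam, h'.lam_nonneg, h'.contact, ae_restrict_mem measurableSet_Icc]
        with s h3 h4 h5 hs
      have h6 := (abs_le.1 (hL₂ s hs)).1
      have h7 : δ * x'.lam s ≤ x'.lam s * S.D (x'.q s) := by
        by_cases h0 : S.fc (x'.q s) = 0
        · rw [mul_comm]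
          exact mul_le_mul_of_nonneg_left (hD s hs h0) h4
        · rw [h5.2 h0, mul_zero, zero_mul]
      rw [h3, zero_mul, add_zero]
      beta_reduce at h6
      linarith
  -- The first summand absorbs half of `Z`, giving `Z ≤ 2 C (d' - c) Λ`; the second then gives `L₂ Z
  -- ≤ δ Λ`.
  obtain ⟨d', hd', hN⟩ := exists_short (N := 2 * (1 + L) + 2 * L₂ * C / δ) (by positivity) hcd
  have hs1 : (d' - c) * (2 * (1 + L)) ≤ 1 := by
    have : 0 ≤ (d' - c) * (2 * L₂ * C / δ) := mul_nonneg (sub_nonneg.2 hd'.1.le) (by positivity)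
    linarith
  have hs2 : (d' - c) * (2 * L₂ * C) ≤ δ := by
    have h1 : 0 ≤ (d' - c) * (2 * (1 + L)) := mul_nonneg (sub_nonneg.2 hd'.1.le) (by positivity)
    have h2 : (d' - c) * (2 * L₂ * C / δ) ≤ 1 := by linarith
    rwa [← mul_div_assoc, div_le_one hδ] at h2
  have hsub : Icc c d' ⊆ Icc c d := Icc_subset_Icc_right hd'.2
  have hZΛle : ∀ t ∈ Icc c d', ∫ s in c..t, gap x x' s
      ≤ 2 * C * (d' - c) * ∫ s in c..t, x'.lam s := by
    intro t ht
    have htI := hsub ht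
    have h1 := h.integral_gap_le h' (C := (1 + L) * (∫ s in c..t, gap x x' s)
      + C * ∫ s in c..t, x'.lam s) (k := 0) htI integrableOn_zero fun s hs => by
        have hsI : s ∈ Icc c d := ⟨hs.1, hs.2.trans htI.2⟩
        have h2 := mul_le_mul_of_nonneg_left (h.monotoneOn_gap h' hsI htI hs.2)
          (by positivity : 0 ≤ 1 + L)
        have h3 := mul_le_mul_of_nonneg_left (hΛm hsI htI hs.2) hC0
        have h4 := hgap s hsI
        beta_reduce at h2 h3
        rw [Pi.zero_apply]
        linarith
    simp only [Pi.zero_apply, intervalIntegral.integral_zero, add_zero] at h1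
    have h2 := integral_gap_nonneg x x' ht.1
    have h3 : 0 ≤ ∫ s in c..t, x'.lam s := by
      have := hΛm ⟨le_rfl, hcd.le⟩ htI ht.1
      simpa using this
    have h4 : (t - c) * ((1 + L) * (∫ s in c..t, gap x x' s) + C * ∫ s in c..t, x'.lam s) ≤
        (d' - c) * ((1 + L) * (∫ s in c..t, gap x x' s) + C * ∫ s in c..t, x'.lam s) :=
      mul_le_mul_of_nonneg_right (by linarith [ht.2]) (by positivity)
    have h5 := mul_le_mul_of_nonneg_right hs1 h2
    linarith
  -- The second solution stays at least as far from the constraint as the first, which is free. So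
  -- its force vanishes, and with `Λ = 0` also `Z = 0`.
  have hmono : MonotoneOn (fun t => S.fc (x'.q t) - S.fc (x.q t)) (Icc c d') := by
    refine ((h'.mono hd'.2).prim_fc.sub (h.mono hd'.2).prim_fc).monotoneOn ?_
    filter_upwards [ae_restrict_mem measurableSet_Icc] with t ht
    refine le_trans ?_ (hc2le t (hsub ht))
    have h1 := mul_le_mul_of_nonneg_left (hZΛle t ht) hL₂0
    have h3 : 0 ≤ ∫ s in c..t, x'.lam s := by
      have := hΛm ⟨le_rfl, hcd.le⟩ (hsub ht) ht.1
      simpa using this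
    have h2 := mul_le_mul_of_nonneg_right hs2 h3
    linarith
  have hlam' : ∀ᵐ t ∂(volume.restrict (Icc c d')), x'.lam t = 0 := by
    filter_upwards [ae_mono (Measure.restrict_mono hsub le_rfl) hne, (h'.mono hd'.2).contact,
      ae_restrict_mem measurableSet_Icc] with t h1 h2 ht
    refine h2.2 (ne_of_gt ?_)
    have h3 := hmono ⟨le_rfl, hd'.1.le⟩ ht ht.1
    have h4 := hfree t ⟨lt_of_le_of_ne ht.1 h1.symm, (hsub ht).2⟩
    beta_reduce at h3
    rw [hq, sub_self] at h3
    linarith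
  have hΛ0 : ∫ s in c..d', x'.lam s = 0 := by
    refine intervalIntegral.integral_zero_ae ?_
    rw [ae_restrict_iff' measurableSet_Icc] at hlam'
    filter_upwards [hlam'] with s hs hI
    rw [uIoc_of_le hd'.1.le] at hI
    exact hs ⟨hI.1.le, hI.2⟩
  have hZ := hZΛle d' ⟨hd'.1.le, le_rfl⟩
  rw [hΛ0, mul_zero] at hZ
  exact ⟨d', hd', (h.mono hd'.2).eq_of_integral_gap (h'.mono hd'.2) hd'.1
    (le_antisymm hZ (integral_gap_nonneg x x' hd'.1.le))⟩

/-- Local uniqueness during contact. -/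
theorem exists_eq_of_contact (h : S.IsArc u x c d) (h' : S.IsArc u x' c d)
    (hc2 : ContDiff ℝ 2 S.c2) (hub : ∃ K, ∀ t, ‖u t‖ ≤ K) (hcd : c < d) (hq : x.q c = x'.q c)
    (hv : x.v c = x'.v c) (hcon : ∀ t ∈ Icc c d, S.fc (x.q t) = 0) :
    ∃ d' ∈ Ioc c d, ∀ t ∈ Icc c d', x.q t = x'.q t ∧ x.v t = x'.v t := by
  obtain ⟨L, hL0, hL⟩ := h.exists_lipschitz_gap h' hub (contDiff_phi_of_c2 hc2)
  have hT : ContDiff ℝ 1 (fun p : Vec n × Vec n × Vec m =>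
      fderiv ℝ S.tangential (p.1, p.2.1) (p.2.1, S.fv p.1 p.2.1 p.2.2)) :=
    (((contDiff_tangential hc2).fderiv_right (m := 1) (by norm_num)).comp
      (contDiff_fst.prodMk contDiff_snd.fst)).clm_apply (contDiff_snd.fst.prodMk (contDiff_fv S))
  obtain ⟨L₂, hL₂0, hL₂⟩ := h.exists_lipschitz_gap h' hub hT
  obtain ⟨C, hC0, hC⟩ := h'.exists_norm_invMn_le
  obtain ⟨R, hR⟩ := h'.exists_bound
  obtain ⟨δ, hδ, hD⟩ := h.exists_D_bound
  have hDv : ContDiff ℝ 1 (fun p : Vec n × Vec n × Vec m => fderiv ℝ S.D p.1 p.2.1) :=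
    (((S.contDiff_D_of le_rfl (contDiff_normal_of_c2 hc2)).fderiv_right (m := 1)
      (by norm_num)).comp contDiff_fst).clm_apply contDiff_snd.fst
  obtain ⟨L₃, hL₃0, hL₃⟩ := h.exists_lipschitz_gap h' hub hDv
  have hcI : c ∈ Icc c d := ⟨le_rfl, hcd.le⟩
  have hZi := (h.prim_gap h').1
  have hR0 : 0 ≤ R := (norm_nonneg _).trans (hR c hcI).1
  have hbA : ∀ t ∈ Icc c d, S.normalVel (x.q t, x.v t) = 0 := by
    refine Measure.eqOn_Icc_of_ae_eq (g := fun _ => 0) volume hcd.ne ?_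
      h.prim_normalVel.continuousOn continuousOn_const
    filter_upwards [h.contact, ae_restrict_mem measurableSet_Icc] with t h1 ht
    exact (h1.1 (hcon t ht)).1
  have hphi : ∀ᵐ t ∂(volume.restrict (Icc c d)), S.phi (x.q t) (x.v t) (u t) ≤ 0 := by
    filter_upwards [h.contact, h.lam_nonneg, ae_restrict_mem measurableSet_Icc] with t h1 h2 ht
    rw [(h1.1 (hcon t ht)).2] at h2
    have h3 := inv_pos.2 (S.D_pos (hcon t ht))
    nlinarith
  have hcZ : ∀ p : ℝ, ∀ s t, ∫ r in s..t, p * gap x x' r = p * ∫ r in s..t, gap x x' r :=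
    fun p s t => intervalIntegral.integral_const_mul _ _
  -- After the last time with nonpositive normal velocity the second solution has no contact force,
  -- as contact would make that velocity zero almost everywhere. Its growth is then `φ`, at most `L`
  -- times the gap because `φ ≤ 0` along the first solution.
  have hb : ∀ t ∈ Icc c d, S.normalVel (x'.q t, x'.v t) ≤ L * ∫ s in c..t, gap x x' s := by
    intro t ht
    have hsubt : Icc c t ⊆ Icc c d := Icc_subset_Icc_right ht.2
    obtain ⟨s, hs, hs0, hneg⟩ := exists_last_nonneg (h := fun t => -S.normalVel (x'.q t, x'.v t))
      ht.1 (h'.prim_normalVel.continuousOn.neg.mono hsubt) (by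
        rw [← hq, ← hv, hbA c hcI, neg_zero])
    have hsI := hsubt hs
    have hst : Icc s t ⊆ Icc c d := (Icc_subset_Icc_left hs.1).trans hsubt
    have h1 : S.normalVel (x'.q t, x'.v t) - S.normalVel (x'.q s, x'.v s)
        ≤ ∫ r in s..t, L * gap x x' r := by
      rw [h'.prim_normalVel.sub_eq hsI ht]
      refine intervalIntegral.integral_mono_ae_restrict hs.2
        (h'.prim_normalVel.intervalIntegrable hsI ht)
        (((h.prim_gap h').intervalIntegrable hsI ht).const_mul L) ?_
      have hne : ∀ᵐ r ∂(volume.restrict (Icc s t)), r ≠ s :=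
        ae_restrict_of_ae (by simp [ae_iff, measure_singleton])
      filter_upwards [hne, ae_mono (Measure.restrict_mono hst le_rfl) hphi,
        ae_mono (Measure.restrict_mono hst le_rfl) h'.contact, ae_restrict_mem measurableSet_Icc]
        with r h1 h2 h3 hr
      have h4 := hneg r ⟨lt_of_le_of_ne hr.1 h1.symm, hr.2⟩
      have h5 : x'.lam r = 0 := h3.2 fun h0 => by
        rw [(h3.1 h0).1] at h4
        simp at h4
      have h6 := (abs_le.1 (hL r (hst hr))).2
      beta_reduce at h6
      rw [h5]
      linarith
    rw [hcZ] at h1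
    have h2 : ∫ r in s..t, gap x x' r ≤ ∫ r in c..t, gap x x' r := by
      rw [← (h.prim_gap h').sub_eq hsI ht]
      linarith [integral_gap_nonneg x x' hs.1]
    have h3 := mul_le_mul_of_nonneg_left h2 hL0
    linarith
  have hbint : ∀ t ∈ Icc c d, 0 ≤ ∫ s in c..t, S.normalVel (x'.q s, x'.v s) := by
    intro t ht
    rw [← h'.prim_fc.sub_eq hcI ht]
    rw [← hq, hcon c hcI, sub_zero]
    exact h'.fc_nonneg t ht
  have hgap : ∀ t ∈ Icc c d, gap x x' t ≤ (1 + δ⁻¹ * (L₂ + L₃ * R)) * (∫ s in c..t, gap x x' s)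
      + δ⁻¹ * C * |S.normalVel (x'.q t, x'.v t)| := by
    intro t ht
    have h1 := h.norm_q_sub_le h' hq ht
    have h2 := (h.prim_tangential hc2).norm_sub_le (h'.prim_tangential hc2)
      (by rw [hq, hv]) (hZi.const_mul L₂)
      (by filter_upwards [ae_restrict_mem measurableSet_Icc] with s hs using hL₂ s hs) ht
    rw [hcZ] at h2
    have h3 := (h.prim_q.comp S.contDiff_D).norm_sub_le (h'.prim_q.comp S.contDiff_D)
      (by rw [hq]) (hZi.const_mul L₃)
      (by filter_upwards [ae_restrict_mem measurableSet_Icc] with s hs using hL₃ s hs) ht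
    rw [hcZ] at h3
    -- The velocity is recovered from `tangential` and the normal velocity; the latter vanishes for
    -- the first solution.
    have h4 : S.D (x.q t) • (x'.v t - x.v t)
        = (S.tangential (x'.q t, x'.v t) - S.tangential (x.q t, x.v t))
          + S.normalVel (x'.q t, x'.v t) • S.invMn (x'.q t)
          - (S.D (x'.q t) - S.D (x.q t)) • x'.v t := by
      simp only [tangential, hbA t ht, smul_sub, sub_smul, zero_smul]
      abel
    have h5 := hD t ht (hcon t ht)
    have h6 : ‖S.D (x.q t) • (x'.v t - x.v t)‖ ≤ L₂ * (∫ s in c..t, gap x x' s)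
        + |S.normalVel (x'.q t, x'.v t)| * C + L₃ * (∫ s in c..t, gap x x' s) * R := by
      rw [h4]
      refine (norm_sub_le _ _).trans (add_le_add ((norm_add_le _ _).trans (add_le_add h2 ?_)) ?_)
      · rw [norm_smul, Real.norm_eq_abs]
        exact mul_le_mul_of_nonneg_left (hC t ht) (abs_nonneg _)
      · rw [norm_smul]
        exact mul_le_mul h3 (hR t ht).2 (norm_nonneg _)
          (mul_nonneg hL₃0 (integral_gap_nonneg x x' ht.1))
    rw [norm_smul, Real.norm_of_nonneg (hδ.le.trans h5)] at h6
    have h7 : ‖x'.v t - x.v t‖ ≤ δ⁻¹ * (L₂ * (∫ s in c..t, gap x x' s)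
        + |S.normalVel (x'.q t, x'.v t)| * C + L₃ * (∫ s in c..t, gap x x' s) * R) := by
      rw [← div_eq_inv_mul, le_div_iff₀ hδ, mul_comm]
      exact (mul_le_mul_of_nonneg_right h5 (norm_nonneg _)).trans h6
    have h8 : gap x x' t = ‖x'.q t - x.q t‖ + ‖x'.v t - x.v t‖ := rfl
    rw [h8]
    linarith
  set C₁ := 1 + δ⁻¹ * (L₂ + L₃ * R) with hC₁
  set C₂ := δ⁻¹ * C with hC₂
  have hC₁0 : 0 ≤ C₁ := by positivity
  have hC₂0 : 0 ≤ C₂ := by positivity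
  -- This rate makes the final inequality read `Z ≤ Z / 2`.
  obtain ⟨d', hd', hN⟩ := exists_short (N := 2 * (C₁ + C₂ * (2 * L))) (by positivity) hcd
  have hdI : d' ∈ Icc c d := ⟨hd'.1.le, hd'.2⟩
  have hZ0 := integral_gap_nonneg x x' hd'.1.le
  have h1 := h.integral_gap_le h' (C := (C₁ + C₂ * (2 * L)) * ∫ s in c..d', gap x x' s)
    (k := fun s => -C₂ * S.normalVel (x'.q s, x'.v s)) hdI
    (h'.prim_fc.1.const_mul _) fun s hs => by
      have hsI : s ∈ Icc c d := ⟨hs.1, hs.2.trans hd'.2⟩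
      have h2 := h.monotoneOn_gap h' hsI hdI hs.2
      -- The upper bound on the normal velocity `b` replaces `|b|` by `2 L Z - b`, and `b` has
      -- nonnegative integral because `fc ≥ 0`.
      have h3 : |S.normalVel (x'.q s, x'.v s)|
          ≤ 2 * L * (∫ s in c..d', gap x x' s) - S.normalVel (x'.q s, x'.v s) := by
        have h4 := hb s hsI
        have h5 := mul_le_mul_of_nonneg_left h2 hL0
        have h6 := mul_nonneg hL0 hZ0
        beta_reduce at h5
        rw [abs_le]
        constructor <;> linarith
      have h4 := mul_le_mul_of_nonneg_left h3 hC₂0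
      have h5 := mul_le_mul_of_nonneg_left h2 hC₁0
      beta_reduce at h5
      have h6 := hgap s hsI
      linarith
  rw [intervalIntegral.integral_const_mul] at h1
  have h2 := mul_nonneg hC₂0 (hbint d' hdI)
  have h3 := mul_le_mul_of_nonneg_right hN hZ0
  exact ⟨d', hd', (h.mono hd'.2).eq_of_integral_gap (h'.mono hd'.2) hd'.1 (by linarith)⟩

end IsArc

end CLS

/-! ### Uniqueness across impacts -/

namespace CLS

variable {n m : ℕ} {S : CLS n m}

namespace IsSolution

variable {u : ℝ → Vec m} {q0 v0 : Vec n} {tf : ℝ} {x x' : CLSTraj n}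

/-- The state before an impact determines the state after it and the impulse. -/
theorem jump_eq (hx : S.IsSolution u q0 v0 tf x) (hx' : S.IsSolution u q0 v0 tf x') {t : ℝ}
    (ht : t ∈ Icc 0 tf) (hq : x.q t = x'.q t) (hv : x.v =ᶠ[𝓝[<] t] x'.v) :
    x.v t = x'.v t ∧ x.imp t = x'.imp t := by
  have h1 := tendsto_nhds_unique ((hx.tendsto_left ht).congr' hv) (hx'.tendsto_left ht)
  have hiff : S.IsImpactTime tf x t ↔ S.IsImpactTime tf x' t := by
    rw [IsImpactTime, IsImpactTime, hx.leftLim_eq ht, hx'.leftLim_eq ht, h1, hq]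
  have himp : x.imp t = x'.imp t := by
    by_cases h : S.IsImpactTime tf x t
    · have h2 := hx.impact_law t h
      have h3 := hx'.impact_law t (hiff.1 h)
      have h4 := S.D_pos h.2.1
      -- With equal left limits the velocities after the impact differ by a multiple of `M⁻¹ n`;
      -- both have zero normal component, so `D > 0` makes the multiple zero.
      have h5 : x.v t - x'.v t = (x.imp t - x'.imp t) • S.invMn (x.q t) := by
        rw [← hq] at h1
        rw [sub_smul, sub_eq_sub_iff_sub_eq_sub, h1]
      have h6 : (x.imp t - x'.imp t) * S.D (x.q t) = 0 := by
        rw [D, ← real_inner_smul_right, ← h5, inner_sub_right, h2, hq, h3, sub_zero]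
      exact sub_eq_zero.1 ((mul_eq_zero.1 h6).resolve_right h4.ne')
    · have h2 := not_not.1 (mt hx.isImpactTime_iff.2 h)
      have h3 := not_not.1 (mt hx'.isImpactTime_iff.2 (mt hiff.2 h))
      rw [h2, h3]
  rw [himp, hq] at h1
  exact ⟨sub_left_injective h1, himp⟩

theorem eq_of_eq_before (hx : S.IsSolution u q0 v0 tf x) (hx' : S.IsSolution u q0 v0 tf x') {t : ℝ}
    (ht : t ∈ Icc 0 tf) (h : ∀ s ∈ Ico 0 t, x.v s = x'.v s) :
    x.q t = x'.q t ∧ x.v t = x'.v t ∧ x.imp t = x'.imp t := by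
  have hq : x.q t = x'.q t := by
    rw [hx.q_eq t ht, hx'.q_eq t ht]
    congr 1
    rw [intervalIntegral.integral_of_le ht.1, intervalIntegral.integral_of_le ht.1,
      integral_Ioc_eq_integral_Ioo, integral_Ioc_eq_integral_Ioo]
    exact setIntegral_congr_fun measurableSet_Ioo fun s hs => h s ⟨hs.1.le, hs.2⟩
  refine ⟨hq, hx.jump_eq hx' ht hq ?_⟩
  filter_upwards [self_mem_nhdsWithin] with s hs
  rcases le_or_gt 0 s with h0 | h0
  · exact h s ⟨h0, hs⟩
  · rw [hx.v_init s h0, hx'.v_init s h0]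

/-- Solutions in physical time continue uniquely if the contact phases do not accumulate. -/
theorem exists_eq_right (hx : S.IsSolution u q0 v0 tf x) (hx' : S.IsSolution u q0 v0 tf x')
    (hc2 : ContDiff ℝ 2 S.c2) (hub : ∃ K, ∀ t, ‖u t‖ ≤ K) {t : ℝ} (ht : t ∈ Ico 0 tf)
    (hphase : (∀ᶠ s in 𝓝[>] t, S.fc (x.q s) = 0) ∨ (∀ᶠ s in 𝓝[>] t, 0 < S.fc (x.q s)))
    (hq : x.q t = x'.q t) (hv : x.v t = x'.v t) :
    ∃ d > t, ∀ s ∈ Icc t d, x.q s = x'.q s ∧ x.v s = x'.v s := by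
  obtain ⟨d₁, hd₁, h1⟩ := eventually_no_impulse_right x t
  obtain ⟨d₂, hd₂, h2⟩ := eventually_no_impulse_right x' t
  have harcs : ∀ d ≤ min d₁ (min d₂ tf), S.IsArc u x t d ∧ S.IsArc u x' t d := by
    intro d hd
    have h3 := hd.trans (min_le_left _ _)
    have h4 := hd.trans ((min_le_right _ _).trans (min_le_left _ _))
    have h5 := hd.trans ((min_le_right _ _).trans (min_le_right _ _))
    exact ⟨hx.isArc ht.1 h5 fun s hs hI => h1 s hs ⟨hI.1, hI.2.trans h3⟩,
      hx'.isArc ht.1 h5 fun s hs hI => h2 s hs ⟨hI.1, hI.2.trans h4⟩⟩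
  have hd0 : t < min d₁ (min d₂ tf) := lt_min hd₁ (lt_min hd₂ ht.2)
  have hspan : ∀ {p : ℝ → Prop}, (∀ᶠ s in 𝓝[>] t, p s) →
      ∃ d > t, d ≤ min d₁ (min d₂ tf) ∧ ∀ s ∈ Ioc t d, p s := by
    intro p hp
    obtain ⟨e, he, hep⟩ := mem_nhdsGT_iff_exists_Ioc_subset.1 hp
    exact ⟨min e _, lt_min he hd0, min_le_right _ _,
      fun s hs => hep ⟨hs.1, hs.2.trans (min_le_left _ _)⟩⟩
  rcases hphase with hp | hp
  · obtain ⟨d, hd, hle, hps⟩ := hspan hp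
    obtain ⟨h3, h4⟩ := harcs d hle
    have hcon : ∀ s ∈ Icc t d, S.fc (x.q s) = 0 := by
      refine Measure.eqOn_Icc_of_ae_eq (g := fun _ => 0) volume (ne_of_lt hd) ?_
        h3.prim_fc.continuousOn continuousOn_const
      have hne : ∀ᵐ s ∂(volume.restrict (Icc t d)), s ≠ t :=
        ae_restrict_of_ae (by simp [ae_iff, measure_singleton])
      filter_upwards [hne, ae_restrict_mem measurableSet_Icc] with s h5 hs
      exact hps s ⟨lt_of_le_of_ne hs.1 h5.symm, hs.2⟩
    obtain ⟨d', hd', h5⟩ := h3.exists_eq_of_contact h4 hc2 hub hd hq hv hcon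
    exact ⟨d', hd'.1, h5⟩
  · obtain ⟨d, hd, hle, hps⟩ := hspan hp
    obtain ⟨h3, h4⟩ := harcs d hle
    obtain ⟨d', hd', h5⟩ := h3.exists_eq_of_free h4 hc2 hub hd hq hv hps
    exact ⟨d', hd'.1, h5⟩

/-- Solutions in physical time are unique if the contact phases of one of them do not accumulate
from the right. -/
theorem eq_on (hx : S.IsSolution u q0 v0 tf x) (hx' : S.IsSolution u q0 v0 tf x')
    (hc2 : ContDiff ℝ 2 S.c2) (hub : ∃ K, ∀ t, ‖u t‖ ≤ K)
    (hphase : ∀ t ∈ Ico 0 tf,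
      (∀ᶠ s in 𝓝[>] t, S.fc (x.q s) = 0) ∨ (∀ᶠ s in 𝓝[>] t, 0 < S.fc (x.q s))) :
    ∀ t ∈ Icc 0 tf, x.q t = x'.q t ∧ x.v t = x'.v t := by
  by_contra! hcon
  obtain ⟨t₁, ht₁, hne⟩ := hcon
  set B := {t | t ∈ Icc 0 tf ∧ ¬(x.q t = x'.q t ∧ x.v t = x'.v t)} with hB
  have ht₁B : t₁ ∈ B := ⟨ht₁, fun h => hne h.1 h.2⟩
  have hbd : BddBelow B := ⟨0, fun t ht => ht.1.1⟩
  have hb1 : sInf B ≤ t₁ := csInf_le hbd ht₁B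
  have hbI : sInf B ∈ Icc 0 tf := ⟨le_csInf ⟨_, ht₁B⟩ fun t ht => ht.1.1, hb1.trans ht₁.2⟩
  have hbefore : ∀ s ∈ Ico 0 (sInf B), x.q s = x'.q s ∧ x.v s = x'.v s := by
    intro s hs
    by_contra h
    exact hs.2.not_ge (csInf_le hbd ⟨⟨hs.1, hs.2.le.trans hbI.2⟩, h⟩)
  -- Agreement before the infimum of the disagreement set extends to the infimum, jump included, and
  -- then beyond it.
  obtain ⟨hq, hv, -⟩ := hx.eq_of_eq_before hx' hbI fun s hs => (hbefore s hs).2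
  have hlt : sInf B < t₁ := lt_of_le_of_ne hb1 fun h => ht₁B.2 (h ▸ ⟨hq, hv⟩)
  have hbo : sInf B ∈ Ico 0 tf := ⟨hbI.1, hlt.trans_le ht₁.2⟩
  obtain ⟨d, hd, heq⟩ := hx.exists_eq_right hx' hc2 hub hbo (hphase _ hbo) hq hv
  refine hd.not_ge (le_csInf ⟨_, ht₁B⟩ fun t ht => ?_)
  by_contra hn
  exact ht.2 (heq t ⟨csInf_le hbd ht, (not_le.1 hn).le⟩)

/-- Almost everywhere the contact force is a function of state and control. -/
theorem lam_ae_eq (hx : S.IsSolution u q0 v0 tf x) (hx' : S.IsSolution u q0 v0 tf x')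
    (h : ∀ t ∈ Icc 0 tf, x.q t = x'.q t ∧ x.v t = x'.v t) :
    ∀ᵐ t ∂(volume.restrict (Icc 0 tf)), x.lam t = x'.lam t := by
  filter_upwards [hx.ae_contact, hx'.ae_contact, ae_restrict_mem measurableSet_Icc] with t h1 h2 ht
  obtain ⟨hq, hv⟩ := h t ht
  by_cases h0 : S.fc (x.q t) = 0
  · rw [(h1.1 h0).2, (h2.1 (hq ▸ h0)).2, hq, hv]
  · rw [h1.2 h0, h2.2 (hq ▸ h0)]

theorem imp_eq (hx : S.IsSolution u q0 v0 tf x) (hx' : S.IsSolution u q0 v0 tf x')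
    (h : ∀ t ∈ Icc 0 tf, x.q t = x'.q t ∧ x.v t = x'.v t) : x.imp = x'.imp := by
  ext t
  by_cases ht : t ∈ Icc 0 tf
  · exact (hx.eq_of_eq_before hx' ht fun s hs => (h s ⟨hs.1, hs.2.le.trans ht.2⟩).2).2.2
  · have h1 : x.imp t = 0 := by_contra fun hn => ht (hx.imp_only t hn).1
    have h2 : x'.imp t = 0 := by_contra fun hn => ht (hx'.imp_only t hn).1
    rw [h1, h2]

theorem related_congr {a τf : ℝ} {y : ℝ → TFState n}
    (hx : S.IsSolution u q0 v0 (y τf).2.2 x) (hx' : S.IsSolution u q0 v0 (y τf).2.2 x')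
    (h : ∀ t ∈ Icc 0 (y τf).2.2, x.q t = x'.q t ∧ x.v t = x'.v t)
    (hmem : ∀ τ ∈ Icc 0 τf, (y τ).2.2 ∈ Icc 0 (y τf).2.2)
    (hr : S.Related a u τf y x) : S.Related a u τf y x' := by
  have himp := hx.imp_eq hx' h
  have hlam := hx.lam_ae_eq hx' h
  have hiff : ∀ t, S.IsImpactTime (y τf).2.2 x' t ↔ S.IsImpactTime (y τf).2.2 x t := fun t => by
    rw [hx.isImpactTime_iff, hx'.isImpactTime_iff, himp]
  have hforce : x'.contactForce (y τf).2.2 = x.contactForce (y τf).2.2 := by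
    rw [CLSTraj.contactForce, CLSTraj.contactForce, himp]
    congr 1
    refine withDensity_congr_ae ?_
    filter_upwards [hlam] with t ht
    rw [ht]
  refine ⟨fun τ hτ hn => ?_, ?_, fun ts hts => ?_⟩
  · obtain ⟨h1, h2⟩ := h _ (hmem τ hτ)
    rw [← h1, ← h2]
    exact hr.state_eq τ hτ (mt (hiff _).2 hn)
  · filter_upwards [hr.lam_eq, hlam, ae_restrict_mem measurableSet_Icc] with t h1 h2 ht τ hτ hτt
    rw [← h2, h1 τ hτ hτt, (h t ht).1, (h t ht).2]
  · rw [hforce]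
    exact hr.impulse_eq ts ((hiff ts).1 hts)

end IsSolution

/-! ### Finitely many contact phases -/

namespace IsTame

variable {a : ℝ} {u w : ℝ → Vec m} {τf : ℝ} {y : ℝ → TFState n} {θ : ℝ → ℝ}

/-- Impacts begin on the boundary of the set of contact times. -/
theorem finite_impactTimes (h : S.IsTame a u w τf y θ)
    (hfin : (frontier {τ | τ ∈ Icc 0 τf ∧ S.c1 (y τ) = 0}).Finite) :
    (S.impactTimes τf y).Finite := by
  refine (hfin.image (clock y)).subset ?_
  rintro _ ⟨σ, hσ, hi, rfl⟩
  have ht := h.isClock.mem hσ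
  have hI := h.isClock.firstTime_mem ht
  have hlt := (h.lt_last_clock hσ hi).1.trans_lt (h.lt_last_clock hσ hi).2
  have hT := h.isClock.T_firstTime ht
  have hρ := (h.impact_interval ht hlt).2.1 _ ⟨le_rfl, hlt⟩
  set ρ := firstTime (clock y) τf (clock y σ) with hρd
  refine ⟨ρ, ⟨subset_closure ⟨hI, hρ.1⟩, fun hint => ?_⟩, hT⟩
  -- If contact held around `ρ`, then by continuity of `c2` states just before `ρ` would be
  -- impacting too. The clock would already rest there, and `ρ` would not be the first time with its
  -- clock value.
  rw [mem_interior_iff_mem_nhds] at hint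
  have hIn : Icc 0 τf ∈ 𝓝 ρ := mem_of_superset hint fun τ hτ => hτ.1
  have hc : ContinuousAt (fun τ => S.c2 (y τ)) ρ :=
    S.continuous_c2.continuousAt.comp (h.clocked.prim.continuousOn.continuousAt hIn)
  have hev : ∀ᶠ τ in 𝓝 ρ, τ ∈ Icc 0 τf ∧ y τ ∈ S.Impacting := by
    filter_upwards [hint, hc.eventually_lt_const hρ.2] with τ h1 h2
    exact ⟨h1.1, h1.2, h2⟩
  obtain ⟨r, hr, hsub⟩ := mem_nhdsLE_iff_exists_Icc_subset.1 (mem_nhdsWithin_of_mem_nhds hev)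
  have hrI : r ∈ Icc 0 τf := (hsub ⟨le_rfl, le_of_lt hr⟩).1
  have hrT : clock y ρ - clock y r = 0 := by
    refine (h.clocked.prim_t.sub_eq hrI hI).trans (intervalIntegral.integral_zero_ae ?_)
    have h1 := h.clocked.ae_impacting
    rw [ae_restrict_iff' measurableSet_Icc] at h1
    filter_upwards [h1] with s hs hI
    rw [uIoc_of_le (le_of_lt hr)] at hI
    have h2 := hsub ⟨hI.1.le, hI.2⟩
    exact hs h2.1 h2.2
  have hle : ρ ≤ r := (h.isClock.firstTime_le_iff ht hrI).2 (by linarith)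
  exact hle.not_gt hr

/-- Just after the pause there are no boundary points of the contact set, so by connectedness an
interval lies either inside it or outside. -/
theorem phases (h : S.IsTame a u w τf y θ)
    (hfin : (frontier {τ | τ ∈ Icc 0 τf ∧ S.c1 (y τ) = 0}).Finite) {t : ℝ}
    (ht : t ∈ Ico 0 (clock y τf)) :
    (∀ᶠ s in 𝓝[>] t, S.c1 (y (lastTime (clock y) τf s)) = 0) ∨
      (∀ᶠ s in 𝓝[>] t, 0 < S.c1 (y (lastTime (clock y) τf s))) := by
  set C := {τ | τ ∈ Icc 0 τf ∧ S.c1 (y τ) = 0} with hC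
  have htend := h.isClock.tendsto_right ht.1 ht.2
  set σ := lastTime (clock y) τf t with hσ
  have hσI : σ ∈ Icc 0 τf := h.last_mem t
  have hlt : σ < τf := by
    refine lt_of_le_of_ne hσI.2 fun he => ht.2.ne ?_
    rw [← he]
    exact (h.isClock.T_lastTime ⟨ht.1, ht.2.le⟩).symm
  have hev : ∀ᶠ τ in 𝓝[>] σ, τ ∉ frontier C := by
    have h1 : (frontier C \ {σ})ᶜ ∈ 𝓝 σ :=
      (hfin.subset sdiff_subset).isClosed.isOpen_compl.mem_nhds fun h' => h'.2 rfl
    filter_upwards [mem_nhdsWithin_of_mem_nhds h1, self_mem_nhdsWithin] with τ h2 h3 h4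
    exact h2 ⟨h4, (ne_of_gt h3 : τ ≠ σ)⟩
  obtain ⟨e, he, hsub⟩ := mem_nhdsGT_iff_exists_Ioo_subset.1 hev
  have hmem : Ioo σ (min e τf) ∈ 𝓝[>] σ := Ioo_mem_nhdsGT (lt_min he hlt)
  have hdisj : ∀ τ ∈ Ioo σ (min e τf), τ ∉ frontier C := fun τ hτ =>
    hsub ⟨hτ.1, hτ.2.trans_le (min_le_left _ _)⟩
  by_cases hne : (Ioo σ (min e τf) ∩ interior C).Nonempty
  · left
    have hall : Ioo σ (min e τf) ⊆ interior C := by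
      refine isPreconnected_Ioo.subset_left_of_subset_union isOpen_interior
        isClosed_closure.isOpen_compl (disjoint_compl_right_iff_subset.2 interior_subset_closure)
        (fun τ hτ => ?_) hne
      by_cases hc : τ ∈ closure C
      · exact Or.inl (by_contra fun hn => hdisj τ hτ ⟨hc, hn⟩)
      · exact Or.inr hc
    filter_upwards [htend hmem] with s hs
    exact (interior_subset (hall hs)).2
  · right
    filter_upwards [htend hmem] with s hs
    have hn : lastTime (clock y) τf s ∉ C := fun hc =>
      hdisj _ hs ⟨subset_closure hc, fun hi => hne ⟨_, hs, hi⟩⟩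
    exact lt_of_le_of_ne (h.clocked.c1_nonneg h.c1_zero (h.last_mem s))
      fun h0 => hn ⟨h.last_mem s, h0.symm⟩

end IsTame

/-- Solutions of the time-freezing system and of the system in physical time are related. -/
theorem IsTFSolution.related {a : ℝ} {u w : ℝ → Vec m} {q0 v0 : Vec n} {τf : ℝ}
    {y : ℝ → TFState n} {x : CLSTraj n} (ha : 0 < a) (h0 : 0 ≤ S.fc q0) (hu : Measurable u)
    (hub : ∃ K, ∀ t, ‖u t‖ ≤ K) (hc2 : ContDiff ℝ 2 S.c2) (hτ : 0 ≤ τf)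
    (hy : S.IsTFSolution a w (q0, v0, 0) τf y) (hc : S.ControlsAgree u w τf y)
    (hf : y τf ∉ S.Impacting)
    (hfin : (frontier {τ | τ ∈ Icc 0 τf ∧ S.c1 (y τ) = 0}).Finite)
    (hx : S.IsSolution u q0 v0 (y τf).2.2 x) : S.Related a u τf y x := by
  obtain ⟨hy0, θ, ht⟩ := hy.exists_isTame ha h0 hτ hc hf
  have hr := ht.isRegular (ht.finite_impactTimes hfin)
  have hs := hr.isSolution hu hub
  rw [hy0] at hs
  -- The phase condition is needed for one of the two solutions only; it is verified for the one
  -- obtained from `y`.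
  refine hs.related_congr hx (hs.eq_on hx hc2 hub fun t htI => ht.phases hfin htI)
    (fun τ hτ => hr.isClock.mem hτ) (hr.related hu hub)

end CLS

end

theorem mainTheorem3 {n m : ℕ} (S : CLS n m) (a : ℝ) (ha : 0 < a) (q0 v0 : Vec n)
    (h0 : 0 ≤ S.fc q0) (u : ℝ → Vec m) (hu : Measurable u) (hub : ∃ K, ∀ t, ‖u t‖ ≤ K) :
    -- every solution of the time-freezing system yields a related solution of the CLS
    (∀ (w : ℝ → Vec m) (τf : ℝ) (y : ℝ → TFState n), 0 ≤ τf →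
      S.IsTFSolution a w (q0, v0, 0) τf y → S.ControlsAgree u w τf y →
      y τf ∉ S.Impacting → S.AtMostOneImpactTF τf y →
      ∃ x : CLSTraj n, S.IsSolution u q0 v0 (y τf).2.2 x ∧
        S.AtMostOneImpact (y τf).2.2 x ∧ S.Related a u τf y x) ∧
    -- every solution of the CLS comes from a related solution of the time-freezing system
    (∀ (tf : ℝ) (x : CLSTraj n), 0 ≤ tf →
      S.IsSolution u q0 v0 tf x → S.AtMostOneImpact tf x →
      ∃ (τf : ℝ) (y : ℝ → TFState n), 0 ≤ τf ∧ (y τf).2.2 = tf ∧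
        (∀ w : ℝ → Vec m, S.ControlsAgree u w τf y → S.IsTFSolution a w (q0, v0, 0) τf y) ∧
        y τf ∉ S.Impacting ∧ S.AtMostOneImpactTF τf y ∧ S.Related a u τf y x) ∧
    -- any two solutions are related if contact is made or lost only finitely often along `y`
    (ContDiff ℝ 2 S.c2 →
      ∀ (w : ℝ → Vec m) (τf : ℝ) (y : ℝ → TFState n) (x : CLSTraj n), 0 ≤ τf →
      S.IsTFSolution a w (q0, v0, 0) τf y → S.ControlsAgree u w τf y →
      y τf ∉ S.Impacting →
      (frontier {τ | τ ∈ Icc 0 τf ∧ S.c1 (y τ) = 0}).Finite →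
      S.IsSolution u q0 v0 (y τf).2.2 x →
      (S.AtMostOneImpactTF τf y ∨ S.AtMostOneImpact (y τf).2.2 x) →
      S.Related a u τf y x) := by
  exact ⟨fun w τf y hτ hy hc hf hJ => hy.exists_isSolution ha h0 hu hub hτ hc hf hJ,
    fun tf x htf hx h1 => ⟨CLS.dilate a x tf, S.freeze a tf x, (hx.dilate_mem ha ⟨htf, le_rfl⟩).1,
      hx.clock_freeze_last ha htf, fun w hw => hx.freeze_isTFSolution ha htf hw,
      hx.freeze_last_not_impacting ha htf, hx.freeze_atMostOneImpact ha htf h1,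
      hx.freeze_related ha htf⟩, fun hc2 w τf y x hτ hy hc hf hfin hx _ =>
      hy.related ha h0 hu hub hc2 hτ hc hf hfin hx⟩
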